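/- Let $\mathrm{Rat}_2$ be the space of quadratic rational maps $z\mapsto\frac{a_0z^2+a_1z+a_2}{b_0z^2+b_1z+b_2}$ of the Riemann sphere, that is, the open subset of $\mathbf{CP}^5$ of all points $(a_0:a_1:a_2:b_0:b_1:b_2)$ for which the resultant $$\det\begin{pmatrix}a_0&a_1&a_2&0\\0&a_0&a_1&a_2\\b_0&b_1&b_2&0\\0&b_0&b_1&b_2\end{pmatrix}$$ is non-zero, with the topology induced from $\mathbf{CP}^5$. Then $\mathrm{Rat}_2$ contains a compact, non-orientable, smoothly embedded manifold $M^5$ of real dimension $5$ which is a (strong) deformation retract of $\mathrm{Rat}_2$. Moreover, $M^5$ is the total space of a non-trivial principal $\mathrm{SO}(3)$-bundle over the real projective plane $\mathbf{RP}^2$, and this bundle is the unique non-trivial one: every non-trivial (topological) principal $\mathrm{SO}(3)$-bundle over $\mathbf{RP}^2$ is isomorphic to it, by an $\mathrm{SO}(3)$-equivariant homeomorphism of total spaces covering the identity of $\mathbf{RP}^2$. -/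

import Mathlib

universe u

open scoped Manifold ContDiff Topology LinearAlgebra.Projectivization

/-- The quotient topology on a projective space, induced by `v ↦ [v]` from the nonzero vectors. -/
instance projTopology (K V : Type*) [DivisionRing K] [AddCommGroup V] [Module K V]
    [TopologicalSpace V] : TopologicalSpace (ℙ K V) :=
  TopologicalSpace.coinduced (fun v : {v : V // v ≠ 0} => Projectivization.mk K v.1 v.2)
    inferInstance

/-- The resultant of `p = a₀z² + a₁z + a₂` and `q = b₀z² + b₁z + b₂`, where
`c = (a₀, a₁, a₂, b₀, b₁, b₂)`. -/
def quadResultant (c : Fin 6 → ℂ) : ℂ :=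
  Matrix.det !![c 0, c 1, c 2, 0;
                0, c 0, c 1, c 2;
                c 3, c 4, c 5, 0;
                0, c 3, c 4, c 5]

theorem quadResultant_smul (t : ℂ) (c : Fin 6 → ℂ) :
    quadResultant (t • c) = t ^ 4 * quadResultant c := by
  simp [quadResultant, Matrix.det_succ_row_zero, Fin.sum_univ_succ, Fin.succAbove]
  ring

/-- The space of quadratic rational maps `z ↦ (a₀z² + a₁z + a₂) / (b₀z² + b₁z + b₂)`: the points
`(a₀ : a₁ : a₂ : b₀ : b₁ : b₂)` of complex projective 5-space with nonzero resultant (a condition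
that does not depend on the representative, see `mk_mem_rat2Set_iff`). -/
def rat2Set : Set (ℙ ℂ (Fin 6 → ℂ)) := {x | quadResultant x.rep ≠ 0}

theorem mk_mem_rat2Set_iff (c : Fin 6 → ℂ) (hc : c ≠ 0) :
    Projectivization.mk ℂ c hc ∈ rat2Set ↔ quadResultant c ≠ 0 := by
  obtain ⟨t, ht⟩ := Projectivization.exists_smul_eq_mk_rep ℂ c hc
  have h : quadResultant (Projectivization.mk ℂ c hc).rep = (t : ℂ) ^ 4 * quadResultant c := by
    rw [← ht, ← quadResultant_smul]; rfl
  simp [rat2Set, h]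

/-- `Rat₂`, with the topology induced from complex projective 5-space. -/
abbrev Rat2 : Type := rat2Set

/-- The real projective plane. -/
abbrev RP2 : Type := ℙ ℝ (Fin 3 → ℝ)

/-- The rotation group `SO(3)`. -/
abbrev SO3 : Type := Matrix.specialOrthogonalGroup (Fin 3) ℝ

/-- `A` is a (strong) deformation retract of `X`: the identity of `X` is homotopic, through maps
fixing every point of `A`, to a map with values in `A`. -/
def IsDeformationRetract {X : Type*} [TopologicalSpace X] (A : Set X) : Prop :=
  ∃ r : C(X, X), (∀ x, r x ∈ A) ∧ (ContinuousMap.id X).HomotopicRel r A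

/-- A smooth `n`-manifold (without boundary) is orientable if it is covered by a family of smooth
charts all of whose coordinate changes have positive Jacobian determinant. -/
def IsOrientable (n : ℕ) (M : Type*) [TopologicalSpace M]
    [ChartedSpace (EuclideanSpace ℝ (Fin n)) M] : Prop :=
  ∃ A : Set (OpenPartialHomeomorph M (EuclideanSpace ℝ (Fin n))),
    A ⊆ IsManifold.maximalAtlas (𝓡 n) ∞ M ∧
    (∀ m : M, ∃ e ∈ A, m ∈ e.source) ∧
    ∀ e ∈ A, ∀ e' ∈ A, ∀ x ∈ (e.symm.trans e').source,
      0 < (fderiv ℝ (e.symm.trans e') x).det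

/-- `g` is a smooth immersion of the `n`-manifold `M` into the complex projective space of `V = ℂᴺ`
(regarded as a real manifold). Near each point `g` is `[v]` for a smooth map `v` into `V \ {0}`, and
the derivative of `g`, which is that of `v` taken modulo the complex line `ℂ v` (the tangent space
of the projective space at `[v]` being `V / ℂ v` up to scale), is injective. -/
def IsSmoothImmersionToProj (n : ℕ) {N : ℕ} {M : Type*} [TopologicalSpace M]
    [ChartedSpace (EuclideanSpace ℝ (Fin n)) M] (g : M → ℙ ℂ (Fin N → ℂ)) : Prop :=
  ∀ m : M, ∃ (U : Set M) (v : M → Fin N → ℂ), IsOpen U ∧ m ∈ U ∧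
    ContMDiffOn (𝓡 n) 𝓘(ℝ, Fin N → ℂ) ∞ v U ∧
    (∀ m' ∈ U, ∃ h : v m' ≠ 0, g m' = Projectivization.mk ℂ (v m') h) ∧
    ∀ ξ : TangentSpace (𝓡 n) m,
      (show Fin N → ℂ from mfderiv (𝓡 n) 𝓘(ℝ, Fin N → ℂ) v m ξ) ∈ Submodule.span ℂ {v m} → ξ = 0

/-- `proj : P → B` is a (topological) principal `G`-bundle for the given action of `G` on `P`: the
action is continuous and fibre-preserving, and `P` is locally, over `B`, equivariantly homeomorphic
to the product with `G`, on which `G` acts by left multiplication. (The action is written on the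
left, as for post-composition of maps; `p · g = g⁻¹ • p` is the corresponding right action.) -/
structure IsPrincipalBundle (G : Type*) {B P : Type*} [Group G] [TopologicalSpace G]
    [TopologicalSpace B] [TopologicalSpace P] [MulAction G P] (proj : P → B) : Prop where
  continuous_smul : Continuous fun x : G × P => x.1 • x.2
  proj_smul : ∀ (g : G) (p : P), proj (g • p) = proj p
  locally_trivial : ∀ b : B, ∃ e : Bundle.Trivialization G proj, b ∈ e.baseSet ∧
    ∀ p ∈ e.source, ∀ g : G, (e (g • p)).2 = g * (e p).2

/-- Isomorphism of principal `G`-bundles over `B`: an equivariant homeomorphism of the total spaces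
over the identity of `B`. -/
def PrincipalBundleIso (G : Type*) {B P P' : Type*} [Group G] [TopologicalSpace P]
    [TopologicalSpace P'] [MulAction G P] [MulAction G P'] (proj : P → B) (proj' : P' → B) : Prop :=
  ∃ φ : P ≃ₜ P', (∀ p, proj' (φ p) = proj p) ∧ ∀ (g : G) (p : P), φ (g • p) = g • φ p

/-- A principal `G`-bundle over `B` is trivial if it is isomorphic to the product `B × G`. -/
def IsTrivialPrincipalBundle (G : Type*) {B P : Type*} [Group G] [TopologicalSpace G]
    [TopologicalSpace B] [TopologicalSpace P] [MulAction G P] (proj : P → B) : Prop :=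
  ∃ φ : P ≃ₜ B × G, (∀ p, (φ p).1 = proj p) ∧
    ∀ (g : G) (p : P), φ (g • p) = ((φ p).1, g * (φ p).2)

/-!
In coordinates of the space of binary quadratic forms in which the discriminant is the sum of
squares, the resultant of two forms is, up to a constant, the determinant of their bilinear Gram
matrix. So `Rat₂` is the space of `2 × 3` complex matrices whose rows span a plane of `ℂ³` on which
the form is nondegenerate, up to a common factor. Such a plane has a normal vector with nonzero sum
of squares, which can be deformed to a multiple of a real vector; orthonormalising the rows at the
same time deforms `Rat₂` onto the set `M` of frames: pairs of orthogonal rows of equal length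
spanning the complexification of a real plane.

`M` is homogeneous under pairs of rotations of the source and the target sphere, which gives its
atlas. The target rotations alone act freely and simply transitively on the frames of a given plane,
so sending a frame to the normal line of its plane makes `M` a principal `SO(3)`-bundle over `RP²`.

A principal `SO(3)`-bundle over `RP²` has a section over the disc covering `RP²`; it jumps between
antipodal boundary points by a path in `SO(3)`, closed up to inversion, and the lift of this path to
`S³` ends at one of two signs. Since loops in `S³` extend over the disc, the sign determines the
bundle, and one of the signs is that of the trivial bundle. For `M` it is the other one.

Rotating the source and the target about the same axis, through an angle from `0` to `π`, carries
the base chart along a path of charts, which would all have the same orientation, to a chart in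
which the Jacobian is negative.
-/

section ProjectiveTopology

section

variable {K V : Type*} [DivisionRing K] [AddCommGroup V] [Module K V] [TopologicalSpace V]

theorem continuous_projMk :
    Continuous fun v : {v : V // v ≠ 0} => Projectivization.mk K v.1 v.2 :=
  continuous_coinduced_rng

theorem isOpenQuotientMap_projMk [ContinuousConstSMul K V] :
    IsOpenQuotientMap fun v : {v : V // v ≠ 0} => Projectivization.mk K v.1 v.2 := by
  refine ⟨fun x => ⟨⟨x.rep, x.rep_nonzero⟩, x.mk_rep⟩, continuous_projMk, fun s hs =>
    isOpen_coinduced.2 ?_⟩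
  have h_saturation : (fun v : {v : V // v ≠ 0} => Projectivization.mk K v.1 v.2) ⁻¹'
      ((fun v : {v : V // v ≠ 0} => Projectivization.mk K v.1 v.2) '' s) =
      ⋃ a : Kˣ, (fun v : {v : V // v ≠ 0} =>
        (⟨a • v.1, (smul_ne_zero_iff_ne a).2 v.2⟩ : {v : V // v ≠ 0})) ⁻¹' s := by
    ext v
    simp only [Set.mem_preimage, Set.mem_image, Set.mem_iUnion]
    constructor
    · rintro ⟨w, hw, h⟩
      obtain ⟨a, ha⟩ := (Projectivization.mk_eq_mk_iff K _ _ w.2 v.2).1 h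
      exact ⟨a, by simpa only [ha] using hw⟩
    · rintro ⟨a, ha⟩
      exact ⟨_, ha, (Projectivization.mk_eq_mk_iff K _ _ _ _).2 ⟨a, rfl⟩⟩
  rw [h_saturation]
  exact isOpen_iUnion fun a => hs.preimage <|
    (continuous_subtype_val.const_smul (a : K)).subtype_mk _

instance projSecondCountableTopology [ContinuousConstSMul K V] [SecondCountableTopology V] :
    SecondCountableTopology (ℙ K V) :=
  have : SecondCountableTopology {v : V // v ≠ 0} :=
    Topology.IsEmbedding.subtypeVal.secondCountableTopology
  isOpenQuotientMap_projMk.isQuotientMap.secondCountableTopology isOpenQuotientMap_projMk.isOpenMap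

end

section

variable {ι K : Type*} [Field K]

theorem projMk_eq_projMk_iff_mul_eq_mul {v w : ι → K} (hv : v ≠ 0) (hw : w ≠ 0) :
    Projectivization.mk K v hv = Projectivization.mk K w hw ↔ ∀ i j, v i * w j = v j * w i := by
  rw [Projectivization.mk_eq_mk_iff']
  constructor
  · rintro ⟨a, rfl⟩ i j
    simp only [Pi.smul_apply, smul_eq_mul]
    ring
  · intro h
    obtain ⟨i, hi⟩ := Function.ne_iff.1 hw
    refine ⟨v i / w i, funext fun j => ?_⟩
    rw [Pi.smul_apply, smul_eq_mul, div_mul_eq_mul_div, h i j, mul_div_cancel_right₀ _ hi]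

instance projT2Space [TopologicalSpace K] [ContinuousMul K] [T2Space K] :
    T2Space (ℙ K (ι → K)) := by
  refine (t2Space_iff_of_isOpenQuotientMap isOpenQuotientMap_projMk).2 ?_
  simp only [projMk_eq_projMk_iff_mul_eq_mul, Set.ofPred_forall]
  have hc (i : ι) : Continuous fun v : {v : ι → K // v ≠ 0} => v.1 i :=
    (continuous_apply i).comp continuous_subtype_val
  exact isClosed_iInter fun i => isClosed_iInter fun j =>
    isClosed_eq (((hc i).comp continuous_fst).mul ((hc j).comp continuous_snd))
      (((hc j).comp continuous_fst).mul ((hc i).comp continuous_snd))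

end

end ProjectiveTopology

section Quaternions

open Quaternion Matrix

/-- The group `S³` of unit quaternions. -/
abbrev S3 : Type := Metric.sphere (0 : ℍ[ℝ]) 1

noncomputable instance S3.instMul : Mul S3 :=
  (Metric.unitSphere.instGroup (𝕜 := ℍ[ℝ])).toMul

theorem S3.sum_sq_eq_one (q : S3) :
    q.1.re ^ 2 + q.1.imI ^ 2 + q.1.imJ ^ 2 + q.1.imK ^ 2 = 1 := by
  rw [← normSq_def', normSq_eq_norm_mul_self, norm_eq_of_mem_sphere, one_mul]

theorem mem_S3_iff (q : ℍ[ℝ]) :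
    q ∈ Metric.sphere (0 : ℍ[ℝ]) 1 ↔ q.re ^ 2 + q.imI ^ 2 + q.imJ ^ 2 + q.imK ^ 2 = 1 := by
  rw [mem_sphere_zero_iff_norm, ← normSq_def', normSq_eq_norm_mul_self, ← sq,
    pow_eq_one_iff_of_nonneg (norm_nonneg q) two_ne_zero]

instance S3.pathConnectedSpace : PathConnectedSpace S3 := by
  rw [← isPathConnected_iff_pathConnectedSpace]
  refine isPathConnected_sphere ?_ _ zero_le_one
  rw [← Module.finrank_eq_rank, Quaternion.finrank_eq_four]
  norm_num

/-- The quaternion `a + bi + cj + dk`. -/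
def quat (a b c d : ℝ) : ℍ[ℝ] := ⟨a, b, c, d⟩

@[simp] theorem quat_re (a b c d : ℝ) : (quat a b c d).re = a := rfl
@[simp] theorem quat_imI (a b c d : ℝ) : (quat a b c d).imI = b := rfl
@[simp] theorem quat_imJ (a b c d : ℝ) : (quat a b c d).imJ = c := rfl
@[simp] theorem quat_imK (a b c d : ℝ) : (quat a b c d).imK = d := rfl

theorem continuous_quat {X : Type*} [TopologicalSpace X] {a b c d : X → ℝ} (ha : Continuous a)
    (hb : Continuous b) (hc : Continuous c) (hd : Continuous d) :
    Continuous fun x => quat (a x) (b x) (c x) (d x) := by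
  have h : (fun x => quat (a x) (b x) (c x) (d x)) = fun x =>
      a x • quat 1 0 0 0 + b x • quat 0 1 0 0 + c x • quat 0 0 1 0 + d x • quat 0 0 0 1 := by
    funext x
    ext <;> simp
  rw [h]
  fun_prop

/-- The matrix of `x ↦ q x q̄` on the imaginary quaternions. -/
def rotMat (q : ℍ[ℝ]) : Matrix (Fin 3) (Fin 3) ℝ :=
  !![q.re ^ 2 + q.imI ^ 2 - q.imJ ^ 2 - q.imK ^ 2, 2 * (q.imI * q.imJ - q.re * q.imK),
      2 * (q.imI * q.imK + q.re * q.imJ);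
    2 * (q.imI * q.imJ + q.re * q.imK), q.re ^ 2 - q.imI ^ 2 + q.imJ ^ 2 - q.imK ^ 2,
      2 * (q.imJ * q.imK - q.re * q.imI);
    2 * (q.imI * q.imK - q.re * q.imJ), 2 * (q.imJ * q.imK + q.re * q.imI),
      q.re ^ 2 - q.imI ^ 2 - q.imJ ^ 2 + q.imK ^ 2]

theorem rotMat_mul (p q : ℍ[ℝ]) : rotMat (p * q) = rotMat p * rotMat q := by
  ext i j
  fin_cases i <;> fin_cases j <;>
    simp [rotMat, Matrix.mul_apply, Fin.sum_univ_three] <;> ring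

theorem rotMat_one : rotMat 1 = 1 := by
  ext i j
  fin_cases i <;> fin_cases j <;> simp [rotMat]

theorem rotMat_smul (c : ℝ) (q : ℍ[ℝ]) : rotMat (c • q) = c ^ 2 • rotMat q := by
  ext i j
  fin_cases i <;> fin_cases j <;> simp [rotMat] <;> ring

theorem rotMat_mul_transpose (q : ℍ[ℝ]) :
    rotMat q * (rotMat q)ᵀ = normSq q ^ 2 • (1 : Matrix (Fin 3) (Fin 3) ℝ) := by
  ext i j
  fin_cases i <;> fin_cases j <;>
    simp [rotMat, Matrix.mul_apply, Fin.sum_univ_three, normSq_def'] <;> ring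

theorem det_rotMat (q : ℍ[ℝ]) : (rotMat q).det = normSq q ^ 3 := by
  simp only [rotMat, det_fin_three, of_apply, cons_val, normSq_def']
  ring

theorem rotMat_mem_specialOrthogonalGroup (q : S3) :
    rotMat q.1 ∈ specialOrthogonalGroup (Fin 3) ℝ := by
  have hq : normSq q.1 = 1 := by rw [normSq_def', q.sum_sq_eq_one]
  rw [mem_specialOrthogonalGroup_iff, mem_orthogonalGroup_iff, det_rotMat, hq,
    rotMat_mul_transpose, hq]
  simp

/-- The double cover `S³ → SO(3)`. -/
noncomputable def rot : S3 →* SO3 where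
  toFun q := ⟨rotMat q.1, rotMat_mem_specialOrthogonalGroup q⟩
  map_one' := Subtype.ext rotMat_one
  map_mul' p q := Subtype.ext (rotMat_mul p.1 q.1)

theorem coe_rot (q : S3) : (rot q : Matrix (Fin 3) (Fin 3) ℝ) = rotMat q.1 := rfl

theorem continuous_rot : Continuous rot := by
  refine Continuous.subtype_mk (continuous_matrix fun i j => ?_) _
  have hre : Continuous fun q : S3 => q.1.re := continuous_re.comp continuous_subtype_val
  have hI : Continuous fun q : S3 => q.1.imI := continuous_imI.comp continuous_subtype_val
  have hJ : Continuous fun q : S3 => q.1.imJ := continuous_imJ.comp continuous_subtype_val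
  have hK : Continuous fun q : S3 => q.1.imK := continuous_imK.comp continuous_subtype_val
  fin_cases i <;> fin_cases j <;>
    simp only [rotMat, of_apply, Fin.zero_eta, Fin.mk_one, Fin.reduceFinMk, cons_val] <;> fun_prop

theorem rot_eq_one_iff (q : S3) : rot q = 1 ↔ q = 1 ∨ q = -1 := by
  constructor
  · intro h
    have hmat : rotMat q.1 = 1 := congrArg Subtype.val h
    have h00 : q.1.re ^ 2 + q.1.imI ^ 2 - q.1.imJ ^ 2 - q.1.imK ^ 2 = 1 := by
      simpa [rotMat] using congrFun (congrFun hmat 0) 0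
    have h11 : q.1.re ^ 2 - q.1.imI ^ 2 + q.1.imJ ^ 2 - q.1.imK ^ 2 = 1 := by
      simpa [rotMat] using congrFun (congrFun hmat 1) 1
    have h22 : q.1.re ^ 2 - q.1.imI ^ 2 - q.1.imJ ^ 2 + q.1.imK ^ 2 = 1 := by
      simpa [rotMat] using congrFun (congrFun hmat 2) 2
    have hn := q.sum_sq_eq_one
    have hI : q.1.imI = 0 := by nlinarith
    have hJ : q.1.imJ = 0 := by nlinarith
    have hK : q.1.imK = 0 := by nlinarith
    rcases mul_self_eq_one_iff.1 (by nlinarith : q.1.re * q.1.re = 1) with hre | hre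
    · exact .inl (Subtype.ext (QuaternionAlgebra.ext (by simp [hre]) (by simp [hI]) (by simp [hJ])
      (by simp [hK])))
    · exact .inr (Subtype.ext (QuaternionAlgebra.ext (by simp [hre]) (by simp [hI]) (by simp [hJ])
      (by simp [hK])))
  · rintro (rfl | rfl)
    · exact map_one rot
    · refine Subtype.ext ?_
      rw [coe_rot, show ((-1 : S3) : ℍ[ℝ]) = (-1 : ℝ) • 1 by simp, rotMat_smul, rotMat_one]
      simp

theorem rot_eq_rot_iff (p q : S3) : rot p = rot q ↔ p = q ∨ p = -q := by
  have hneg : -q = -1 * q := Subtype.ext (by simp)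
  rw [← mul_inv_eq_one, ← map_inv, ← map_mul, rot_eq_one_iff, mul_inv_eq_one,
    mul_inv_eq_iff_eq_mul, hneg]

theorem SO3.mul_transpose (R : SO3) : R.1 * R.1ᵀ = 1 :=
  (mem_orthogonalGroup_iff _ _).1 (mem_specialOrthogonalGroup_iff.1 R.2).1

theorem SO3.transpose_mul (R : SO3) : R.1ᵀ * R.1 = 1 :=
  mul_eq_one_comm.1 R.mul_transpose

theorem SO3.det_eq_one (R : SO3) : R.1.det = 1 :=
  (mem_specialOrthogonalGroup_iff.1 R.2).2

theorem SO3.adjugate_eq_transpose (R : SO3) : R.1.adjugate = R.1ᵀ := by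
  rw [← mul_one R.1.adjugate, ← R.mul_transpose, ← mul_assoc, adjugate_mul, R.det_eq_one, one_smul,
    one_mul]

/-- For a rotation `R` by the angle `t` about the unit axis `u`, this is
`4 cos (t / 2) • (cos (t / 2) + sin (t / 2) u)`. -/
def axisQuat (R : Matrix (Fin 3) (Fin 3) ℝ) : ℍ[ℝ] :=
  quat (1 + R.trace) (R 2 1 - R 1 2) (R 0 2 - R 2 0) (R 1 0 - R 0 1)

theorem rotMat_axisQuat (R : SO3) : rotMat (axisQuat R.1) = (4 * (1 + R.1.trace)) • R.1 := by
  have hrow := R.mul_transpose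
  have hcol := R.transpose_mul
  have hadj := R.adjugate_eq_transpose
  rw [adjugate_fin_three] at hadj
  simp only [← Matrix.ext_iff, Fin.forall_fin_succ, Matrix.mul_apply, Fin.sum_univ_three,
    transpose_apply] at hrow hcol hadj
  simp only [of_apply, cons_val, Fin.succ_zero_eq_one, Fin.succ_one_eq_two, IsEmpty.forall_iff,
    and_true, one_apply] at hrow hcol hadj
  ext i j
  fin_cases i <;> fin_cases j <;> simp [rotMat, axisQuat, trace_fin_three] <;> grind

theorem exists_rot_eq_of_rotMat_eq_smul {R : SO3} {q : ℍ[ℝ]} (hq : q ≠ 0) {c : ℝ}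
    (h : rotMat q = c • R.1) : ∃ p, rot p = R := by
  have hc : c = normSq q := by
    have hdet := congrArg det h
    rw [det_rotMat, det_smul, R.det_eq_one, mul_one, Fintype.card_fin] at hdet
    exact (Odd.strictMono_pow ⟨1, rfl⟩).injective hdet.symm
  have hn : ‖q‖ ≠ 0 := norm_ne_zero_iff.2 hq
  refine ⟨⟨‖q‖⁻¹ • q, mem_sphere_zero_iff_norm.2 (norm_smul_inv_norm (𝕜 := ℝ) hq)⟩,
    Subtype.ext ?_⟩
  rw [coe_rot, rotMat_smul, h, hc, smul_smul, normSq_eq_norm_mul_self, ← sq, ← mul_pow,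
    inv_mul_cancel₀ hn, one_pow, one_smul]

theorem exists_rot_eq_of_trace_pos (R : SO3) (hR : 0 < 1 + R.1.trace) : ∃ q, rot q = R :=
  exists_rot_eq_of_rotMat_eq_smul (fun h => hR.ne' (congrArg QuaternionAlgebra.re h))
    (rotMat_axisQuat R)

/-- One of `R`, `R·i`, `R·j`, `R·k`, where `i`, `j` and `k` act as half turns, has trace greater
than `-1`, since these four traces have sum `0`. -/
theorem rot_surjective : Function.Surjective rot := by
  intro R
  have of_mul_rot (p : S3) (hp : 0 < 1 + (R * rot p).1.trace) : ∃ q, rot q = R := by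
    obtain ⟨q, hq⟩ := exists_rot_eq_of_trace_pos _ hp
    exact ⟨q * p⁻¹, by rw [map_mul, hq, map_inv, mul_inv_cancel_right]⟩
  have htrace : 0 < 1 + R.1.trace ∨ 0 < 1 + R.1 0 0 - R.1 1 1 - R.1 2 2 ∨
      0 < 1 - R.1 0 0 + R.1 1 1 - R.1 2 2 ∨ 0 < 1 - R.1 0 0 - R.1 1 1 + R.1 2 2 := by
    rw [trace_fin_three]
    by_contra! h
    linarith
  rcases htrace with h | h | h | h
  · exact exists_rot_eq_of_trace_pos R h
  · refine of_mul_rot ⟨quat 0 1 0 0, (mem_S3_iff _).2 (by simp)⟩ ?_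
    simpa [coe_rot, rotMat, trace_fin_three, Matrix.mul_apply, Fin.sum_univ_three,
      sub_eq_add_neg, add_assoc] using h
  · refine of_mul_rot ⟨quat 0 0 1 0, (mem_S3_iff _).2 (by simp)⟩ ?_
    simpa [coe_rot, rotMat, trace_fin_three, Matrix.mul_apply, Fin.sum_univ_three,
      sub_eq_add_neg, add_assoc] using h
  · refine of_mul_rot ⟨quat 0 0 0 1, (mem_S3_iff _).2 (by simp)⟩ ?_
    simpa [coe_rot, rotMat, trace_fin_three, Matrix.mul_apply, Fin.sum_univ_three,
      sub_eq_add_neg, add_assoc] using h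

instance SO3.compactSpace : CompactSpace SO3 :=
  rot_surjective.compactSpace continuous_rot

instance SO3.isTopologicalGroup : IsTopologicalGroup SO3 where
  continuous_mul := continuous_mul
  continuous_inv :=
    Continuous.subtype_mk (f := fun R : SO3 => R.1ᵀ) continuous_subtype_val.matrix_transpose _

theorem isCoveringMap_rot : IsCoveringMap rot := by
  have hker : (rot.ker : Set S3).Finite :=
    (Set.toFinite {1, -1}).subset fun q hq => by simpa using (rot_eq_one_iff q).1 hq
  have hquot : Topology.IsQuotientMap rot :=
    continuous_rot.isClosedMap.isQuotientMap continuous_rot rot_surjective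
  exact (hquot.isQuotientCoveringMap_of_isDiscrete_ker_monoidHom hker.isDiscrete).isCoveringMap

end Quaternions

section LoopExtension

open Metric unitInterval

section Sphere

variable {X E : Type*} [TopologicalSpace X] [NormedAddCommGroup E] [NormedSpace ℝ E]

theorem norm_inv_norm_smul_mem_sphere {v : E} (hv : v ≠ 0) : ‖v‖⁻¹ • v ∈ sphere (0 : E) 1 :=
  mem_sphere_zero_iff_norm.2 (norm_smul_inv_norm (𝕜 := ℝ) hv)

/-- Normalise the straight-line homotopy. -/
theorem homotopic_of_forall_ne_neg {f g : C(X, sphere (0 : E) 1)} (h : ∀ x, f x ≠ -g x) :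
    f.Homotopic g := by
  let L : I × X → E := fun x => (1 - x.1 : ℝ) • (f x.2 : E) + (x.1 : ℝ) • (g x.2 : E)
  have hL : Continuous L := by fun_prop
  have hL0 (x : I × X) : L x ≠ 0 := by
    intro hx
    have hfg : (1 - x.1 : ℝ) • (f x.2 : E) = -((x.1 : ℝ) • (g x.2 : E)) :=
      eq_neg_of_add_eq_zero_left hx
    have ht : (1 - x.1 : ℝ) = x.1 := by
      have hnorm := congrArg norm hfg
      rwa [norm_neg, norm_smul, norm_smul, norm_eq_of_mem_sphere, norm_eq_of_mem_sphere, mul_one,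
        mul_one, Real.norm_of_nonneg (sub_nonneg.2 x.1.2.2), Real.norm_of_nonneg x.1.2.1] at hnorm
    rw [ht, ← smul_neg] at hfg
    exact h x.2 (Subtype.ext (smul_right_injective E (by linarith : (x.1 : ℝ) ≠ 0) hfg))
  exact ⟨{
    toFun := fun x => ⟨‖L x‖⁻¹ • L x, norm_inv_norm_smul_mem_sphere (hL0 x)⟩
    continuous_toFun :=
      ((hL.norm.inv₀ fun x => norm_ne_zero_iff.2 (hL0 x)).smul hL).subtype_mk _
    map_zero_left := fun x => Subtype.ext (by simp [L])
    map_one_left := fun x => Subtype.ext (by simp [L]) }⟩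

theorem nullhomotopic_of_forall_ne {f : C(X, sphere (0 : E) 1)} {v : sphere (0 : E) 1}
    (h : ∀ x, f x ≠ v) : f.Nullhomotopic :=
  ⟨-v, homotopic_of_forall_ne_neg fun x => by simpa using h x⟩

/-- A nearby `C¹` loop spans a cone of dimension at most two, which omits some vector. -/
theorem nullhomotopic_of_two_lt_finrank [FiniteDimensional ℝ E] (hE : 2 < Module.finrank ℝ E)
    (f : C(Circle, sphere (0 : E) 1)) : f.Nullhomotopic := by
  have : TietzeExtension E := .of_tvs ℝ
  have hcircle : IsClosed (Submonoid.unitSphere ℂ : Set ℂ) := isClosed_sphere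
  obtain ⟨F, hF⟩ := ContinuousMap.exists_restrict_eq hcircle
    (⟨fun x => (f x : E), by fun_prop⟩ : C(Circle, E))
  have hFf (x : Circle) : F x = f x := congrArg (fun φ => φ x) hF
  obtain ⟨p, hp, hpF, -⟩ := F.continuous.exists_contDiff_approx (ε := fun _ => 1) 1
    continuous_const (fun _ => one_pos)
  have hpf (x : Circle) : ‖p x - f x‖ < 1 := by simpa only [dist_eq_norm, hFf] using hpF x
  have hp0 (x : Circle) : p x ≠ 0 := by
    intro h
    simpa [h] using hpf x
  obtain ⟨v, hv⟩ : ∃ v : E, v ∉ Set.range fun y : ℝ × ℝ => y.1 • p (Circle.exp y.2) := by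
    have hcone : ContDiff ℝ 1 fun y : ℝ × ℝ => y.1 • p (Circle.exp y.2) :=
      contDiff_fst.smul (hp.comp (Complex.contDiff_exp.comp
        ((Complex.ofRealCLM.contDiff.comp contDiff_snd).mul contDiff_const)))
    exact (hcone.dense_compl_range_of_finrank_lt_finrank (by simpa using hE)).nonempty
  have hcone_ne (x : Circle) (s : ℝ) : s • p x ≠ v := by
    rintro rfl
    exact hv ⟨(s, Complex.arg x), by simp⟩
  have hv0 : v ≠ 0 := fun h => hcone_ne 1 0 (by rw [zero_smul, h])
  let g : C(Circle, sphere (0 : E) 1) :=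
    ⟨fun x => ⟨‖p x‖⁻¹ • p x, norm_inv_norm_smul_mem_sphere (hp0 x)⟩, by
      have hpc : Continuous fun x : Circle => p x := hp.continuous.comp continuous_subtype_val
      exact ((hpc.norm.inv₀ fun x => norm_ne_zero_iff.2 (hp0 x)).smul hpc).subtype_mk _⟩
  have hgv : g.Nullhomotopic := by
    refine nullhomotopic_of_forall_ne
      (v := ⟨‖v‖⁻¹ • v, norm_inv_norm_smul_mem_sphere hv0⟩) fun x hx => ?_
    refine hcone_ne x (‖v‖ * ‖p x‖⁻¹) ?_
    rw [mul_smul, show ‖p x‖⁻¹ • p x = ‖v‖⁻¹ • v from congrArg Subtype.val hx,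
      smul_inv_smul₀ (norm_ne_zero_iff.2 hv0)]
  have hfg : f.Homotopic g := by
    refine homotopic_of_forall_ne_neg fun x hx => (hpf x).not_ge ?_
    have hfx : (f x : E) = -(‖p x‖⁻¹ • p x) := congrArg Subtype.val hx
    have hsum : p x - f x = (‖p x‖ + 1) • (g x : E) := by
      rw [hfx, sub_neg_eq_add, add_smul, one_smul]
      exact congrArg (· + ‖p x‖⁻¹ • p x) (smul_inv_smul₀ (norm_ne_zero_iff.2 (hp0 x)) (p x)).symm
    rw [hsum, norm_smul, norm_eq_of_mem_sphere, mul_one, Real.norm_of_nonneg (by positivity)]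
    linarith [norm_nonneg (p x)]
  exact hgv.imp fun y hy => hfg.trans hy

end Sphere

theorem exists_extension_of_nullhomotopic {X : Type*} [TopologicalSpace X] {f : C(Circle, X)}
    (hf : f.Nullhomotopic) : ∃ F : C(ℂ, X), ∀ x : Circle, F x = f x := by
  obtain ⟨y, ⟨H⟩⟩ := hf
  -- the homotopy parameter is `1` near the origin, where the angular coordinate is not continuous
  let t : ℂ → I := fun z => Set.projIcc 0 1 zero_le_one (2 * (1 - ‖z‖))
  have ht : Continuous t := continuous_projIcc.comp (by fun_prop)
  let angle : ({0}ᶜ : Set ℂ) → Circle := fun z => (homeomorphUnitSphereProd ℂ z).1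
  have hangle : Continuous angle :=
    continuous_fst.comp (homeomorphUnitSphereProd ℂ).continuous
  let F : ℂ → X := Function.extend Subtype.val (fun z => H (t z.1, angle z)) fun _ => y
  have hF (z : ({0}ᶜ : Set ℂ)) : F z = H (t z.1, angle z) :=
    Subtype.val_injective.extend_apply _ _ _
  have hF0 : ∀ z ∈ ball (0 : ℂ) (1 / 2), F z = y := by
    intro z hz
    by_cases hz0 : z = 0
    · exact Function.extend_apply' _ _ _ (by simp [hz0])
    · have htz : t z = 1 := Set.projIcc_of_right_le _ (by linarith [mem_ball_zero_iff.1 hz])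
      rw [hF ⟨z, hz0⟩, htz, H.apply_one]
      rfl
  refine ⟨⟨F, continuous_iff_continuousAt.2 fun z => ?_⟩, fun x => ?_⟩
  · by_cases hz : z = 0
    · subst hz
      refine (continuousAt_const (y := y)).congr ?_
      filter_upwards [ball_mem_nhds (0 : ℂ) one_half_pos] with z hz using (hF0 z hz).symm
    · refine (isOpen_compl_singleton.isOpenEmbedding_subtypeVal.continuousAt_iff
        (x := ⟨z, hz⟩)).1 (Continuous.continuousAt ?_)
      exact (by fun_prop : Continuous fun z : ({0}ᶜ : Set ℂ) => H (t z.1, angle z)).congr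
        fun z => (hF z).symm
  · have hx0 : (x : ℂ) ≠ 0 := x.coe_ne_zero
    have htx : t x = 0 := Set.projIcc_of_le_left _ (by rw [Circle.norm_coe, sub_self, mul_zero])
    have hax : angle ⟨x, hx0⟩ = x := by
      refine Circle.ext ((homeomorphUnitSphereProd_apply_fst_coe ℂ _).trans ?_)
      rw [Circle.norm_coe, inv_one, one_smul]
    exact (hF ⟨x, hx0⟩).trans (by rw [htx, hax, H.apply_zero])

theorem exists_extension_of_circle_to_S3 (f : C(Circle, S3)) :
    ∃ F : C(ℂ, S3), ∀ x : Circle, F x = f x :=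
  exists_extension_of_nullhomotopic
    (nullhomotopic_of_two_lt_finrank (by rw [Quaternion.finrank_eq_four]; norm_num) f)

end LoopExtension

section LiftsOn

variable {X Y B P : Type*} [TopologicalSpace X] [TopologicalSpace Y] [TopologicalSpace P]
  {proj : P → B} {f : X → B} {S : Set X}

/-- The map `f` into the base lifts, over the set `S`, to a continuous map into the total space. -/
def LiftsOn (proj : P → B) (f : X → B) (S : Set X) : Prop :=
  ∃ s : X → P, ContinuousOn s S ∧ ∀ x ∈ S, proj (s x) = f x

theorem LiftsOn.mono {T : Set X} (h : LiftsOn proj f S) (hTS : T ⊆ S) : LiftsOn proj f T :=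
  h.imp fun _ hs => ⟨hs.1.mono hTS, fun x hx => hs.2 x (hTS hx)⟩

theorem LiftsOn.comp {T : Set Y} {φ : Y → X} (h : LiftsOn proj f S) (hφ : ContinuousOn φ T)
    (hTS : Set.MapsTo φ T S) : LiftsOn proj (f ∘ φ) T := by
  obtain ⟨s, hs, hsf⟩ := h
  exact ⟨s ∘ φ, hs.comp hφ hTS, fun x hx => hsf _ (hTS hx)⟩

theorem liftsOn_of_mapsTo_baseSet {F : Type*} [TopologicalSpace F] [Nonempty F]
    [TopologicalSpace B] (e : Bundle.Trivialization F proj) (hf : ContinuousOn f S)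
    (hfS : Set.MapsTo f S e.baseSet) : LiftsOn proj f S := by
  refine ⟨fun x => e.toOpenPartialHomeomorph.symm (f x, Classical.arbitrary F), ?_,
    fun x hx => e.proj_symm_apply (e.mem_target.2 (hfS hx))⟩
  exact e.toOpenPartialHomeomorph.continuousOn_symm.comp (hf.prodMk continuousOn_const)
    fun x hx => e.mem_target.2 (hfS hx)

end LiftsOn

section PrincipalBundles

variable {G B P P' : Type*} [Group G] [TopologicalSpace G] [TopologicalSpace B]
  [TopologicalSpace P] [MulAction G P] [TopologicalSpace P'] [MulAction G P']
  {proj : P → B} {proj' : P' → B}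

namespace IsPrincipalBundle

theorem exists_smul_eq (hP : IsPrincipalBundle G proj) {p p' : P} (h : proj p = proj p') :
    ∃ g : G, p' = g • p := by
  obtain ⟨e, he, heq⟩ := hP.locally_trivial (proj p)
  have hp : p ∈ e.source := e.mem_source.2 he
  have hp' : p' ∈ e.source := e.mem_source.2 (h ▸ he)
  have hgp : ((e p').2 * (e p).2⁻¹) • p ∈ e.source := e.mem_source.2 (by rwa [hP.proj_smul])
  refine ⟨(e p').2 * (e p).2⁻¹, e.injOn hp' hgp (Prod.ext ?_ ?_)⟩
  · exact (e.coe_fst hp').trans ((e.coe_fst hgp).trans ((hP.proj_smul _ p).trans h)).symm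
  · exact ((heq p hp _).trans (inv_mul_cancel_right _ _)).symm

theorem smul_right_injective (hP : IsPrincipalBundle G proj) (p : P) :
    Function.Injective fun g : G => g • p := by
  intro g g' h
  obtain ⟨e, he, heq⟩ := hP.locally_trivial (proj p)
  have hp : p ∈ e.source := e.mem_source.2 he
  have hfib : (e (g • p)).2 = (e (g' • p)).2 := congrArg (fun p => (e p).2) h
  rw [heq p hp, heq p hp] at hfib
  exact mul_right_cancel hfib

theorem eq_one_of_smul_eq_self (hP : IsPrincipalBundle G proj) {p : P} {g : G} (h : g • p = p) :
    g = 1 :=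
  hP.smul_right_injective p (h.trans (one_smul G p).symm)

theorem continuous_proj (hP : IsPrincipalBundle G proj) : Continuous proj := by
  refine continuous_iff_continuousAt.2 fun p => ?_
  obtain ⟨e, he, -⟩ := hP.locally_trivial (proj p)
  exact e.continuousAt_proj (e.mem_source.2 he)

theorem t2Space [T2Space B] [T2Space G] (hP : IsPrincipalBundle G proj) : T2Space P := by
  rw [t2Space_iff_disjoint_nhds]
  intro p p' hne
  by_cases h : proj p = proj p'
  · obtain ⟨e, he, -⟩ := hP.locally_trivial (proj p)
    have hp : p ∈ e.source := e.mem_source.2 he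
    have hp' : p' ∈ e.source := e.mem_source.2 (h ▸ he)
    exact (e.continuousAt hp).tendsto.disjoint
      (disjoint_nhds_nhds.2 fun h => hne (e.injOn hp hp' h)) (e.continuousAt hp').tendsto
  · exact hP.continuous_proj.continuousAt.tendsto.disjoint (disjoint_nhds_nhds.2 h)
      hP.continuous_proj.continuousAt.tendsto

theorem exists_continuousOn_smul_eq [IsTopologicalGroup G] (hP : IsPrincipalBundle G proj)
    {X : Type*} [TopologicalSpace X] {S : Set X} {a b : X → P} (ha : ContinuousOn a S)
    (hb : ContinuousOn b S) (hab : ∀ x ∈ S, proj (a x) = proj (b x)) :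
    ∃ g : X → G, ContinuousOn g S ∧ ∀ x ∈ S, b x = g x • a x := by
  have hdiv (x : X) : ∃ g : G, x ∈ S → b x = g • a x := by
    by_cases hx : x ∈ S
    · exact (hP.exists_smul_eq (hab x hx)).imp fun g hg _ => hg
    · exact ⟨1, fun h => absurd h hx⟩
  choose g hg using hdiv
  refine ⟨g, fun x hx => ?_, hg⟩
  obtain ⟨e, he, heq⟩ := hP.locally_trivial (proj (a x))
  have hax : a x ∈ e.source := e.mem_source.2 he
  have hbx : b x ∈ e.source := e.mem_source.2 (hab x hx ▸ he)
  have hquot : ContinuousWithinAt (fun y => (e (b y)).2 * (e (a y)).2⁻¹) S x :=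
    (continuous_snd.continuousAt.comp_continuousWithinAt
      ((e.continuousAt hbx).comp_continuousWithinAt (hb x hx))).mul
    (continuous_snd.continuousAt.comp_continuousWithinAt
      ((e.continuousAt hax).comp_continuousWithinAt (ha x hx))).inv
  refine hquot.congr_of_eventuallyEq ?_ ?_
  · filter_upwards [self_mem_nhdsWithin, (ha x hx) (e.open_source.mem_nhds hax)] with y hy hay
    rw [hg y hy, heq _ hay, mul_inv_cancel_right]
  · rw [hg x hx, heq _ hax, mul_inv_cancel_right]

section Lifting

variable [IsTopologicalGroup G] (hP : IsPrincipalBundle G proj)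
include hP

theorem liftsOn_union {X : Type*} [TopologicalSpace X] {f : X → B} {S T : Set X}
    (hS : IsClosed S) (hT : IsClosed T) {r : X → X} (hr : Continuous r)
    (hrT : Set.MapsTo r T (S ∩ T)) (hrid : ∀ x ∈ S ∩ T, r x = x)
    (hfS : LiftsOn proj f S) (hfT : LiftsOn proj f T) : LiftsOn proj f (S ∪ T) := by
  classical
  obtain ⟨s, hs, hsf⟩ := hfS
  obtain ⟨t, ht, htf⟩ := hfT
  obtain ⟨g, hg, hgst⟩ := hP.exists_continuousOn_smul_eq (ht.mono Set.inter_subset_right)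
    (hs.mono Set.inter_subset_left)
    (fun x (hx : x ∈ S ∩ T) => (htf x hx.2).trans (hsf x hx.1).symm)
  -- translate the lift over `T` so as to agree with the lift over `S` on the intersection
  let u : X → P := fun x => if x ∈ S then s x else g (r x) • t x
  have huS : ∀ x ∈ S, u x = s x := fun x hx => if_pos hx
  have huT : ∀ x ∈ T, u x = g (r x) • t x := by
    intro x hx
    by_cases hxS : x ∈ S
    · rw [huS x hxS, hrid x ⟨hxS, hx⟩, hgst x ⟨hxS, hx⟩]
    · exact if_neg hxS
  refine ⟨u, ContinuousOn.union_of_isClosed (hs.congr huS) ?_ hS hT, ?_⟩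
  · exact (hP.continuous_smul.comp_continuousOn
      ((hg.comp hr.continuousOn hrT).prodMk ht)).congr huT
  · rintro x (hx | hx)
    · rw [huS x hx, hsf x hx]
    · rw [huT x hx, hP.proj_smul, htf x hx]

open unitInterval

theorem liftsOn_prod_univ {Y : Type*} [TopologicalSpace Y] {A : Set Y} (hA : IsClosed A)
    {f : Y × I → B} {t : ℕ → I} (ht : Monotone t) (ht0 : t 0 = 0) (ht1 : ∃ n, t n = 1)
    (h : ∀ n, LiftsOn proj f (A ×ˢ Set.Icc (t n) (t (n + 1)))) :
    LiftsOn proj f (A ×ˢ Set.univ) := by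
  have hIcc (n : ℕ) : LiftsOn proj f (A ×ˢ Set.Icc 0 (t n)) := by
    induction n with
    | zero =>
      rw [← ht0]
      exact (h 0).mono (Set.prod_mono_right (Set.Icc_subset_Icc_right (ht zero_le_one)))
    | succ n ih =>
      have hle : t n ≤ t (n + 1) := ht n.le_succ
      rw [← Set.Icc_union_Icc_eq_Icc (nonneg' (t := t n)) hle, Set.prod_union]
      refine hP.liftsOn_union (hA.prod isClosed_Icc) (hA.prod isClosed_Icc)
        (r := fun x => (x.1, t n)) (by fun_prop) ?_ ?_ ih (h n)
      · exact fun x hx => ⟨⟨hx.1, nonneg', le_rfl⟩, hx.1, le_rfl, hle⟩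
      · exact fun x hx => Prod.ext rfl (le_antisymm hx.2.2.1 hx.1.2.2)
  obtain ⟨n, hn⟩ := ht1
  exact (hIcc n).mono fun x hx => ⟨hx.1, nonneg', hn ▸ le_one'⟩

theorem liftsOn_unitSquare {f : I × I → B} (hf : Continuous f) :
    LiftsOn proj f Set.univ := by
  choose e he _ using hP.locally_trivial
  obtain ⟨t, ht0, ht, ⟨N, hN⟩, hcell⟩ :=
    exists_monotone_Icc_subset_open_cover_unitInterval_prod_self
      (c := fun b => f ⁻¹' (e b).baseSet) (fun b => (e b).open_baseSet.preimage hf)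
      (fun x _ => Set.mem_iUnion.2 ⟨f x, he (f x)⟩)
  have ht1 : ∃ n, t n = 1 := ⟨N, hN N le_rfl⟩
  have hstrip (n : ℕ) : LiftsOn proj f (Set.Icc (t n) (t (n + 1)) ×ˢ Set.univ) := by
    refine hP.liftsOn_prod_univ isClosed_Icc ht ht0 ht1 fun m => ?_
    obtain ⟨b, hb⟩ := hcell n m
    exact liftsOn_of_mapsTo_baseSet (e b) hf.continuousOn hb
  have hswap : LiftsOn proj (f ∘ Prod.swap) (Set.univ ×ˢ Set.univ) :=
    hP.liftsOn_prod_univ isClosed_univ ht ht0 ht1 fun n =>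
      (hstrip n).comp continuous_swap.continuousOn fun x hx => ⟨hx.2, trivial⟩
  exact hswap.comp continuous_swap.continuousOn fun x _ => ⟨trivial, trivial⟩

end Lifting

section Isomorphism

variable [IsTopologicalGroup G] (hP : IsPrincipalBundle G proj) (hP' : IsPrincipalBundle G proj')
include hP hP'

theorem iso_of_equivariant {φ : P → P'} (hφ : Continuous φ) (hproj : ∀ p, proj' (φ p) = proj p)
    (hsmul : ∀ (g : G) (p : P), φ (g • p) = g • φ p) : PrincipalBundleIso G proj proj' := by
  have hinj : Function.Injective φ := by
    intro p p' h
    obtain ⟨g, rfl⟩ := hP.exists_smul_eq (show proj p = proj p' by rw [← hproj, ← hproj, h])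
    rw [hsmul] at h
    rw [hP'.eq_one_of_smul_eq_self h.symm, one_smul]
  have hlocal (b : B) : ∃ U : Set B, IsOpen U ∧ b ∈ U ∧ ∃ ψ : P' → P,
      ContinuousOn ψ (proj' ⁻¹' U) ∧ ∀ p' ∈ proj' ⁻¹' U, φ (ψ p') = p' := by
    obtain ⟨e, he, -⟩ := hP.locally_trivial b
    obtain ⟨s, hs, hsp⟩ := liftsOn_of_mapsTo_baseSet e continuousOn_id (Set.mapsTo_id e.baseSet)
    have hsc : ContinuousOn (fun p' => s (proj' p')) (proj' ⁻¹' e.baseSet) :=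
      hs.comp hP'.continuous_proj.continuousOn fun _ h => h
    obtain ⟨g, hg, hgs⟩ := hP'.exists_continuousOn_smul_eq (hφ.comp_continuousOn hsc)
      continuousOn_id (fun p' hp' => (hproj _).trans (hsp _ hp'))
    exact ⟨e.baseSet, e.open_baseSet, he, fun p' => g p' • s (proj' p'),
      hP.continuous_smul.comp_continuousOn (hg.prodMk hsc),
      fun p' hp' => (hsmul _ _).trans (hgs p' hp').symm⟩
  have hsurj : Function.Surjective φ := by
    intro p'
    obtain ⟨U, -, hU, ψ, -, hψ⟩ := hlocal (proj' p')
    exact ⟨ψ p', hψ p' hU⟩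
  let φe : P ≃ P' := Equiv.ofBijective φ ⟨hinj, hsurj⟩
  have hinv : Continuous φe.symm := by
    refine continuous_iff_continuousAt.2 fun p' => ?_
    obtain ⟨U, hUo, hU, ψ, hψc, hψ⟩ := hlocal (proj' p')
    have hUp' : proj' ⁻¹' U ∈ 𝓝 p' := (hUo.preimage hP'.continuous_proj).mem_nhds hU
    refine (hψc.continuousAt hUp').congr ?_
    filter_upwards [hUp'] with x hx using φe.eq_symm_apply.2 (hψ x hx)
  exact ⟨⟨φe, hφ, hinv⟩, hproj, hsmul⟩

/-- The total space is a quotient of `G × K`, so the isomorphism is `g • s z ↦ g • s' z`. -/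
theorem iso_of_compatible_lifts [T2Space B] [T2Space G] [CompactSpace G]
    {K : Type*} [TopologicalSpace K] [CompactSpace K] {q : K → B} (hq : Function.Surjective q)
    {s : K → P} {s' : K → P'} (hs : Continuous s) (hs' : Continuous s')
    (hsq : ∀ z, proj (s z) = q z) (hsq' : ∀ z, proj' (s' z) = q z)
    (hcomp : ∀ z w, ∀ g : G, s w = g • s z → s' w = g • s' z) :
    PrincipalBundleIso G proj proj' := by
  have := hP.t2Space
  let m : C(G × K, P) :=
    ⟨fun x => x.1 • s x.2, hP.continuous_smul.comp (continuous_fst.prodMk (hs.comp continuous_snd))⟩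
  let m' : C(G × K, P') :=
    ⟨fun x => x.1 • s' x.2,
      hP'.continuous_smul.comp (continuous_fst.prodMk (hs'.comp continuous_snd))⟩
  have hsurj : Function.Surjective m := by
    intro p
    obtain ⟨z, hz⟩ := hq (proj p)
    obtain ⟨g, hg⟩ := hP.exists_smul_eq ((hsq z).trans hz)
    exact ⟨(g, z), hg.symm⟩
  have hquot : Topology.IsQuotientMap m :=
    m.continuous.isClosedMap.isQuotientMap m.continuous hsurj
  have hfactor : Function.FactorsThrough m' m := by
    intro x y h
    have hxy : s y.2 = (y.1⁻¹ * x.1) • s x.2 := by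
      rw [mul_smul, show x.1 • s x.2 = y.1 • s y.2 from h, inv_smul_smul]
    change x.1 • s' x.2 = y.1 • s' y.2
    rw [hcomp _ _ _ hxy, mul_smul, smul_inv_smul]
  let φ : C(P, P') := hquot.lift m' hfactor
  have hφ (x : G × K) : φ (m x) = m' x :=
    congrArg (fun ψ : C(G × K, P') => ψ x) (hquot.lift_comp m' hfactor)
  refine hP.iso_of_equivariant hP' φ.continuous (fun p => ?_) fun g p => ?_
  · obtain ⟨x, rfl⟩ := hsurj p
    rw [hφ]
    exact ((hP'.proj_smul _ _).trans (hsq' _)).trans ((hP.proj_smul _ _).trans (hsq _)).symm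
  · obtain ⟨x, rfl⟩ := hsurj p
    rw [show g • m x = m (g * x.1, x.2) from (mul_smul _ _ _).symm, hφ, hφ]
    exact mul_smul _ _ _

end Isomorphism

end IsPrincipalBundle

end PrincipalBundles

section DiscModel

theorem sq_norm_eq_re_sq_add_im_sq (z : ℂ) : ‖z‖ ^ 2 = z.re ^ 2 + z.im ^ 2 := by
  rw [← Complex.normSq_eq_norm_sq, Complex.normSq_apply, sq, sq]

/-- The point of the upper unit hemisphere of `ℝ³` above `z`. Outside the unit disc the square root
is `0`, and this is the point `z` of the horizontal plane. -/
noncomputable def discVec (z : ℂ) : Fin 3 → ℝ := ![z.re, z.im, √(1 - ‖z‖ ^ 2)]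

theorem discVec_ne_zero (z : ℂ) : discVec z ≠ 0 := by
  intro h
  have hz : z = 0 := Complex.ext (congrFun h 0) (congrFun h 1)
  simpa [hz, discVec] using congrFun h 2

theorem continuous_discVec : Continuous discVec := by
  refine continuous_pi fun i => ?_
  fin_cases i
  · exact Complex.continuous_re
  · exact Complex.continuous_im
  · exact (by fun_prop : Continuous fun z : ℂ => √(1 - ‖z‖ ^ 2))

theorem discVec_sq_sum {z : ℂ} (hz : ‖z‖ ≤ 1) :
    discVec z 0 ^ 2 + discVec z 1 ^ 2 + discVec z 2 ^ 2 = 1 := by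
  change z.re ^ 2 + z.im ^ 2 + √(1 - ‖z‖ ^ 2) ^ 2 = 1
  rw [Real.sq_sqrt (by nlinarith [norm_nonneg z]), sq_norm_eq_re_sq_add_im_sq]
  ring

/-- The projection of the closed unit disc onto the projective plane, extended to the plane. -/
noncomputable def discToRP2 (z : ℂ) : RP2 := Projectivization.mk ℝ (discVec z) (discVec_ne_zero z)

theorem continuous_discToRP2 : Continuous discToRP2 :=
  continuous_projMk.comp (continuous_discVec.subtype_mk discVec_ne_zero)

/-- The radial retraction of the plane onto the closed unit disc. -/
noncomputable def clampDisc (z : ℂ) : ℂ := (max 1 ‖z‖)⁻¹ • z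

theorem continuous_clampDisc : Continuous clampDisc :=
  ((continuous_const.max continuous_norm).inv₀ fun _ =>
    (one_pos.trans_le (le_max_left _ _)).ne').smul continuous_id

theorem norm_clampDisc_le (z : ℂ) : ‖clampDisc z‖ ≤ 1 := by
  have hpos : 0 < max 1 ‖z‖ := one_pos.trans_le (le_max_left _ _)
  rw [clampDisc, norm_smul, norm_inv, Real.norm_of_nonneg hpos.le, inv_mul_le_iff₀ hpos, mul_one]
  exact le_max_right _ _

theorem clampDisc_of_norm_le_one {z : ℂ} (hz : ‖z‖ ≤ 1) : clampDisc z = z := by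
  rw [clampDisc, max_eq_left hz, inv_one, one_smul]

theorem discToRP2_clampDisc (z : ℂ) : discToRP2 (clampDisc z) = discToRP2 z := by
  rcases le_total ‖z‖ 1 with h | h
  · rw [clampDisc_of_norm_le_one h]
  · have hz : 0 < ‖z‖ := one_pos.trans_le h
    have hnorm : ‖‖z‖⁻¹ • z‖ = 1 := by
      rw [norm_smul, norm_inv, norm_norm, inv_mul_cancel₀ hz.ne']
    have hsqrt : √(1 - ‖z‖ ^ 2) = 0 := Real.sqrt_eq_zero_of_nonpos (by nlinarith)
    rw [clampDisc, max_eq_right h]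
    refine (Projectivization.mk_eq_mk_iff' ℝ _ _ _ _).2 ⟨‖z‖⁻¹, ?_⟩
    ext i
    fin_cases i
    · simp [discVec]
    · simp [discVec]
    · change ‖z‖⁻¹ * √(1 - ‖z‖ ^ 2) = √(1 - ‖‖z‖⁻¹ • z‖ ^ 2)
      rw [hsqrt, hnorm, mul_zero, one_pow, sub_self, Real.sqrt_zero]

theorem discToRP2_neg {z : ℂ} (hz : ‖z‖ = 1) : discToRP2 (-z) = discToRP2 z := by
  refine (Projectivization.mk_eq_mk_iff' ℝ _ _ _ _).2 ⟨-1, ?_⟩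
  ext i
  fin_cases i <;> simp [discVec, hz]

theorem eq_or_eq_neg_of_discToRP2_eq {z w : ℂ} (hz : ‖z‖ ≤ 1) (hw : ‖w‖ ≤ 1)
    (h : discToRP2 z = discToRP2 w) : w = z ∨ (w = -z ∧ ‖z‖ = 1) := by
  obtain ⟨a, ha⟩ := (Projectivization.mk_eq_mk_iff' ℝ _ _ _ _).1 h
  have hre : a * w.re = z.re := congrFun ha 0
  have him : a * w.im = z.im := congrFun ha 1
  have hsqrt : a * √(1 - ‖w‖ ^ 2) = √(1 - ‖z‖ ^ 2) := congrFun ha 2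
  have ha2 : a * a = 1 := by
    have hsum := discVec_sq_sum hz
    simp only [← ha, Pi.smul_apply, smul_eq_mul] at hsum
    linear_combination hsum - a ^ 2 * discVec_sq_sum hw
  rcases mul_self_eq_one_iff.1 ha2 with rfl | rfl
  · exact .inl (Complex.ext (by linarith) (by linarith))
  · refine .inr ⟨Complex.ext (by rw [Complex.neg_re]; linarith) (by rw [Complex.neg_im]; linarith),
      hz.antisymm ?_⟩
    have hzero : √(1 - ‖z‖ ^ 2) = 0 :=
      le_antisymm (by linarith [Real.sqrt_nonneg (1 - ‖w‖ ^ 2)]) (Real.sqrt_nonneg _)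
    nlinarith [Real.sqrt_eq_zero'.1 hzero, norm_nonneg z]

theorem sum_sq_pos {n : Fin 3 → ℝ} (hn : n ≠ 0) : 0 < n 0 ^ 2 + n 1 ^ 2 + n 2 ^ 2 := by
  rw [← Fin.sum_univ_three fun i => n i ^ 2]
  obtain ⟨i, hi⟩ := Function.ne_iff.1 hn
  exact Finset.sum_pos' (fun j _ => sq_nonneg (n j)) ⟨i, Finset.mem_univ i, sq_pos_of_ne_zero hi⟩

theorem exists_discToRP2_eq (x : RP2) : ∃ z : ℂ, ‖z‖ ≤ 1 ∧ discToRP2 z = x := by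
  induction x using Projectivization.ind with
  | h v hv =>
  wlog hv2 : 0 ≤ v 2 generalizing v
  · obtain ⟨z, hz, h⟩ := this (-v) (neg_ne_zero.2 hv) (neg_nonneg.2 (not_le.1 hv2).le)
    refine ⟨z, hz, h.trans ?_⟩
    exact (Projectivization.mk_eq_mk_iff' ℝ _ _ _ _).2 ⟨-1, by simp⟩
  have hpos := sum_sq_pos hv
  set r := √(v 0 ^ 2 + v 1 ^ 2 + v 2 ^ 2)
  have hr0 : 0 < r := Real.sqrt_pos.2 hpos
  have hr2 : r ^ 2 = v 0 ^ 2 + v 1 ^ 2 + v 2 ^ 2 := Real.sq_sqrt hpos.le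
  have hnorm : ‖(⟨v 0 / r, v 1 / r⟩ : ℂ)‖ ^ 2 = 1 - (v 2 / r) ^ 2 := by
    rw [sq_norm_eq_re_sq_add_im_sq]
    field_simp
    linear_combination -hr2
  refine ⟨⟨v 0 / r, v 1 / r⟩, ?_, ?_⟩
  · nlinarith [norm_nonneg (⟨v 0 / r, v 1 / r⟩ : ℂ), sq_nonneg (v 2 / r)]
  · refine (Projectivization.mk_eq_mk_iff' ℝ _ _ _ _).2 ⟨r⁻¹, ?_⟩
    have hsqrt : √(1 - ‖(⟨v 0 / r, v 1 / r⟩ : ℂ)‖ ^ 2) = v 2 / r := by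
      rw [hnorm, sub_sub_cancel, Real.sqrt_sq (by positivity)]
    ext i
    fin_cases i
    · exact (div_eq_inv_mul (v 0) r).symm
    · exact (div_eq_inv_mul (v 1) r).symm
    · exact (div_eq_inv_mul (v 2) r).symm.trans hsqrt.symm

end DiscModel

section CircleMaps

theorem coe_circleExp_add_pi (θ : ℝ) :
    (Circle.exp (θ + Real.pi) : ℂ) = -(Circle.exp θ : ℂ) := by
  rw [Circle.exp_add, Circle.coe_mul, Circle.coe_exp Real.pi, Complex.exp_pi_mul_I, mul_neg_one]

theorem coe_circleExp_arg {z : ℂ} (hz : ‖z‖ = 1) : (Circle.exp z.arg : ℂ) = z :=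
  congrArg Subtype.val (Circle.exp_arg ⟨z, mem_sphere_zero_iff_norm.2 hz⟩)

theorem exists_circle_map {X : Type*} [TopologicalSpace X] {κ : ℝ → X} (hκ : Continuous κ)
    (h : κ 0 = κ (2 * Real.pi)) :
    ∃ f : C(Circle, X), ∀ θ ∈ Set.Icc 0 (2 * Real.pi), f (Circle.exp θ) = κ θ := by
  have : Fact (0 < 2 * Real.pi) := ⟨Real.two_pi_pos⟩
  have hlift : Continuous (AddCircle.liftIco (2 * Real.pi) 0 κ) :=
    AddCircle.liftIco_continuous (by rwa [zero_add]) hκ.continuousOn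
  have hIco : ∀ θ ∈ Set.Ico 0 (2 * Real.pi), AddCircle.liftIco (2 * Real.pi) 0 κ
      (AddCircle.homeomorphCircle'.symm (Circle.exp θ)) = κ θ := by
    intro θ hθ
    rw [← AddCircle.homeomorphCircle'_apply_mk, Homeomorph.symm_apply_apply]
    exact AddCircle.liftIco_coe_apply (by rwa [zero_add])
  refine ⟨⟨_, hlift.comp AddCircle.homeomorphCircle'.symm.continuous⟩, fun θ hθ => ?_⟩
  rcases hθ.2.lt_or_eq with hlt | rfl
  · exact hIco θ ⟨hθ.1, hlt⟩
  · rw [← h, ← hIco 0 ⟨le_rfl, Real.two_pi_pos⟩, Circle.exp_two_pi, Circle.exp_zero]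
    rfl

/-- Join `1` to `g 0 * (g' 0)⁻¹` over the first half circle. The twist prescribes the values over
the second half circle, and the hypothesis says that they close up. -/
theorem exists_circle_map_of_twist {H : Type*} [Group H] [TopologicalSpace H]
    [IsTopologicalGroup H] [PathConnectedSpace H] {g g' : ℝ → H} (hg : Continuous g)
    (hg' : Continuous g') (h : g Real.pi * g 0 = g' Real.pi * g' 0) :
    ∃ f : C(Circle, H), ∀ θ ∈ Set.Icc 0 Real.pi,
      f (Circle.exp (θ + Real.pi)) = g θ * f (Circle.exp θ) * (g' θ)⁻¹ := by
  have hπ := Real.pi_pos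
  let γ : Path (1 : H) (g 0 * (g' 0)⁻¹) := PathConnectedSpace.somePath _ _
  let κ₁ : ℝ → H := fun θ => γ.extend (θ / Real.pi)
  let κ₂ : ℝ → H := fun θ => g (θ - Real.pi) * κ₁ (θ - Real.pi) * (g' (θ - Real.pi))⁻¹
  let κ : ℝ → H := fun θ => if θ ≤ Real.pi then κ₁ θ else κ₂ θ
  have hκ₁ : Continuous κ₁ := γ.continuous_extend.comp (continuous_id.div_const _)
  have hκ₁0 : κ₁ 0 = 1 := by simp [κ₁]
  have hκ₁π : κ₁ Real.pi = g 0 * (g' 0)⁻¹ := by simp [κ₁, hπ.ne']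
  have hκ₂π : κ₂ Real.pi = κ₁ Real.pi := by simp only [κ₂, sub_self, hκ₁0, hκ₁π, mul_one]
  have hκle : ∀ θ ≤ Real.pi, κ θ = κ₁ θ := fun θ hθ => if_pos hθ
  have hκge : ∀ θ ≥ Real.pi, κ θ = κ₂ θ := by
    intro θ hθ
    rcases hθ.eq_or_lt with rfl | hθ
    · rw [hκle _ le_rfl, hκ₂π]
    · exact if_neg hθ.not_ge
  have hκ : Continuous κ := by
    refine Continuous.if_le hκ₁ ?_ continuous_id continuous_const fun θ hθ => ?_
    · exact ((hg.comp (by fun_prop)).mul (hκ₁.comp (by fun_prop))).mul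
        (hg'.comp (by fun_prop)).inv
    · rw [hθ, hκ₂π]
  have htwist : ∀ θ ∈ Set.Icc 0 Real.pi, κ (θ + Real.pi) = g θ * κ θ * (g' θ)⁻¹ := by
    intro θ hθ
    rw [hκge _ (by linarith [hθ.1]), hκle θ hθ.2]
    simp only [κ₂, add_sub_cancel_right]
  have hclosed : κ 0 = κ (2 * Real.pi) := by
    rw [two_mul, htwist Real.pi ⟨hπ.le, le_rfl⟩, hκle _ le_rfl, hκle 0 hπ.le, hκ₁0, hκ₁π,
      ← mul_assoc, h, mul_inv_cancel_right, mul_inv_cancel]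
  obtain ⟨f, hf⟩ := exists_circle_map hκ hclosed
  refine ⟨f, fun θ hθ => ?_⟩
  rw [hf _ ⟨by linarith [hθ.1], by linarith [hθ.2]⟩, hf θ ⟨hθ.1, by linarith [hθ.2]⟩,
    htwist θ hθ]

end CircleMaps

section Clutching

variable {P : Type*} [TopologicalSpace P] [MulAction SO3 P] {proj : P → RP2}
  {P' : Type*} [TopologicalSpace P'] [MulAction SO3 P'] {proj' : P' → RP2}

/-- The bundle has a section over the disc whose values at antipodal boundary points differ by a
path in `SO(3)`; `ε` is the obstruction to closing up a lift of that path to the three-sphere. -/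
def HasClutching (proj : P → RP2) (ε : S3) : Prop :=
  ∃ (s : C(ℂ, P)) (g : C(ℝ, S3)), (∀ z, proj (s z) = discToRP2 z) ∧
    (∀ θ : ℝ, s (-(Circle.exp θ : ℂ)) = rot (g θ) • s (Circle.exp θ : ℂ)) ∧
    g Real.pi * g 0 = ε

theorem exists_disc_section (hP : IsPrincipalBundle SO3 proj) :
    ∃ s : C(ℂ, P), ∀ z, proj (s z) = discToRP2 z := by
  obtain ⟨s, hs, hsf⟩ := hP.liftsOn_unitSquare
    (f := fun x => discToRP2 ⟨2 * x.1 - 1, 2 * x.2 - 1⟩)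
    (continuous_discToRP2.comp (Complex.equivRealProdCLM.symm.continuous.comp
      (by fun_prop : Continuous fun x : unitInterval × unitInterval =>
        ((2 * x.1 - 1 : ℝ), (2 * x.2 - 1 : ℝ)))))
  let toSquare : ℂ → unitInterval × unitInterval := fun z =>
    (Set.projIcc 0 1 zero_le_one (((clampDisc z).re + 1) / 2),
      Set.projIcc 0 1 zero_le_one (((clampDisc z).im + 1) / 2))
  have htoSquare : Continuous toSquare := by
    have hre := Complex.continuous_re.comp continuous_clampDisc
    have him := Complex.continuous_im.comp continuous_clampDisc
    exact (continuous_projIcc.comp ((hre.add continuous_const).div_const 2)).prodMk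
      (continuous_projIcc.comp ((him.add continuous_const).div_const 2))
  refine ⟨⟨s ∘ toSquare, (continuousOn_univ.1 hs).comp htoSquare⟩, fun z => ?_⟩
  have hre := abs_le.1 ((Complex.abs_re_le_norm (clampDisc z)).trans (norm_clampDisc_le z))
  have him := abs_le.1 ((Complex.abs_im_le_norm (clampDisc z)).trans (norm_clampDisc_le z))
  refine (hsf _ trivial).trans ((congrArg discToRP2 (Complex.ext ?_ ?_)).trans
    (discToRP2_clampDisc z))
  · change 2 * (Set.projIcc 0 1 zero_le_one (((clampDisc z).re + 1) / 2) : ℝ) - 1 = _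
    rw [Set.projIcc_of_mem _ ⟨by linarith, by linarith⟩]
    ring
  · change 2 * (Set.projIcc 0 1 zero_le_one (((clampDisc z).im + 1) / 2) : ℝ) - 1 = _
    rw [Set.projIcc_of_mem _ ⟨by linarith, by linarith⟩]
    ring

theorem exists_lift_S3 {X : Type*} [TopologicalSpace X] [SimplyConnectedSpace X]
    [LocallyPathConnectedSpace X] {f : X → SO3} (hf : Continuous f) :
    ∃ F : C(X, S3), ∀ x, rot (F x) = f x := by
  obtain ⟨x₀⟩ : Nonempty X := inferInstance
  obtain ⟨e₀, he⟩ := rot_surjective (f x₀)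
  obtain ⟨F, ⟨-, hF⟩, -⟩ :=
    isCoveringMap_rot.existsUnique_continuousMap_lifts ⟨f, hf⟩ x₀ e₀ he
  exact ⟨F, fun x => congrFun hF x⟩

theorem exists_hasClutching (hP : IsPrincipalBundle SO3 proj) :
    HasClutching proj 1 ∨ HasClutching proj (-1) := by
  obtain ⟨s, hs⟩ := exists_disc_section hP
  obtain ⟨g, hg, hgs⟩ := hP.exists_continuousOn_smul_eq (S := Set.univ)
    (a := fun θ : ℝ => s (Circle.exp θ : ℂ)) (b := fun θ : ℝ => s (-(Circle.exp θ : ℂ)))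
    (by fun_prop) (by fun_prop)
    (fun θ _ => by rw [hs, hs, discToRP2_neg (Circle.norm_coe _)])
  obtain ⟨γ, hγ⟩ := exists_lift_S3 (continuousOn_univ.1 hg)
  have hγs (θ : ℝ) : s (-(Circle.exp θ : ℂ)) = rot (γ θ) • s (Circle.exp θ : ℂ) := by
    rw [hγ]
    exact hgs θ trivial
  have hloop : rot (γ Real.pi * γ 0) = 1 := by
    have hπ := coe_circleExp_add_pi 0
    rw [zero_add] at hπ
    refine hP.eq_one_of_smul_eq_self (p := s (Circle.exp 0 : ℂ)) ?_
    rw [map_mul, mul_smul, ← hγs, ← hπ, ← hγs, hπ, neg_neg]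
  exact ((rot_eq_one_iff _).1 hloop).imp (fun h => ⟨s, γ, hs, hγs, h⟩) fun h => ⟨s, γ, hs, hγs, h⟩

/-- The only identifications made by the disc model are antipodal ones on the boundary, and each
antipodal pair has a representative on the upper half circle. -/
theorem smul_compatible_of_halfCircle {Q : Type*} [MulAction SO3 Q]
    (hP : IsPrincipalBundle SO3 proj) {s : ℂ → P} {t : ℂ → Q} (hs : ∀ z, proj (s z) = discToRP2 z)
    (hst : ∀ θ ∈ Set.Icc 0 Real.pi, ∃ g : SO3,
      s (-(Circle.exp θ : ℂ)) = g • s (Circle.exp θ : ℂ) ∧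
      t (-(Circle.exp θ : ℂ)) = g • t (Circle.exp θ : ℂ))
    {z w : ℂ} (hz : ‖z‖ ≤ 1) (hw : ‖w‖ ≤ 1) {g : SO3} (hg : s w = g • s z) : t w = g • t z := by
  have hcircle {z : ℂ} (hz : ‖z‖ = 1) (hz0 : 0 ≤ z.arg) {g : SO3} (hg : s (-z) = g • s z) :
      t (-z) = g • t z := by
    obtain ⟨g', hs', ht'⟩ := hst z.arg ⟨hz0, Complex.arg_le_pi z⟩
    rw [coe_circleExp_arg hz] at hs' ht'
    rw [ht', hP.smul_right_injective (s z) (hg.symm.trans hs')]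
  have hzw : discToRP2 z = discToRP2 w := by rw [← hs, ← hs, hg, hP.proj_smul]
  rcases eq_or_eq_neg_of_discToRP2_eq hz hw hzw with rfl | ⟨rfl, hz1⟩
  · rw [hP.eq_one_of_smul_eq_self hg.symm, one_smul]
  · rcases le_or_gt 0 z.arg with harg | harg
    · exact hcircle hz1 harg hg
    · have hneg : 0 ≤ (-z).arg := by
        rw [Complex.arg_neg_eq_arg_add_pi_of_im_neg (Complex.arg_neg_iff.1 harg)]
        linarith [Complex.neg_pi_lt_arg z]
      have hinv := hcircle (by rwa [norm_neg]) hneg (g := g⁻¹) (by rw [neg_neg, hg, inv_smul_smul])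
      rw [neg_neg] at hinv
      rw [hinv, smul_inv_smul]

theorem HasClutching.iso (hP : IsPrincipalBundle SO3 proj) (hP' : IsPrincipalBundle SO3 proj')
    {ε : S3} (h : HasClutching proj ε) (h' : HasClutching proj' ε) :
    PrincipalBundleIso SO3 proj proj' := by
  obtain ⟨s, g, hs, hsg, hg⟩ := h
  obtain ⟨s', g', hs', hsg', hg'⟩ := h'
  obtain ⟨f, hf⟩ := exists_circle_map_of_twist g.continuous g'.continuous (hg.trans hg'.symm)
  obtain ⟨F, hF⟩ := exists_extension_of_circle_to_S3 f
  let t : ℂ → P' := fun z => rot (F z) • s' z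
  have ht : Continuous t := hP'.continuous_smul.comp
    ((continuous_rot.comp F.continuous).prodMk s'.continuous)
  have htg : ∀ θ ∈ Set.Icc 0 Real.pi,
      t (-(Circle.exp θ : ℂ)) = rot (g θ) • t (Circle.exp θ : ℂ) := by
    intro θ hθ
    simp only [t]
    rw [hsg', ← coe_circleExp_add_pi, hF, hF, hf θ hθ, ← mul_smul, ← mul_smul, ← map_mul,
      ← map_mul, inv_mul_cancel_right]
  refine hP.iso_of_compatible_lifts hP' (K := Metric.closedBall (0 : ℂ) 1)
    (q := fun z => discToRP2 z) (s := fun z => s z) (s' := fun z => t z) (fun x => ?_)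
    (by fun_prop) (by fun_prop) (fun z => hs z) (fun z => (hP'.proj_smul _ _).trans (hs' z)) ?_
  · obtain ⟨z, hz, rfl⟩ := exists_discToRP2_eq x
    exact ⟨⟨z, mem_closedBall_zero_iff.2 hz⟩, rfl⟩
  · exact fun z w g => smul_compatible_of_halfCircle hP hs (fun θ hθ => ⟨_, hsg θ, htg θ hθ⟩)
      (mem_closedBall_zero_iff.1 z.2) (mem_closedBall_zero_iff.1 w.2)

theorem mul_eq_one_of_eq_sign_mul {H : Type*} [Group H] [HasDistribNeg H] {u a b x : H}
    (hu : u = 1 ∨ u = -1) (h : x = u * (a * (u * (b * x)))) : a * b = 1 := by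
  rcases hu with rfl | rfl
  · rw [one_mul, one_mul, ← mul_assoc] at h
    exact mul_eq_right.1 h.symm
  · rw [neg_one_mul, neg_one_mul, mul_neg, neg_neg, ← mul_assoc] at h
    exact mul_eq_right.1 h.symm

theorem HasClutching.eq_one_of_isTrivial {ε : S3} (h : HasClutching proj ε)
    (htriv : IsTrivialPrincipalBundle SO3 proj) : ε = 1 := by
  obtain ⟨φ, -, hφ⟩ := htriv
  obtain ⟨s, g, -, hsg, hg⟩ := h
  obtain ⟨F, hF⟩ := exists_lift_S3 (f := fun z : ℂ => (φ (s z)).2) (by fun_prop)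
  -- `F (-e^{iθ})` and `g θ * F (e^{iθ})` are lifts of one path, so they differ by a constant sign
  let u : ℝ → S3 := fun θ => F (-(Circle.exp θ : ℂ)) * (g θ * F (Circle.exp θ : ℂ))⁻¹
  have hrot (θ : ℝ) : rot (u θ) = 1 := by
    rw [map_mul, map_inv, mul_inv_eq_one, map_mul, hF, hF, hsg, hφ]
  have hu : u Real.pi = u 0 := isCoveringMap_rot.const_of_comp (by fun_prop : Continuous u)
    (fun a b => (hrot a).trans (hrot b).symm) _ _
  have hFu (θ : ℝ) : F (-(Circle.exp θ : ℂ)) = u θ * (g θ * F (Circle.exp θ : ℂ)) :=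
    (inv_mul_cancel_right _ _).symm
  have hπ := coe_circleExp_add_pi 0
  rw [zero_add] at hπ
  have hF0 := hFu 0
  have hFπ := hFu Real.pi
  rw [hπ, neg_neg, hF0, hu] at hFπ
  exact hg.symm.trans (mul_eq_one_of_eq_sign_mul ((rot_eq_one_iff _).1 (hrot 0)) hFπ)

theorem HasClutching.not_isTrivial (h : HasClutching proj (-1)) :
    ¬ IsTrivialPrincipalBundle SO3 proj := by
  intro htriv
  have hre : -(1 : ℝ) = 1 := congrArg (fun q : S3 => q.1.re) (h.eq_one_of_isTrivial htriv)
  norm_num at hre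

/-- The left translation action on a product. -/
abbrev prodAction (B G : Type*) [Group G] : MulAction G (B × G) where
  smul g x := (x.1, g * x.2)
  one_smul _ := Prod.ext rfl (one_mul _)
  mul_smul _ _ _ := Prod.ext rfl (mul_assoc _ _ _)

theorem isPrincipalBundle_fst (B G : Type*) [TopologicalSpace B] [Group G] [TopologicalSpace G]
    [ContinuousMul G] :
    letI := prodAction B G
    IsPrincipalBundle G (Prod.fst : B × G → B) :=
  letI := prodAction B G
  { continuous_smul := (continuous_fst.comp continuous_snd).prodMk
      (continuous_fst.mul (continuous_snd.comp continuous_snd))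
    proj_smul := fun _ _ => rfl
    locally_trivial := fun b => ⟨⟨OpenPartialHomeomorph.refl _, Set.univ, isOpen_univ, rfl,
      Set.univ_prod_univ.symm, fun _ _ => rfl⟩, Set.mem_univ b, fun _ _ _ => rfl⟩ }

theorem HasClutching.isTrivial (hP : IsPrincipalBundle SO3 proj) (h : HasClutching proj 1) :
    IsTrivialPrincipalBundle SO3 proj := by
  let _ := prodAction RP2 SO3
  have hfst : HasClutching (Prod.fst : RP2 × SO3 → RP2) 1 :=
    ⟨⟨fun z => (discToRP2 z, 1), continuous_discToRP2.prodMk continuous_const⟩, .const _ 1,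
      fun _ => rfl, fun _ => Prod.ext (discToRP2_neg (Circle.norm_coe _))
        ((mul_one _).trans (map_one rot)).symm, mul_one _⟩
  exact h.iso hP (isPrincipalBundle_fst RP2 SO3) hfst

end Clutching

section Frames

open Quaternion Matrix

/-- Pairs of vectors of `ℂ³`, as the rows of a matrix. -/
abbrev Mat23 : Type := Matrix (Fin 2) (Fin 3) ℂ

/-- The complex `2 × 2` matrix of a quaternion; unit quaternions give `SU(2)`. -/
def quatMat (q : ℍ[ℝ]) : Matrix (Fin 2) (Fin 2) ℂ :=
  !![⟨q.re, q.imI⟩, ⟨q.imJ, q.imK⟩; ⟨-q.imJ, q.imK⟩, ⟨q.re, -q.imI⟩]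

theorem quatMat_mul (p q : ℍ[ℝ]) : quatMat (p * q) = quatMat p * quatMat q := by
  ext i j
  fin_cases i <;> fin_cases j <;> apply Complex.ext <;>
    simp [quatMat, Matrix.mul_apply, Fin.sum_univ_two] <;> ring

theorem quatMat_one : quatMat 1 = 1 := by
  ext i j
  fin_cases i <;> fin_cases j <;> apply Complex.ext <;> simp [quatMat]

theorem quatMat_neg (q : ℍ[ℝ]) : quatMat (-q) = -quatMat q := by
  ext i j
  fin_cases i <;> fin_cases j <;> apply Complex.ext <;> simp [quatMat]

theorem quatMat_injective : Function.Injective quatMat := fun p q h => by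
  have h0 := congrFun (congrFun h 0) 0
  have h1 := congrFun (congrFun h 0) 1
  exact Quaternion.ext _ _ (congrArg Complex.re h0) (congrArg Complex.im h0)
    (congrArg Complex.re h1) (congrArg Complex.im h1)

theorem quatMat_mul_conjTranspose (q : ℍ[ℝ]) :
    quatMat q * (quatMat q)ᴴ = ((normSq q : ℝ) : ℂ) • (1 : Matrix (Fin 2) (Fin 2) ℂ) := by
  rw [normSq_def']
  ext i j
  fin_cases i <;> fin_cases j <;> apply Complex.ext <;>
    simp [quatMat, Matrix.mul_apply, Fin.sum_univ_two, pow_two] <;> ring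

theorem det_quatMat (q : ℍ[ℝ]) : (quatMat q).det = ((normSq q : ℝ) : ℂ) := by
  rw [normSq_def']
  apply Complex.ext <;> simp [quatMat, Matrix.det_fin_two, pow_two] <;> ring

theorem S3.normSq_eq_one (q : S3) : normSq q.1 = 1 := by
  rw [normSq_def', q.sum_sq_eq_one]

theorem det_quatMat_S3 (q : S3) : (quatMat q.1).det = 1 := by
  rw [det_quatMat, q.normSq_eq_one, Complex.ofReal_one]

theorem continuous_quatMat : Continuous quatMat := by
  have h : ∀ a b : ℍ[ℝ] → ℝ, Continuous a → Continuous b →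
      Continuous fun q => (⟨a q, b q⟩ : ℂ) := fun a b ha hb =>
    Complex.equivRealProdCLM.symm.continuous.comp (ha.prodMk hb)
  refine continuous_matrix fun i j => ?_
  fin_cases i <;> fin_cases j
  · exact h _ _ continuous_re continuous_imI
  · exact h _ _ continuous_imJ continuous_imK
  · exact h _ _ continuous_imJ.neg continuous_imK
  · exact h _ _ continuous_re continuous_imI.neg

theorem exists_quatMat_eq {C : Matrix (Fin 2) (Fin 2) ℂ} (hC : C * Cᴴ = 1) (hdet : C.det = 1) :
    ∃ q : S3, quatMat q.1 = C := by
  have hadj : C.adjugate = Cᴴ := by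
    have h : C.adjugate = C.adjugate * C * Cᴴ := by rw [mul_assoc, hC, mul_one]
    rw [h, Matrix.adjugate_mul, hdet, one_smul, one_mul]
  rw [Matrix.adjugate_fin_two] at hadj
  have h11 : C 1 1 = star (C 0 0) := congrFun (congrFun hadj 0) 0
  have h10 : C 1 0 = -star (C 0 1) := by
    have h : -C 0 1 = star (C 1 0) := congrFun (congrFun hadj 0) 1
    rw [← star_neg, h, star_star]
  let q : ℍ[ℝ] := quat (C 0 0).re (C 0 0).im (C 0 1).re (C 0 1).im
  have hq : quatMat q = C := by
    ext i j
    fin_cases i <;> fin_cases j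
    · rfl
    · rfl
    · exact (Complex.ext rfl (neg_neg _).symm : quatMat q 1 0 = -star (C 0 1)).trans h10.symm
    · exact h11.symm
  refine ⟨⟨q, (mem_S3_iff q).2 ?_⟩, hq⟩
  rw [← normSq_def', ← Complex.ofReal_inj, ← det_quatMat, hq, hdet, Complex.ofReal_one]

/-- A multiple of a unitary matrix becomes special unitary after division by a square root of its
determinant. -/
theorem exists_eq_smul_quatMat {B : Matrix (Fin 2) (Fin 2) ℂ} {r : ℝ} (hr : 0 < r)
    (hB : B * Bᴴ = (r : ℂ) • 1) : ∃ (l : ℂ) (q : S3), l ≠ 0 ∧ B = l • quatMat q.1 := by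
  obtain ⟨l, hl⟩ := IsAlgClosed.exists_pow_nat_eq B.det (n := 2) two_pos
  have hdet : ‖B.det‖ ^ 2 = r ^ 2 := by
    have h := congrArg (fun A => ‖A.det‖) hB
    simpa only [Matrix.det_mul, Matrix.det_conjTranspose, norm_mul, _root_.norm_star B.det,
      Matrix.det_smul, Fintype.card_fin, Matrix.det_one, mul_one, norm_pow, Complex.norm_real,
      Real.norm_eq_abs, sq_abs, ← sq] using h
  have hnorm : ‖l‖ ^ 2 = r := by
    rw [← norm_pow, hl]
    exact (pow_left_inj₀ (norm_nonneg _) hr.le two_ne_zero).1 hdet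
  have hl0 : l ≠ 0 := by
    rintro rfl
    exact hr.ne (by simpa only [norm_zero, zero_pow two_ne_zero] using hnorm)
  have hstar : l * star l = r := by
    rw [← hnorm, ← Complex.normSq_eq_norm_sq, ← Complex.mul_conj]
    rfl
  have hunit : l⁻¹ • B * (l⁻¹ • B)ᴴ = 1 := by
    rw [Matrix.conjTranspose_smul, Matrix.smul_mul, Matrix.mul_smul, hB, smul_smul, smul_smul,
      star_inv₀, ← mul_inv, hstar, inv_mul_cancel₀ (Complex.ofReal_ne_zero.2 hr.ne'), one_smul]
  obtain ⟨q, hq⟩ := exists_quatMat_eq hunit (by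
    rw [Matrix.det_smul, Fintype.card_fin, ← hl, inv_pow, inv_mul_cancel₀ (pow_ne_zero 2 hl0)])
  exact ⟨l, q, hl0, by rw [hq, smul_inv_smul₀ hl0]⟩

theorem eq_or_eq_neg_of_quatMat_eq_smul {p q : S3} {l : ℂ} (h : quatMat p.1 = l • quatMat q.1) :
    p = q ∨ p = -q := by
  have hdet := congrArg Matrix.det h
  rw [Matrix.det_smul, det_quatMat_S3, det_quatMat_S3, Fintype.card_fin, mul_one] at hdet
  have hsq : (l - 1) * (l + 1) = 0 := by linear_combination -hdet
  rcases mul_eq_zero.1 hsq with hl | hl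
  · rw [sub_eq_zero.1 hl, one_smul] at h
    exact .inl (Subtype.ext (quatMat_injective h))
  · rw [eq_neg_of_add_eq_zero_left hl, neg_smul, one_smul, ← quatMat_neg] at h
    exact .inr (Subtype.ext (quatMat_injective h))

/-- The complexification of a real vector. -/
def cvec (n : Fin 3 → ℝ) : Fin 3 → ℂ := fun i => (n i : ℂ)

/-- The rows of `X` are orthogonal, of the same positive length, and span the complexification of
the real plane orthogonal to `n`. -/
def IsFrameOf (X : Mat23) (n : Fin 3 → ℝ) : Prop :=
  n ≠ 0 ∧ X *ᵥ cvec n = 0 ∧ ∃ r : ℝ, 0 < r ∧ X * Xᴴ = (r : ℂ) • 1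

theorem cvec_dotProduct_cvec (m n : Fin 3 → ℝ) :
    cvec m ⬝ᵥ cvec n = ((m 0 * n 0 + m 1 * n 1 + m 2 * n 2 : ℝ) : ℂ) := by
  simp only [dotProduct, Fin.sum_univ_three, cvec, Complex.ofReal_add, Complex.ofReal_mul]

theorem cvec_vecMul_conjTranspose (X : Mat23) (n : Fin 3 → ℝ) :
    cvec n ᵥ* Xᴴ = star (X *ᵥ cvec n) := by
  rw [Matrix.star_mulVec]
  exact congrArg (· ᵥ* Xᴴ) (funext fun i => (Complex.conj_ofReal (n i)).symm)

/-- A square matrix with rows `X` and `n` has a right inverse assembled from `Xᴴ` and `n`; the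
formula says that it is a left inverse as well. -/
theorem conjTranspose_mul_eq_sub_vecMulVec {X : Mat23} {n : Fin 3 → ℝ} {r : ℝ} (hn : n ≠ 0)
    (hXn : X *ᵥ cvec n = 0) (hr : 0 < r) (hX : X * Xᴴ = (r : ℂ) • 1) :
    Xᴴ * X = (r : ℂ) • (1 : Matrix (Fin 3) (Fin 3) ℂ) -
      ((r / (n 0 ^ 2 + n 1 ^ 2 + n 2 ^ 2) : ℝ) : ℂ) • vecMulVec (cvec n) (cvec n) := by
  set N := n 0 ^ 2 + n 1 ^ 2 + n 2 ^ 2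
  have hr0 : (r : ℂ) ≠ 0 := Complex.ofReal_ne_zero.2 hr.ne'
  have hN0 : (N : ℂ) ≠ 0 := Complex.ofReal_ne_zero.2 (sum_sq_pos hn).ne'
  have hnn : cvec n ⬝ᵥ cvec n = N := by
    rw [cvec_dotProduct_cvec, ← sq, ← sq, ← sq]
  have hright : fromRows X (replicateRow (Fin 1) (cvec n)) *
      fromCols ((r : ℂ)⁻¹ • Xᴴ) ((N : ℂ)⁻¹ • replicateCol (Fin 1) (cvec n)) = 1 := by
    rw [fromRows_mul_fromCols, ← fromBlocks_one, Matrix.mul_smul, hX, inv_smul_smul₀ hr0,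
      Matrix.mul_smul, ← replicateCol_mulVec, hXn, Matrix.mul_smul, ← replicateRow_vecMul,
      cvec_vecMul_conjTranspose, hXn, Matrix.mul_smul, replicateRow_mul_replicateCol, hnn]
    congr 1
    · simp
    · simp
    · ext i j
      obtain rfl := Subsingleton.elim i j
      simp [hN0]
  have hvec : replicateCol (Fin 1) (cvec n) * replicateRow (Fin 1) (cvec n) =
      vecMulVec (cvec n) (cvec n) := (vecMulVec_eq (Fin 1) _ _).symm
  have hleft :=
    (fromCols_mul_fromRows_eq_one_comm (finSumFinEquiv (m := 2) (n := 1)).symm _ _ _ _).2 hright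
  rw [fromCols_mul_fromRows, Matrix.smul_mul, Matrix.smul_mul, hvec] at hleft
  rw [← hleft, smul_add, smul_inv_smul₀ hr0, smul_smul, ← div_eq_mul_inv, ← Complex.ofReal_div,
    add_sub_cancel_right]

theorem IsFrameOf.exists_eq_smul {X Y : Mat23} {n : Fin 3 → ℝ} (hX : IsFrameOf X n)
    (hY : IsFrameOf Y n) : ∃ (l : ℂ) (q : S3), l ≠ 0 ∧ Y = l • (quatMat q.1 * X) := by
  obtain ⟨hn, hXn, r, hr, hXr⟩ := hX
  obtain ⟨-, hYn, t, ht, hYt⟩ := hY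
  have hXX := conjTranspose_mul_eq_sub_vecMulVec hn hXn hr hXr
  have hrC : (r : ℂ) ≠ 0 := by exact_mod_cast hr.ne'
  set B := (r : ℂ)⁻¹ • (Y * Xᴴ) with hB
  have hBX : B * X = Y := by
    rw [hB, Matrix.smul_mul, Matrix.mul_assoc, hXX, Matrix.mul_sub, Matrix.mul_smul, Matrix.mul_one,
      Matrix.mul_smul, Matrix.mul_vecMulVec, hYn, Matrix.zero_vecMulVec, smul_zero, sub_zero,
      smul_smul, inv_mul_cancel₀ hrC, one_smul]
  have hBB : B * Bᴴ = ((t / r : ℝ) : ℂ) • 1 := by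
    have h1 : B * Bᴴ = (r : ℂ)⁻¹ • (B * X * Yᴴ) := by
      rw [hB, Matrix.conjTranspose_smul, Matrix.conjTranspose_mul,
        Matrix.conjTranspose_conjTranspose,
        Matrix.mul_smul, Matrix.mul_assoc]
      simp
    rw [h1, hBX, hYt, smul_smul]
    push_cast
    rw [div_eq_inv_mul]
  obtain ⟨l, q, hl, h⟩ := exists_eq_smul_quatMat (by positivity) hBB
  exact ⟨l, q, hl, by rw [← hBX, h, Matrix.smul_mul]⟩

theorem IsFrameOf.normal_unique {X : Mat23} {n m : Fin 3 → ℝ} (hX : IsFrameOf X n)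
    (hm : X *ᵥ cvec m = 0) : ∃ a : ℝ, a • n = m := by
  obtain ⟨hn, hXn, r, hr, hXr⟩ := hX
  have hXX := conjTranspose_mul_eq_sub_vecMulVec hn hXn hr hXr
  have h := congrArg (fun A => A *ᵥ cvec m) hXX
  beta_reduce at h
  rw [← Matrix.mulVec_mulVec, hm, Matrix.mulVec_zero, Matrix.sub_mulVec, Matrix.smul_mulVec,
    Matrix.one_mulVec, Matrix.smul_mulVec, Matrix.vecMulVec_mulVec] at h
  refine ⟨(n 0 * m 0 + n 1 * m 1 + n 2 * m 2) / (n 0 ^ 2 + n 1 ^ 2 + n 2 ^ 2), funext fun i => ?_⟩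
  have hi := congrFun h i
  simp only [cvec_dotProduct_cvec, Pi.zero_apply, Pi.sub_apply, Pi.smul_apply, smul_eq_mul,
    MulOpposite.smul_eq_mul_unop, MulOpposite.unop_op, cvec] at hi
  have hi : 0 = r * m i - r / (n 0 ^ 2 + n 1 ^ 2 + n 2 ^ 2) *
      (n i * (n 0 * m 0 + n 1 * m 1 + n 2 * m 2)) := by exact_mod_cast hi
  rw [Pi.smul_apply, smul_eq_mul]
  refine mul_left_cancel₀ hr.ne' ?_
  linear_combination hi

end Frames

section FrameSpace

open Quaternion Matrix

/-- The cross product of the two rows. -/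
def normalVec (X : Mat23) : Fin 3 → ℂ :=
  ![X 0 1 * X 1 2 - X 0 2 * X 1 1, X 0 2 * X 1 0 - X 0 0 * X 1 2, X 0 0 * X 1 1 - X 0 1 * X 1 0]

/-- The determinant of the (bilinear) Gram matrix of the two rows. -/
def gramDet (X : Mat23) : ℂ := normalVec X ⬝ᵥ normalVec X

theorem gramDet_eq (X : Mat23) : gramDet X = (X 0 1 * X 1 2 - X 0 2 * X 1 1) ^ 2 +
    (X 0 2 * X 1 0 - X 0 0 * X 1 2) ^ 2 + (X 0 0 * X 1 1 - X 0 1 * X 1 0) ^ 2 := by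
  simp [gramDet, normalVec, dotProduct, Fin.sum_univ_three]
  ring

/-- The pair of quadratic polynomials whose coefficient vectors, in the basis of `ℂ³` in which the
discriminant is the sum of the squares of the coordinates, are the rows of a matrix. -/
noncomputable def coeffs : Mat23 ≃ₗ[ℂ] (Fin 6 → ℂ) where
  toFun X := ![(X 0 1 - Complex.I * X 0 2) / 2, X 0 0, (-X 0 1 - Complex.I * X 0 2) / 2,
    (X 1 1 - Complex.I * X 1 2) / 2, X 1 0, (-X 1 1 - Complex.I * X 1 2) / 2]
  invFun c := !![c 1, c 0 - c 2, Complex.I * (c 0 + c 2);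
    c 4, c 3 - c 5, Complex.I * (c 3 + c 5)]
  map_add' X Y := by ext i; fin_cases i <;> simp <;> ring
  map_smul' a X := by ext i; fin_cases i <;> simp <;> ring
  left_inv X := by
    ext i j
    fin_cases i <;> fin_cases j <;> simp <;> ring_nf <;> simp
  right_inv c := by
    have hI : Complex.I * Complex.I = -1 := Complex.I_mul_I
    ext i
    fin_cases i <;> simp
    · linear_combination -((c 0 + c 2) / 2) * hI
    · linear_combination -((c 0 + c 2) / 2) * hI
    · linear_combination -((c 3 + c 5) / 2) * hI
    · linear_combination -((c 3 + c 5) / 2) * hI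

theorem coeffs_apply (X : Mat23) : coeffs X =
    ![(X 0 1 - Complex.I * X 0 2) / 2, X 0 0, (-X 0 1 - Complex.I * X 0 2) / 2,
    (X 1 1 - Complex.I * X 1 2) / 2, X 1 0, (-X 1 1 - Complex.I * X 1 2) / 2] := rfl

theorem continuous_coeffs : Continuous coeffs :=
  LinearMap.continuous_of_finiteDimensional coeffs.toLinearMap

theorem quadResultant_coeffs (X : Mat23) : quadResultant (coeffs X) = -(gramDet X) / 4 := by
  have hI : Complex.I ^ 2 = -1 := Complex.I_sq
  rw [gramDet_eq]
  simp [quadResultant, coeffs_apply, Matrix.det_succ_row_zero, Fin.sum_univ_succ, Fin.succAbove]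
  ring_nf
  simp [hI]
  ring

theorem gramDet_smul (a : ℂ) (X : Mat23) : gramDet (a • X) = a ^ 4 * gramDet X := by
  simp [gramDet_eq]; ring

theorem gramDet_mul_left (A : Matrix (Fin 2) (Fin 2) ℂ) (X : Mat23) :
    gramDet (A * X) = A.det ^ 2 * gramDet X := by
  simp [gramDet_eq, Matrix.det_fin_two, Matrix.mul_apply, Fin.sum_univ_two]; ring

theorem gramDet_eq_det (X : Mat23) : gramDet X = (X * Xᵀ).det := by
  simp [gramDet_eq, Matrix.det_fin_two, Matrix.mul_apply, Fin.sum_univ_three]; ring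

theorem continuous_gramDet : Continuous gramDet := by
  have : gramDet = fun X : Mat23 => (X * Xᵀ).det := funext gramDet_eq_det
  rw [this]
  fun_prop

/-- Pairs of rows spanning a plane on which the standard bilinear form is nondegenerate. -/
abbrev NondegPair : Type := {X : Mat23 // gramDet X ≠ 0}

theorem coeffs_ne_zero (X : NondegPair) : coeffs X.1 ≠ 0 := by
  intro h
  have h0 : X.1 = 0 := (LinearEquiv.map_eq_zero_iff coeffs).1 h
  refine X.2 ?_
  rw [h0]
  simp [gramDet_eq]

/-- The quadratic rational map with the given pair of coefficient vectors. -/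
noncomputable def ratMk (X : NondegPair) : Rat2 :=
  ⟨Projectivization.mk ℂ (coeffs X.1) (coeffs_ne_zero X), by
    rw [mk_mem_rat2Set_iff, quadResultant_coeffs]
    simpa using X.2⟩

theorem ratMk_eq_iff (X Y : NondegPair) : ratMk X = ratMk Y ↔ ∃ a : ℂ, a ≠ 0 ∧ Y.1 = a • X.1 := by
  rw [Subtype.ext_iff, eq_comm]
  change Projectivization.mk ℂ _ _ = Projectivization.mk ℂ _ _ ↔ _
  rw [Projectivization.mk_eq_mk_iff']
  constructor
  · rintro ⟨a, ha⟩
    have h : Y.1 = a • X.1 := coeffs.injective (by rw [map_smul, ha])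
    refine ⟨a, ?_, h⟩
    rintro rfl
    exact Y.2 (by rw [h]; simp [gramDet_eq])
  · rintro ⟨a, -, ha⟩
    exact ⟨a, by rw [ha, map_smul]⟩

theorem isOpenEmbedding_coeffs : Topology.IsOpenEmbedding
    fun X : NondegPair => (⟨coeffs X.1, coeffs_ne_zero X⟩ : {v : Fin 6 → ℂ // v ≠ 0}) := by
  have hne : IsOpen {v : Fin 6 → ℂ | v ≠ 0} := isOpen_ne
  have hnondeg : IsOpen {X : Mat23 | gramDet X ≠ 0} :=
    isOpen_ne_fun continuous_gramDet continuous_const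
  exact .of_comp _ hne.isOpenEmbedding_subtypeVal
    (coeffs.toContinuousLinearEquiv.toHomeomorph.isOpenEmbedding.comp
      hnondeg.isOpenEmbedding_subtypeVal)

theorem isOpenQuotientMap_ratMk : IsOpenQuotientMap ratMk := by
  refine ⟨?_, (continuous_projMk.comp isOpenEmbedding_coeffs.continuous).subtype_mk _,
    (isOpenQuotientMap_projMk.isOpenMap.comp isOpenEmbedding_coeffs.isOpenMap).subtype_mk _⟩
  rintro ⟨x, hx⟩
  induction x using Projectivization.ind with
  | h v hv =>
  have hgram : gramDet (coeffs.symm v) ≠ 0 := by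
    intro h
    refine (mk_mem_rat2Set_iff v hv).1 hx ?_
    rw [← coeffs.apply_symm_apply v, quadResultant_coeffs, h, neg_zero, zero_div]
  refine ⟨⟨coeffs.symm v, hgram⟩, Subtype.ext ?_⟩
  change Projectivization.mk ℂ (coeffs (coeffs.symm v)) _ = _
  congr 1
  exact coeffs.apply_symm_apply v

theorem IsFrameOf.smul {X : Mat23} {n : Fin 3 → ℝ} (h : IsFrameOf X n) {a : ℂ} (ha : a ≠ 0) :
    IsFrameOf (a • X) n := by
  obtain ⟨hn, hXn, r, hr, hXr⟩ := h
  refine ⟨hn, by rw [Matrix.smul_mulVec, hXn, smul_zero], ‖a‖ ^ 2 * r, by positivity, ?_⟩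
  rw [Matrix.conjTranspose_smul, Matrix.smul_mul, Matrix.mul_smul, hXr, smul_smul, smul_smul]
  congr 1
  have : a * star a = ((Complex.normSq a : ℝ) : ℂ) := Complex.mul_conj a
  rw [this, Complex.normSq_eq_norm_sq]
  push_cast
  rfl

theorem IsFrameOf.quatMat_mul {X : Mat23} {n : Fin 3 → ℝ} (h : IsFrameOf X n) (q : S3) :
    IsFrameOf (quatMat q.1 * X) n := by
  obtain ⟨hn, hXn, r, hr, hXr⟩ := h
  refine ⟨hn, by rw [← Matrix.mulVec_mulVec, hXn, Matrix.mulVec_zero], r, hr, ?_⟩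
  rw [Matrix.conjTranspose_mul, Matrix.mul_assoc, ← Matrix.mul_assoc X, hXr, Matrix.smul_mul,
    Matrix.one_mul, Matrix.mul_smul, quatMat_mul_conjTranspose, q.normSq_eq_one,
    Complex.ofReal_one, one_smul]

/-- A rotation as a complex matrix. -/
def cmat (R : SO3) : Matrix (Fin 3) (Fin 3) ℂ := R.1.map Complex.ofReal

theorem cmat_mul (R S : SO3) : cmat (R * S) = cmat R * cmat S :=
  Matrix.map_mul (f := Complex.ofRealHom)

theorem cmat_one : cmat 1 = 1 := by
  simp [cmat]

theorem cmat_transpose_mul (R : SO3) : (cmat R)ᵀ * cmat R = 1 := by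
  have h := congrArg (fun A => A.map Complex.ofRealHom) R.transpose_mul
  beta_reduce at h
  rw [Matrix.map_mul] at h
  exact h.trans (Matrix.map_one _ (map_zero _) (map_one _))

theorem cmat_transpose_conjTranspose (R : SO3) : (cmat R)ᵀᴴ = cmat R := by
  ext i j
  simp [cmat]

theorem cmat_mulVec (R : SO3) (n : Fin 3 → ℝ) : cmat R *ᵥ cvec n = cvec (R.1 *ᵥ n) := by
  ext i
  simp [cmat, cvec, Matrix.mulVec, dotProduct]

theorem continuous_cmat : Continuous cmat :=
  Continuous.matrix_map continuous_subtype_val Complex.continuous_ofReal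

/-- Post-composition with the rotation of a unit quaternion and pre-composition with a rotation. -/
def frameAct (k : S3 × SO3) (X : Mat23) : Mat23 := quatMat k.1.1 * X * (cmat k.2)ᵀ

theorem frameAct_mul (k l : S3 × SO3) (X : Mat23) :
    frameAct (k * l) X = frameAct k (frameAct l X) := by
  have : quatMat (k * l).1.1 = quatMat k.1.1 * quatMat l.1.1 := quatMat_mul _ _
  rw [frameAct, this, Prod.snd_mul, cmat_mul, Matrix.transpose_mul]
  simp only [frameAct, Matrix.mul_assoc]

theorem frameAct_one (X : Mat23) : frameAct 1 X = X := by
  have : quatMat (1 : S3 × SO3).1.1 = 1 := quatMat_one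
  rw [frameAct, this, Prod.snd_one, cmat_one, Matrix.transpose_one, Matrix.mul_one, Matrix.one_mul]

theorem frameAct_smul (k : S3 × SO3) (a : ℂ) (X : Mat23) :
    frameAct k (a • X) = a • frameAct k X := by
  simp [frameAct]

theorem gramDet_frameAct (k : S3 × SO3) (X : Mat23) : gramDet (frameAct k X) = gramDet X := by
  have h : gramDet (X * (cmat k.2)ᵀ) = gramDet X := by
    rw [gramDet_eq_det, gramDet_eq_det, Matrix.transpose_mul, Matrix.transpose_transpose,
      Matrix.mul_assoc, ← Matrix.mul_assoc _ _ Xᵀ, cmat_transpose_mul, Matrix.one_mul]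
  rw [frameAct, Matrix.mul_assoc, gramDet_mul_left, det_quatMat_S3, h]
  simp

theorem continuous_frameAct : Continuous fun x : (S3 × SO3) × Mat23 => frameAct x.1 x.2 := by
  have h1 : Continuous fun x : (S3 × SO3) × Mat23 => quatMat x.1.1.1 :=
    continuous_quatMat.comp (by fun_prop)
  have h2 : Continuous fun x : (S3 × SO3) × Mat23 => cmat x.1.2 :=
    continuous_cmat.comp (by fun_prop)
  exact (h1.matrix_mul continuous_snd).matrix_mul h2.matrix_transpose

theorem IsFrameOf.map_frameAct {X : Mat23} {n : Fin 3 → ℝ} (h : IsFrameOf X n) (k : S3 × SO3) :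
    IsFrameOf (frameAct k X) (k.2.1 *ᵥ n) := by
  have h1 : IsFrameOf (X * (cmat k.2)ᵀ) (k.2.1 *ᵥ n) := by
    obtain ⟨hn, hXn, r, hr, hXr⟩ := h
    refine ⟨fun h0 => hn ?_, ?_, r, hr, ?_⟩
    · rw [← Matrix.one_mulVec n, ← k.2.transpose_mul, ← Matrix.mulVec_mulVec, h0,
        Matrix.mulVec_zero]
    · rw [← cmat_mulVec, Matrix.mulVec_mulVec, Matrix.mul_assoc, cmat_transpose_mul,
        Matrix.mul_one, hXn]
    · rw [Matrix.conjTranspose_mul, cmat_transpose_conjTranspose, Matrix.mul_assoc,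
        ← Matrix.mul_assoc _ _ Xᴴ,
        cmat_transpose_mul, Matrix.one_mul, hXr]
  rw [frameAct, Matrix.mul_assoc]
  exact h1.quatMat_mul k.1

/-- The coordinate frame of the plane orthogonal to the third axis. -/
def baseFrame : Mat23 := !![1, 0, 0; 0, 1, 0]

theorem isFrameOf_baseFrame : IsFrameOf baseFrame ![0, 0, 1] := by
  refine ⟨fun h => one_ne_zero (congrFun h 2), ?_, 1, one_pos, ?_⟩
  · ext i
    fin_cases i <;> simp [baseFrame, cvec, Matrix.mulVec, dotProduct, Fin.sum_univ_three]
  · ext i j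
    fin_cases i <;> fin_cases j <;> simp [baseFrame, Matrix.mul_apply, Fin.sum_univ_three]

theorem gramDet_baseFrame : gramDet baseFrame = 1 := by
  simp [gramDet_eq, baseFrame]

/-- The quaternion of the shortest rotation taking the third axis to the unit vector `n`. -/
noncomputable def tilt (n : Fin 3 → ℝ) : ℍ[ℝ] :=
  quat ((1 + n 2) / √(2 * (1 + n 2))) (-n 1 / √(2 * (1 + n 2))) (n 0 / √(2 * (1 + n 2))) 0

theorem tilt_mem {n : Fin 3 → ℝ} (hn : n 0 ^ 2 + n 1 ^ 2 + n 2 ^ 2 = 1) (h2 : -1 < n 2) :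
    tilt n ∈ Metric.sphere (0 : ℍ[ℝ]) 1 := by
  have hne : 1 + n 2 ≠ 0 := (by linarith : 0 < 1 + n 2).ne'
  have hpos : 0 < 2 * (1 + n 2) := by linarith
  have hsq : √(2 * (1 + n 2)) ^ 2 = 2 * (1 + n 2) := Real.sq_sqrt hpos.le
  rw [mem_S3_iff, tilt]
  simp only [quat_re, quat_imI, quat_imJ, quat_imK, div_pow, hsq]
  field_simp
  linarith

theorem rotMat_tilt_mulVec {n : Fin 3 → ℝ} (hn : n 0 ^ 2 + n 1 ^ 2 + n 2 ^ 2 = 1)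
    (h2 : -1 < n 2) : rotMat (tilt n) *ᵥ ![0, 0, 1] = n := by
  have hpos : 0 < 2 * (1 + n 2) := by linarith
  have hsq : √(2 * (1 + n 2)) ^ 2 = 2 * (1 + n 2) := Real.sq_sqrt hpos.le
  have hne : √(2 * (1 + n 2)) ≠ 0 := (Real.sqrt_pos.2 hpos).ne'
  rw [tilt]
  generalize √(2 * (1 + n 2)) = s at hsq hne ⊢
  ext i
  fin_cases i <;> simp [rotMat, Matrix.mulVec, dotProduct, Fin.sum_univ_three]
  all_goals
    field_simp
    simp only [hsq]
  linarith

theorem exists_SO3_mulVec_eq {n : Fin 3 → ℝ} (hn : n 0 ^ 2 + n 1 ^ 2 + n 2 ^ 2 = 1)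
    (h2 : -1 < n 2) : ∃ R : SO3, R.1 *ᵥ ![0, 0, 1] = n :=
  ⟨rot ⟨_, tilt_mem hn h2⟩, rotMat_tilt_mulVec hn h2⟩

theorem IsFrameOf.smul_normal {X : Mat23} {n : Fin 3 → ℝ} (h : IsFrameOf X n) {a : ℝ}
    (ha : a ≠ 0) : IsFrameOf X (a • n) := by
  refine ⟨smul_ne_zero ha h.1, ?_, h.2.2⟩
  have : cvec (a • n) = (a : ℂ) • cvec n := by ext i; simp [cvec]
  rw [this, Matrix.mulVec_smul, h.2.1, smul_zero]

theorem IsFrameOf.exists_eq_smul_frameAct {X : Mat23} {n : Fin 3 → ℝ} (h : IsFrameOf X n) :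
    ∃ (k : S3 × SO3) (a : ℂ), a ≠ 0 ∧ X = a • frameAct k baseFrame := by
  wlog h2 : 0 ≤ n 2 generalizing n
  · exact this (h.smul_normal (neg_ne_zero.2 one_ne_zero)) (by simp; linarith)
  have hpos := sum_sq_pos h.1
  set r := √(n 0 ^ 2 + n 1 ^ 2 + n 2 ^ 2)
  have hr : 0 < r := Real.sqrt_pos.2 hpos
  have hsq : r ^ 2 = n 0 ^ 2 + n 1 ^ 2 + n 2 ^ 2 := Real.sq_sqrt hpos.le
  have hunit : (r⁻¹ * n 0) ^ 2 + (r⁻¹ * n 1) ^ 2 + (r⁻¹ * n 2) ^ 2 = 1 := by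
    rw [mul_pow, mul_pow, mul_pow, ← mul_add, ← mul_add, ← hsq, inv_pow,
      inv_mul_cancel₀ (pow_pos hr 2).ne']
  obtain ⟨R, hR⟩ := exists_SO3_mulVec_eq (n := r⁻¹ • n) hunit
    (neg_one_lt_zero.trans_le (mul_nonneg (inv_pos.2 hr).le h2))
  have hframe : IsFrameOf (frameAct (1, R) baseFrame) (r⁻¹ • n) :=
    hR ▸ isFrameOf_baseFrame.map_frameAct (1, R)
  obtain ⟨l, q, hl, hX⟩ := hframe.exists_eq_smul (h.smul_normal (inv_ne_zero hr.ne'))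
  have hone : quatMat (1 : S3).1 = 1 := quatMat_one
  refine ⟨(q, R), l, hl, ?_⟩
  rw [hX, frameAct, frameAct, hone, Matrix.one_mul, Matrix.mul_assoc]

theorem IsFrameOf.gramDet_ne_zero {X : Mat23} {n : Fin 3 → ℝ} (h : IsFrameOf X n) :
    gramDet X ≠ 0 := by
  obtain ⟨k, a, ha, rfl⟩ := h.exists_eq_smul_frameAct
  rw [gramDet_smul, gramDet_frameAct, gramDet_baseFrame, mul_one]
  exact pow_ne_zero 4 ha

end FrameSpace

section FrameManifold

open Quaternion Matrix

/-- The rational maps `A ∘ (z ↦ z²) ∘ B` with `A` and `B` rotations of the sphere: those given by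
pairs of orthogonal vectors of equal length spanning the complexification of a real plane. -/
def frameSet : Set Rat2 := {x | ∃ X : NondegPair, ratMk X = x ∧ ∃ n, IsFrameOf X.1 n}

/-- Matrices whose rows are a frame of the complexification of some real plane. -/
abbrev Frame : Type := {X : Mat23 // ∃ n, IsFrameOf X n}

theorem Frame.gramDet_ne_zero (X : Frame) : gramDet X.1 ≠ 0 :=
  X.2.choose_spec.gramDet_ne_zero

/-- The rational map of a frame. -/
noncomputable def frameMk (X : Frame) : frameSet :=
  ⟨ratMk ⟨X.1, X.gramDet_ne_zero⟩, _, rfl, X.2⟩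

theorem frameMk_eq_iff (X Y : Frame) : frameMk X = frameMk Y ↔ ∃ a : ℂ, a ≠ 0 ∧ Y.1 = a • X.1 := by
  rw [Subtype.ext_iff]
  exact ratMk_eq_iff _ _

theorem ratMk_mem_frameSet_iff (X : NondegPair) :
    ratMk X ∈ frameSet ↔ ∃ n, IsFrameOf X.1 n := by
  refine ⟨?_, fun h => ⟨X, rfl, h⟩⟩
  rintro ⟨Y, h, n, hn⟩
  obtain ⟨a, ha, e⟩ := (ratMk_eq_iff _ _).1 h
  exact ⟨n, e ▸ hn.smul ha⟩

theorem isOpenQuotientMap_frameMk : IsOpenQuotientMap frameMk := by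
  have hι : Continuous fun X : Frame => (⟨X.1, X.gramDet_ne_zero⟩ : NondegPair) :=
    continuous_subtype_val.subtype_mk _
  refine ⟨?_, (isOpenQuotientMap_ratMk.continuous.comp hι).subtype_mk _, fun U hU => ?_⟩
  · rintro ⟨_, X, rfl, h⟩
    exact ⟨⟨X.1, h⟩, rfl⟩
  obtain ⟨V, hV, rfl⟩ := isOpen_induced_iff.1 hU
  have himage : frameMk '' (Subtype.val ⁻¹' V) =
      Subtype.val ⁻¹' (ratMk '' (Subtype.val ⁻¹' V)) := by
    ext x
    constructor
    · rintro ⟨X, hX, rfl⟩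
      exact ⟨⟨X.1, X.gramDet_ne_zero⟩, hX, rfl⟩
    · rintro ⟨X, hX, h⟩
      exact ⟨⟨X.1, (ratMk_mem_frameSet_iff X).1 (h ▸ x.2)⟩, hX, Subtype.ext h⟩
  rw [himage]
  exact (isOpenQuotientMap_ratMk.isOpenMap _ (hV.preimage continuous_subtype_val)).preimage
    continuous_subtype_val

theorem frameMk_surjective : Function.Surjective frameMk := isOpenQuotientMap_frameMk.surjective

/-- The action of pairs of rotations on frames. -/
def Frame.act (k : S3 × SO3) (X : Frame) : Frame :=
  ⟨frameAct k X.1, _, X.2.choose_spec.map_frameAct k⟩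

/-- The action of pairs of rotations on rational maps. -/
noncomputable def pairAct (k : S3 × SO3) (m : frameSet) : frameSet :=
  frameMk ((Function.surjInv frameMk_surjective m).act k)

theorem pairAct_frameMk (k : S3 × SO3) (X : Frame) : pairAct k (frameMk X) = frameMk (X.act k) := by
  obtain ⟨a, ha, e⟩ := (frameMk_eq_iff _ _).1
    (Function.surjInv_eq frameMk_surjective (frameMk X))
  refine (frameMk_eq_iff _ _).2 ⟨a, ha, ?_⟩
  change frameAct k X.1 = a • frameAct k _
  rw [e, frameAct_smul]

theorem pairAct_mul (k l : S3 × SO3) (m : frameSet) :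
    pairAct (k * l) m = pairAct k (pairAct l m) := by
  obtain ⟨X, rfl⟩ := frameMk_surjective m
  rw [pairAct_frameMk, pairAct_frameMk, pairAct_frameMk]
  exact congrArg frameMk (Subtype.ext (frameAct_mul k l X.1))

theorem pairAct_one (m : frameSet) : pairAct 1 m = m := by
  obtain ⟨X, rfl⟩ := frameMk_surjective m
  rw [pairAct_frameMk]
  exact congrArg frameMk (Subtype.ext (frameAct_one X.1))

theorem continuous_pairAct : Continuous fun x : (S3 × SO3) × frameSet => pairAct x.1 x.2 := by
  refine (IsOpenQuotientMap.id.prodMap isOpenQuotientMap_frameMk).isQuotientMap.continuous_iff.2 ?_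
  have : (fun x : (S3 × SO3) × frameSet => pairAct x.1 x.2) ∘ Prod.map id frameMk =
      fun x : (S3 × SO3) × Frame => frameMk (x.2.act x.1) := by
    funext x
    exact pairAct_frameMk _ _
  rw [this]
  have hact : Continuous fun x : (S3 × SO3) × Frame => frameAct x.1 x.2.1 :=
    continuous_frameAct.comp (f := fun x : (S3 × SO3) × Frame => (x.1, x.2.1)) (by fun_prop)
  exact isOpenQuotientMap_frameMk.continuous.comp (hact.subtype_mk fun x => (x.2.act x.1).2)

theorem pairAct_neg (q : S3) (m : frameSet) : pairAct (-q, 1) m = pairAct (q, 1) m := by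
  obtain ⟨X, rfl⟩ := frameMk_surjective m
  rw [pairAct_frameMk, pairAct_frameMk, eq_comm]
  refine (frameMk_eq_iff _ _).2 ⟨-1, by simp, ?_⟩
  have : quatMat (-q : S3).1 = -quatMat q.1 := quatMat_neg q.1
  change quatMat (-q : S3).1 * X.1 * _ = -1 • (quatMat q.1 * X.1 * _)
  rw [this]
  simp

/-- A unit quaternion lifting a rotation. -/
noncomputable def liftRot (R : SO3) : S3 := Function.surjInv rot_surjective R

theorem pairAct_liftRot_rot (q : S3) (m : frameSet) :
    pairAct (liftRot (rot q), 1) m = pairAct (q, 1) m := by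
  rcases (rot_eq_rot_iff _ _).1 (Function.surjInv_eq rot_surjective (rot q)) with h | h
  · rw [liftRot, h]
  · rw [liftRot, h, pairAct_neg]

/-- Post-composition with rotations of the sphere. -/
noncomputable instance frameAction : MulAction SO3 frameSet where
  smul R m := pairAct (liftRot R, 1) m
  one_smul m := by
    change pairAct (liftRot 1, 1) m = m
    have h := pairAct_liftRot_rot 1 m
    rw [map_one] at h
    exact h.trans (pairAct_one m)
  mul_smul R S m := by
    obtain ⟨p, rfl⟩ := rot_surjective R
    obtain ⟨q, rfl⟩ := rot_surjective S
    change pairAct (liftRot (rot p * rot q), 1) m = pairAct _ (pairAct _ m)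
    rw [← map_mul, pairAct_liftRot_rot, pairAct_liftRot_rot, pairAct_liftRot_rot, ← pairAct_mul]
    simp

theorem rot_smul (q : S3) (m : frameSet) : rot q • m = pairAct (q, 1) m :=
  pairAct_liftRot_rot q m

theorem continuous_frame_smul : Continuous fun x : SO3 × frameSet => x.1 • x.2 := by
  have hq : IsOpenQuotientMap rot :=
    ⟨rot_surjective, continuous_rot, isCoveringMap_rot.isOpenMap⟩
  refine (hq.prodMap IsOpenQuotientMap.id).isQuotientMap.continuous_iff.2 ?_
  have : (fun x : SO3 × frameSet => x.1 • x.2) ∘ Prod.map rot id =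
      fun x : S3 × frameSet => pairAct (x.1, 1) x.2 := by
    funext x
    exact rot_smul _ _
  rw [this]
  exact continuous_pairAct.comp
    (f := fun x : S3 × frameSet => ((x.1, (1 : SO3)), x.2)) (by fun_prop)

/-- The base frame, as a frame. -/
def Frame.base : Frame := ⟨baseFrame, _, isFrameOf_baseFrame⟩

theorem exists_pairAct_base (m : frameSet) : ∃ k, pairAct k (frameMk .base) = m := by
  obtain ⟨X, rfl⟩ := frameMk_surjective m
  obtain ⟨n, hn⟩ := X.2
  obtain ⟨k, a, ha, h⟩ := hn.exists_eq_smul_frameAct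
  exact ⟨k, by rw [pairAct_frameMk]; exact (frameMk_eq_iff _ _).2 ⟨a, ha, h⟩⟩

theorem continuous_pairAct_left (m : frameSet) : Continuous fun k : S3 × SO3 => pairAct k m :=
  continuous_pairAct.comp (f := fun k : S3 × SO3 => (k, m)) (by fun_prop)

instance frameSet.compactSpace : CompactSpace frameSet :=
  Function.Surjective.compactSpace (f := fun k => pairAct k (frameMk .base))
    (continuous_pairAct_left _) exists_pairAct_base

/-- The plane spanned by a frame, given by its real normal line. -/
noncomputable def frameProj (m : frameSet) : RP2 :=
  Projectivization.mk ℝ (Function.surjInv frameMk_surjective m).2.choose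
    (Function.surjInv frameMk_surjective m).2.choose_spec.1

theorem frameProj_frameMk (X : Frame) {n : Fin 3 → ℝ} (hX : IsFrameOf X.1 n) :
    frameProj (frameMk X) = Projectivization.mk ℝ n hX.1 := by
  obtain ⟨a, ha, e⟩ := (frameMk_eq_iff _ _).1
    (Function.surjInv_eq frameMk_surjective (frameMk X))
  set Y := Function.surjInv frameMk_surjective (frameMk X)
  have hY : IsFrameOf X.1 Y.2.choose := e ▸ Y.2.choose_spec.smul ha
  obtain ⟨c, hc⟩ := hX.normal_unique hY.2.1
  exact (Projectivization.mk_eq_mk_iff' ℝ _ _ _ _).2 ⟨c, hc⟩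

theorem SO3.mulVec_axis_ne_zero (R : SO3) : R.1 *ᵥ ![0, 0, 1] ≠ 0 := fun h => by
  have haxis : (![0, 0, 1] : Fin 3 → ℝ) = 0 := by
    rw [← Matrix.one_mulVec ![0, 0, 1], ← R.transpose_mul, ← Matrix.mulVec_mulVec, h,
      Matrix.mulVec_zero]
  exact one_ne_zero (congrFun haxis 2)

theorem frameProj_pairAct_base (k : S3 × SO3) : frameProj (pairAct k (frameMk .base)) =
    Projectivization.mk ℝ (k.2.1 *ᵥ ![0, 0, 1]) (SO3.mulVec_axis_ne_zero k.2) := by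
  rw [pairAct_frameMk]
  exact frameProj_frameMk _ (isFrameOf_baseFrame.map_frameAct k)

theorem continuous_frameProj : Continuous frameProj := by
  have hq : Topology.IsQuotientMap fun k : S3 × SO3 => pairAct k (frameMk .base) :=
    (continuous_pairAct_left _).isClosedMap.isQuotientMap (continuous_pairAct_left _)
      exists_pairAct_base
  refine hq.continuous_iff.2 ?_
  rw [show frameProj ∘ (fun k : S3 × SO3 => pairAct k (frameMk .base)) = _ from
    funext frameProj_pairAct_base]
  have h : Continuous fun k : S3 × SO3 => k.2.1 *ᵥ ![0, 0, 1] := by fun_prop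
  exact continuous_projMk.comp (h.subtype_mk fun k => SO3.mulVec_axis_ne_zero k.2)

theorem frameProj_smul (R : SO3) (m : frameSet) : frameProj (R • m) = frameProj m := by
  obtain ⟨q, rfl⟩ := rot_surjective R
  obtain ⟨k, rfl⟩ := exists_pairAct_base m
  rw [rot_smul, ← pairAct_mul, frameProj_pairAct_base, frameProj_pairAct_base]
  simp

theorem exists_smul_eq_of_frameProj_eq {m m' : frameSet} (h : frameProj m = frameProj m') :
    ∃ R : SO3, m' = R • m := by
  obtain ⟨X, rfl⟩ := frameMk_surjective m
  obtain ⟨Y, rfl⟩ := frameMk_surjective m'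
  obtain ⟨n, hn⟩ := X.2
  obtain ⟨n', hn'⟩ := Y.2
  rw [frameProj_frameMk _ hn, frameProj_frameMk _ hn'] at h
  obtain ⟨c, rfl⟩ := (Projectivization.mk_eq_mk_iff' ℝ _ _ _ _).1 h
  have hc : c ≠ 0 := by
    rintro rfl
    exact hn.1 (zero_smul _ _)
  have hX : IsFrameOf X.1 n' := by
    have := hn.smul_normal (inv_ne_zero hc)
    rwa [smul_smul, inv_mul_cancel₀ hc, one_smul] at this
  obtain ⟨l, q, hl, e⟩ := hX.exists_eq_smul hn'
  refine ⟨rot q, ?_⟩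
  rw [rot_smul, pairAct_frameMk, eq_comm]
  refine (frameMk_eq_iff _ _).2 ⟨l, hl, ?_⟩
  change Y.1 = l • (quatMat q.1 * X.1 * (cmat 1)ᵀ)
  rw [e, cmat_one, Matrix.transpose_one, Matrix.mul_one]

theorem eq_one_of_frame_smul_eq {R : SO3} {m : frameSet} (h : R • m = m) : R = 1 := by
  obtain ⟨q, rfl⟩ := rot_surjective R
  obtain ⟨X, rfl⟩ := frameMk_surjective m
  rw [rot_smul, pairAct_frameMk] at h
  obtain ⟨a, -, e⟩ := (frameMk_eq_iff _ _).1 h.symm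
  change quatMat q.1 * X.1 * (cmat 1)ᵀ = a • X.1 at e
  rw [cmat_one, Matrix.transpose_one, Matrix.mul_one] at e
  obtain ⟨n, -, -, r, hr, hXr⟩ := X.2
  have hrC : (r : ℂ) ≠ 0 := by exact_mod_cast hr.ne'
  have hq : quatMat q.1 = a • quatMat (1 : S3).1 := by
    rw [show quatMat (1 : S3).1 = 1 from quatMat_one]
    refine smul_right_injective _ hrC ?_
    calc (r : ℂ) • quatMat q.1 = quatMat q.1 * X.1 * X.1ᴴ := by
          rw [Matrix.mul_assoc, hXr, Matrix.mul_smul, Matrix.mul_one]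
      _ = (r : ℂ) • a • 1 := by rw [e, Matrix.smul_mul, hXr, smul_comm]
  exact (rot_eq_one_iff q).2 (eq_or_eq_neg_of_quatMat_eq_smul hq)

end FrameManifold

section LocalSections

variable {G B P : Type*} [Group G] [TopologicalSpace G] [TopologicalSpace B]
  [TopologicalSpace P] [MulAction G P] {proj : P → B}

theorem continuousOn_of_smul_eq [CompactSpace G] [T2Space P]
    (hsmul : Continuous fun x : G × P => x.1 • x.2)
    (hfree : ∀ p : P, Function.Injective fun g : G => g • p)
    {X : Type*} [TopologicalSpace X] {S : Set X} {a b : X → P} {g : X → G}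
    (ha : ContinuousOn a S) (hb : ContinuousOn b S) (hg : ∀ x ∈ S, b x = g x • a x) :
    ContinuousOn g S := by
  rw [continuousOn_iff_continuous_domRestrict] at *
  refine continuous_iff_isClosed.2 fun C hC => ?_
  have hgraph : IsClosed
      {y : S × G | S.domRestrict b y.1 = y.2 • S.domRestrict a y.1 ∧ y.2 ∈ C} :=
    (isClosed_eq (hb.comp continuous_fst) <| hsmul.comp <|
      continuous_snd.prodMk (ha.comp (continuous_fst (X := S) (Y := G)))).inter
      (hC.preimage continuous_snd)
  convert isClosedMap_fst_of_compactSpace _ hgraph using 1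
  ext x
  constructor
  · intro hx
    exact ⟨(x, g x), ⟨hg x x.2, hx⟩, rfl⟩
  · rintro ⟨⟨y, h⟩, ⟨hy, hC⟩, rfl⟩
    have hgy : g y = h := hfree _ ((hg y y.2).symm.trans hy)
    change g y ∈ C
    rwa [hgy]

/-- The trivialization over `U` of a free fibre-preserving action defined by a section `s`: the
fibre coordinate of `p` is the element `g p` taking `s (proj p)` to `p`. -/
def sectionTrivialization (hsmul : Continuous fun x : G × P => x.1 • x.2)
    (hproj : Continuous proj) (hproj_smul : ∀ (g : G) (p : P), proj (g • p) = proj p)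
    (hfree : ∀ p : P, Function.Injective fun g : G => g • p)
    {U : Set B} (hU : IsOpen U) {s : B → P} (hs : ContinuousOn s U)
    (hps : ∀ x ∈ U, proj (s x) = x) {g : P → G} (hgc : ContinuousOn g (proj ⁻¹' U))
    (hg : ∀ p, proj p ∈ U → p = g p • s (proj p)) : Bundle.Trivialization G proj where
  toFun p := (proj p, g p)
  invFun x := x.2 • s x.1
  source := proj ⁻¹' U
  target := U ×ˢ Set.univ
  map_source' _ hp := ⟨hp, trivial⟩
  map_target' x hx := by
    rw [Set.mem_preimage, hproj_smul, hps _ hx.1]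
    exact hx.1
  left_inv' p hp := (hg p hp).symm
  right_inv' x hx := by
    have hx1 : proj (x.2 • s x.1) = x.1 := by rw [hproj_smul, hps _ hx.1]
    have hgx := hg (x.2 • s x.1) (by rw [hx1]; exact hx.1)
    rw [hx1] at hgx
    exact Prod.ext hx1 (hfree _ hgx.symm)
  open_source := hU.preimage hproj
  open_target := hU.prod isOpen_univ
  continuousOn_toFun := hproj.continuousOn.prodMk hgc
  continuousOn_invFun := hsmul.comp_continuousOn
    (continuousOn_snd.prodMk (hs.comp continuousOn_fst fun _ hx => hx.1))
  baseSet := U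
  open_baseSet := hU
  source_eq := rfl
  target_eq := rfl
  proj_toFun _ _ := rfl

theorem isPrincipalBundle_of_local_sections [CompactSpace G] [T2Space P]
    (hsmul : Continuous fun x : G × P => x.1 • x.2)
    (hproj : Continuous proj) (hproj_smul : ∀ (g : G) (p : P), proj (g • p) = proj p)
    (hfree : ∀ p : P, Function.Injective fun g : G => g • p)
    (htrans : ∀ p p' : P, proj p = proj p' → ∃ g : G, p' = g • p)
    (hsec : ∀ b : B, ∃ (U : Set B) (s : B → P), IsOpen U ∧ b ∈ U ∧ ContinuousOn s U ∧
      ∀ x ∈ U, proj (s x) = x) :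
    IsPrincipalBundle G proj := by
  classical
  refine ⟨hsmul, hproj_smul, fun b => ?_⟩
  obtain ⟨U, s, hU, hbU, hs, hps⟩ := hsec b
  have hex : ∀ p : P, ∃ g : G, proj p ∈ U → p = g • s (proj p) := fun p => by
    by_cases hp : proj p ∈ U
    · exact (htrans (s (proj p)) p (hps _ hp)).imp fun g hg _ => hg
    · exact ⟨1, fun h => absurd h hp⟩
  choose g hg using hex
  have hgc : ContinuousOn g (proj ⁻¹' U) :=
    continuousOn_of_smul_eq hsmul hfree (a := fun p => s (proj p)) (b := fun p => p)
      (hs.comp hproj.continuousOn fun _ h => h) continuousOn_id hg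
  refine ⟨sectionTrivialization hsmul hproj hproj_smul hfree hU hs hps hgc hg, hbU,
    fun p hp h => (hfree (s (proj p)) ?_).symm⟩
  have hhp := hg (h • p) (by rw [hproj_smul]; exact hp)
  rw [hproj_smul] at hhp
  change (h * g p) • s (proj p) = g (h • p) • s (proj p)
  rw [← hhp, mul_smul, ← hg p hp]

end LocalSections

section FrameBundle

open Quaternion Matrix

/-- The unit vectors of `ℝ³` other than the south pole. -/
abbrev PuncturedSphere : Type :=
  {n : Fin 3 → ℝ // n 0 ^ 2 + n 1 ^ 2 + n 2 ^ 2 = 1 ∧ -1 < n 2}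

/-- The class of the base frame tilted so that its normal becomes `n`: a section of `frameProj`
over the punctured sphere. -/
noncomputable def tiltedFrame (n : PuncturedSphere) : frameSet :=
  pairAct (1, rot ⟨tilt n.1, tilt_mem n.2.1 n.2.2⟩) (frameMk .base)

theorem continuous_tiltedFrame : Continuous tiltedFrame := by
  have hcoord (i : Fin 3) : Continuous fun n : PuncturedSphere => n.1 i :=
    (continuous_apply i).comp continuous_subtype_val
  have hsqrt : Continuous fun n : PuncturedSphere => √(2 * (1 + n.1 2)) :=
    (continuous_const.mul (continuous_const.add (hcoord 2))).sqrt
  have hsqrt0 (n : PuncturedSphere) : √(2 * (1 + n.1 2)) ≠ 0 :=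
    (Real.sqrt_pos.2 (by linarith [n.2.2])).ne'
  have htilt : Continuous fun n : PuncturedSphere => tilt n.1 :=
    continuous_quat ((continuous_const.add (hcoord 2)).div hsqrt hsqrt0)
      ((hcoord 1).neg.div hsqrt hsqrt0) ((hcoord 0).div hsqrt hsqrt0) continuous_const
  exact (continuous_pairAct_left _).comp (f := fun n : PuncturedSphere =>
    ((1 : S3), rot ⟨tilt n.1, tilt_mem n.2.1 n.2.2⟩))
    (continuous_const.prodMk (continuous_rot.comp (htilt.subtype_mk _)))

theorem frameProj_tiltedFrame (n : PuncturedSphere) (hn : n.1 ≠ 0) :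
    frameProj (tiltedFrame n) = Projectivization.mk ℝ n.1 hn := by
  rw [tiltedFrame, frameProj_pairAct_base, Projectivization.mk_eq_mk_iff']
  exact ⟨1, by rw [one_smul]; exact (rotMat_tilt_mulVec n.2.1 n.2.2).symm⟩

/-- The unit vector on the line `x` that has positive inner product with `w`. -/
noncomputable def unitRep (w : Fin 3 → ℝ) (x : RP2) : Fin 3 → ℝ :=
  ((x.rep ⬝ᵥ w) / |x.rep ⬝ᵥ w| / √(x.rep ⬝ᵥ x.rep)) • x.rep

theorem dotProduct_self_pos {v : Fin 3 → ℝ} (hv : v ≠ 0) : 0 < v ⬝ᵥ v :=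
  Matrix.dotProduct_self_star_pos_iff.2 hv

theorem unitRep_mk (w : Fin 3 → ℝ) {v : Fin 3 → ℝ} (hv : v ≠ 0) :
    unitRep w (Projectivization.mk ℝ v hv) = ((v ⬝ᵥ w) / |v ⬝ᵥ w| / √(v ⬝ᵥ v)) • v := by
  obtain ⟨a, ha⟩ := Projectivization.exists_smul_eq_mk_rep ℝ v hv
  have ha0 : (a : ℝ) ≠ 0 := a.ne_zero
  have habs : |(a : ℝ)| ≠ 0 := abs_ne_zero.2 ha0
  rw [unitRep, ← ha, Units.smul_def, smul_dotProduct, smul_dotProduct, dotProduct_smul, smul_smul]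
  simp only [smul_eq_mul]
  rw [abs_mul, ← mul_assoc, Real.sqrt_mul (mul_self_nonneg _), Real.sqrt_mul_self_eq_abs]
  congr 1
  rw [div_div, div_div, div_mul_eq_mul_div, mul_right_comm, ← abs_mul_abs_self]
  rw [mul_assoc, mul_mul_mul_comm |(a : ℝ)|]
  field_simp

theorem mk_rep_dotProduct_ne_zero_iff (w : Fin 3 → ℝ) {v : Fin 3 → ℝ} (hv : v ≠ 0) :
    (Projectivization.mk ℝ v hv).rep ⬝ᵥ w ≠ 0 ↔ v ⬝ᵥ w ≠ 0 := by
  obtain ⟨a, ha⟩ := Projectivization.exists_smul_eq_mk_rep ℝ v hv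
  rw [← ha, Units.smul_def, smul_dotProduct, smul_ne_zero_iff]
  exact and_iff_right a.ne_zero

theorem isOpen_rep_dotProduct_ne_zero (w : Fin 3 → ℝ) : IsOpen {x : RP2 | x.rep ⬝ᵥ w ≠ 0} := by
  rw [← isOpenQuotientMap_projMk.isQuotientMap.isOpen_preimage]
  simp only [Set.preimage_ofPred_eq, mk_rep_dotProduct_ne_zero_iff]
  exact isOpen_ne_fun (by fun_prop) continuous_const

theorem continuousOn_unitRep (w : Fin 3 → ℝ) :
    ContinuousOn (unitRep w) {x : RP2 | x.rep ⬝ᵥ w ≠ 0} := by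
  intro x hx
  obtain ⟨v, rfl⟩ := isOpenQuotientMap_projMk.surjective x
  have hvw : v.1 ⬝ᵥ w ≠ 0 := (mk_rep_dotProduct_ne_zero_iff w v.2).1 hx
  refine (isOpenQuotientMap_projMk.continuousAt_comp_iff.1 ?_).continuousWithinAt
  have hcomp : unitRep w ∘ (fun v : {v : Fin 3 → ℝ // v ≠ 0} => Projectivization.mk ℝ v.1 v.2) =
      fun v => ((v.1 ⬝ᵥ w) / |v.1 ⬝ᵥ w| / √(v.1 ⬝ᵥ v.1)) • v.1 :=
    funext fun v => unitRep_mk w v.2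
  rw [hcomp]
  have hdot : Continuous fun v : {v : Fin 3 → ℝ // v ≠ 0} => v.1 ⬝ᵥ w := by fun_prop
  have hnorm : Continuous fun v : {v : Fin 3 → ℝ // v ≠ 0} => √(v.1 ⬝ᵥ v.1) := by fun_prop
  exact ((hdot.continuousAt.div hdot.abs.continuousAt (abs_ne_zero.2 hvw)).div hnorm.continuousAt
    (Real.sqrt_pos.2 (dotProduct_self_pos v.2)).ne').smul continuous_subtype_val.continuousAt

theorem unitRep_dotProduct_self {w : Fin 3 → ℝ} {x : RP2} (hx : x.rep ⬝ᵥ w ≠ 0) :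
    unitRep w x ⬝ᵥ unitRep w x = 1 := by
  have hpos : 0 < x.rep ⬝ᵥ x.rep := dotProduct_self_pos x.rep_nonzero
  rw [unitRep, smul_dotProduct, dotProduct_smul, smul_eq_mul, smul_eq_mul, ← mul_assoc, ← sq,
    div_pow, div_pow, sq_abs, Real.sq_sqrt hpos.le, div_self (pow_ne_zero 2 hx),
    one_div_mul_cancel hpos.ne']

theorem unitRep_dotProduct_pos {w : Fin 3 → ℝ} {x : RP2} (hx : x.rep ⬝ᵥ w ≠ 0) :
    0 < unitRep w x ⬝ᵥ w := by
  have hpos : 0 < x.rep ⬝ᵥ x.rep := dotProduct_self_pos x.rep_nonzero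
  rw [unitRep, smul_dotProduct, smul_eq_mul, div_mul_eq_mul_div, div_mul_eq_mul_div,
    ← abs_mul_abs_self]
  positivity

theorem neg_one_lt_of_dotProduct_pos {n w : Fin 3 → ℝ} (hn : n 0 ^ 2 + n 1 ^ 2 + n 2 ^ 2 = 1)
    (hw : 0 ≤ w 2) (hnw : 0 < n ⬝ᵥ w) : -1 < n 2 := by
  by_contra! h
  have hn0 : n 0 = 0 := by nlinarith
  have hn1 : n 1 = 0 := by nlinarith
  rw [dotProduct, Fin.sum_univ_three, hn0, hn1] at hnw
  nlinarith

theorem exists_local_section (b : RP2) : ∃ (U : Set RP2) (s : RP2 → frameSet), IsOpen U ∧ b ∈ U ∧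
    ContinuousOn s U ∧ ∀ x ∈ U, frameProj (s x) = x := by
  classical
  obtain ⟨z, hz, rfl⟩ := exists_discToRP2_eq b
  have hw : discVec z ⬝ᵥ discVec z = 1 := by
    simpa only [dotProduct, Fin.sum_univ_three, ← sq] using discVec_sq_sum hz
  let U : Set RP2 := {x | x.rep ⬝ᵥ discVec z ≠ 0}
  let n (x : U) : PuncturedSphere := by
    have hn : unitRep (discVec z) x 0 ^ 2 + unitRep (discVec z) x 1 ^ 2 +
        unitRep (discVec z) x 2 ^ 2 = 1 := by
      simpa only [dotProduct, Fin.sum_univ_three, ← sq] using unitRep_dotProduct_self x.2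
    exact ⟨_, hn, neg_one_lt_of_dotProduct_pos hn (Real.sqrt_nonneg _) (unitRep_dotProduct_pos x.2)⟩
  have hn : Continuous n := (continuousOn_unitRep _).domRestrict.subtype_mk _
  let s (x : RP2) : frameSet := if hx : x ∈ U then tiltedFrame (n ⟨x, hx⟩) else frameMk .base
  have hs (x : U) : s x = tiltedFrame (n x) := dif_pos x.2
  refine ⟨U, s, isOpen_rep_dotProduct_ne_zero _, ?_, ?_, fun x hx => ?_⟩
  · exact (mk_rep_dotProduct_ne_zero_iff _ (discVec_ne_zero z)).2 (hw.symm ▸ one_ne_zero)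
  · rw [continuousOn_iff_continuous_domRestrict, show U.domRestrict s = _ from funext hs]
    exact continuous_tiltedFrame.comp hn
  · have hn0 : (n ⟨x, hx⟩).1 ≠ 0 := fun h => by
      simpa [h] using (n ⟨x, hx⟩).2.1
    rw [hs ⟨x, hx⟩, frameProj_tiltedFrame _ hn0]
    conv_rhs => rw [← x.mk_rep]
    exact (Projectivization.mk_eq_mk_iff' ℝ _ _ _ _).2 ⟨_, rfl⟩

theorem isPrincipalBundle_frameProj : IsPrincipalBundle SO3 frameProj := by
  refine isPrincipalBundle_of_local_sections continuous_frame_smul continuous_frameProj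
    frameProj_smul (fun m R S (h : R • m = S • m) => ?_)
    (fun m m' => exists_smul_eq_of_frameProj_eq) exists_local_section
  have hfix : (S⁻¹ * R) • m = m := by rw [mul_smul, h, inv_smul_smul]
  exact (inv_mul_eq_one.1 (eq_one_of_frame_smul_eq hfix)).symm

theorem pairAct_half_turn (θ : ℝ) (p g : S3) (hp : p.1 = quat 0 (Real.sin θ) (-Real.cos θ) 0)
    (hg : g.1 = quat 0 (-Real.cos (2 * θ)) 0 (-Real.sin (2 * θ))) :
    pairAct (1, rot p) (frameMk .base) = pairAct (g, 1) (frameMk .base) := by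
  rw [pairAct_frameMk, pairAct_frameMk, eq_comm]
  refine (frameMk_eq_iff _ _).2 ⟨-Complex.I, by simp, ?_⟩
  change quatMat (1 : S3).1 * baseFrame * (cmat (rot p))ᵀ =
    -Complex.I • (quatMat g.1 * baseFrame * (cmat 1)ᵀ)
  rw [show quatMat (1 : S3).1 = 1 from quatMat_one, cmat_one, Matrix.transpose_one,
    Matrix.mul_one, Matrix.one_mul, hg, cmat, coe_rot, hp]
  have hs := Real.sin_sq_add_cos_sq θ
  ext i j
  fin_cases i <;> fin_cases j <;> apply Complex.ext <;>
    simp [baseFrame, quatMat, rotMat, Matrix.mul_apply, Fin.sum_univ_three,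
      Real.cos_two_mul, Real.sin_two_mul, -Complex.ofReal_sin, -Complex.ofReal_cos,
      -Complex.ofReal_pow] <;> nlinarith

/-- The sections `tiltedFrame` over opposite unit vectors of the equator differ by the rotation of
the target which this path of unit quaternions describes. -/
noncomputable def equatorTransition (θ : ℝ) : S3 :=
  ⟨quat 0 (-Real.cos (2 * θ)) 0 (-Real.sin (2 * θ)), by rw [mem_S3_iff]; simp⟩

theorem continuous_equatorTransition : Continuous equatorTransition :=
  (continuous_quat continuous_const (by fun_prop) continuous_const (by fun_prop)).subtype_mk _

theorem equatorTransition_pi_mul_zero : equatorTransition Real.pi * equatorTransition 0 = -1 := by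
  refine Subtype.ext ?_
  change quat _ _ _ _ * quat _ _ _ _ = -1
  refine Quaternion.ext _ _ ?_ ?_ ?_ ?_ <;> simp

theorem tilt_neg_equator (θ : ℝ) : tilt ![-Real.cos θ, -Real.sin θ, 0] =
    tilt ![Real.cos θ, Real.sin θ, 0] * quat 0 (Real.sin θ) (-Real.cos θ) 0 := by
  have h := Real.sin_sq_add_cos_sq θ
  refine Quaternion.ext _ _ ?_ ?_ ?_ ?_ <;> simp [tilt] <;> field_simp <;> nlinarith

theorem tiltedFrame_neg_equator {n n' : PuncturedSphere} {θ : ℝ}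
    (hn : n.1 = ![Real.cos θ, Real.sin θ, 0]) (hn' : n'.1 = ![-Real.cos θ, -Real.sin θ, 0]) :
    tiltedFrame n' = rot (equatorTransition θ) • tiltedFrame n := by
  have hp : quat 0 (Real.sin θ) (-Real.cos θ) 0 ∈ Metric.sphere (0 : ℍ[ℝ]) 1 := by
    rw [mem_S3_iff]
    simp
  set Q : S3 := ⟨tilt n.1, tilt_mem n.2.1 n.2.2⟩
  have hQ : (⟨tilt n'.1, tilt_mem n'.2.1 n'.2.2⟩ : S3) = Q * ⟨_, hp⟩ := by
    refine Subtype.ext ?_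
    change tilt n'.1 = tilt n.1 * quat _ _ _ _
    rw [hn, hn', tilt_neg_equator]
  have hsplit : ((1 : S3), rot Q * rot ⟨_, hp⟩) = (1, rot Q) * (1, rot ⟨_, hp⟩) := by simp
  have hcomm : (equatorTransition θ, (1 : SO3)) * (1, rot Q) =
      (1, rot Q) * (equatorTransition θ, 1) := by simp
  rw [tiltedFrame, tiltedFrame, hQ, rot_smul, ← pairAct_mul, map_mul, hsplit, hcomm, pairAct_mul,
    pairAct_mul, pairAct_half_turn θ ⟨_, hp⟩ (equatorTransition θ) rfl rfl]

theorem discVec_circleExp (θ : ℝ) :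
    discVec (Circle.exp θ) = ![Real.cos θ, Real.sin θ, 0] := by
  rw [discVec, Circle.norm_coe, Circle.coe_exp, Complex.exp_ofReal_mul_I_re,
    Complex.exp_ofReal_mul_I_im]
  simp

theorem hasClutching_frameProj : HasClutching frameProj (-1) := by
  let n (z : ℂ) : PuncturedSphere := ⟨discVec (clampDisc z), discVec_sq_sum (norm_clampDisc_le z),
    neg_one_lt_zero.trans_le (Real.sqrt_nonneg _)⟩
  have hn : Continuous n := (continuous_discVec.comp continuous_clampDisc).subtype_mk _
  refine ⟨⟨fun z => tiltedFrame (n z), continuous_tiltedFrame.comp hn⟩,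
    ⟨equatorTransition, continuous_equatorTransition⟩, fun z => ?_, fun θ => ?_,
    equatorTransition_pi_mul_zero⟩
  · rw [← discToRP2_clampDisc]
    exact frameProj_tiltedFrame (n z) (discVec_ne_zero _)
  · refine tiltedFrame_neg_equator ?_ ?_
    · change discVec (clampDisc _) = _
      rw [clampDisc_of_norm_le_one (Circle.norm_coe _).le, discVec_circleExp]
    · change discVec (clampDisc _) = _
      rw [← coe_circleExp_add_pi, clampDisc_of_norm_le_one (Circle.norm_coe _).le,
        discVec_circleExp, Real.cos_add_pi, Real.sin_add_pi]

end FrameBundle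

section Retraction

open Matrix ComplexConjugate

/-- A first deformation of pairs of rows, which makes the plane spanned by the rows real: the rows
are projected to the plane with normal `a • w + b • conj w`, where `w` is a normal of their own
plane with `w ⬝ᵥ w = 1`. As `w` is given by `normalVec X = c • w`, `c ^ 2 = gramDet X`, only up to
sign, the formula uses only even expressions in `c`; see `straighten_eq_projectRows`. -/
noncomputable def straighten (a b : ℝ) (X : Mat23) : Mat23 :=
  ((a ^ 2 + b ^ 2 : ℝ) +
      (2 * a * b : ℝ) * (normalVec X ⬝ᵥ star (normalVec X)) / ‖gramDet X‖ : ℂ) • X -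
    vecMulVec (X *ᵥ star (normalVec X))
      (((a * b : ℝ) / ‖gramDet X‖ : ℂ) • normalVec X +
        ((b ^ 2 : ℝ) / conj (gramDet X) : ℂ) • star (normalVec X))

theorem mulVec_normalVec (X : Mat23) : X *ᵥ normalVec X = 0 := by
  ext i
  fin_cases i <;> simp [normalVec, Matrix.mulVec, dotProduct, Fin.sum_univ_three] <;> ring

theorem normalVec_smul (c : ℂ) (X : Mat23) : normalVec (c • X) = c ^ 2 • normalVec X := by
  ext i
  fin_cases i <;> simp [normalVec] <;> ring

/-- The projection of the rows to the plane with normal `v`, up to a factor. -/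
def projectRows (X : Mat23) (v : Fin 3 → ℂ) : Mat23 := (v ⬝ᵥ v) • X - vecMulVec (X *ᵥ v) v

theorem projectRows_mulVec (X : Mat23) (v : Fin 3 → ℂ) : projectRows X v *ᵥ v = 0 := by
  rw [projectRows, Matrix.sub_mulVec, Matrix.smul_mulVec, Matrix.vecMulVec_mulVec]
  simp

theorem gramDet_projectRows (X : Mat23) (v : Fin 3 → ℂ) :
    gramDet (projectRows X v) = (v ⬝ᵥ v) ^ 3 * (v ⬝ᵥ normalVec X) ^ 2 := by
  simp [gramDet_eq, projectRows, normalVec, vecMulVec_apply, Matrix.mulVec, dotProduct,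
    Fin.sum_univ_three]
  ring

theorem exists_unit_normal {X : Mat23} (hX : gramDet X ≠ 0) : ∃ (c : ℂ) (w : Fin 3 → ℂ), c ≠ 0 ∧
    normalVec X = c • w ∧ w ⬝ᵥ w = 1 := by
  obtain ⟨c, hc⟩ := IsAlgClosed.exists_pow_nat_eq (gramDet X) (n := 2) two_pos
  have hc0 : c ≠ 0 := by
    rintro rfl
    exact hX (by rw [← hc]; simp)
  refine ⟨c, c⁻¹ • normalVec X, hc0, by rw [smul_inv_smul₀ hc0], ?_⟩
  rw [smul_dotProduct, dotProduct_smul, ← gramDet, ← hc]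
  simp only [smul_eq_mul]
  field_simp

theorem straighten_eq_projectRows {X : Mat23} {c : ℂ} {w : Fin 3 → ℂ} (hc : c ≠ 0)
    (hu : normalVec X = c • w) (hw : w ⬝ᵥ w = 1) (a b : ℝ) :
    straighten a b X = projectRows X ((a : ℂ) • w + (b : ℂ) • star w) := by
  have hD : gramDet X = c ^ 2 := by
    rw [gramDet, hu, smul_dotProduct, dotProduct_smul, hw]
    simp [sq]
  have hN : ((‖gramDet X‖ : ℝ) : ℂ) = c * conj c := by
    rw [hD, norm_pow, Complex.mul_conj, Complex.normSq_eq_norm_sq]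
  have hc' : conj c ≠ 0 := by simpa using hc
  have hw' : star w ⬝ᵥ star w = 1 := by
    rw [star_dotProduct_star, hw, star_one]
  have hXw : X *ᵥ w = 0 := by
    have h := mulVec_normalVec X
    rw [hu, Matrix.mulVec_smul] at h
    exact (smul_eq_zero.1 h).resolve_left hc
  rw [straighten, projectRows, hN, hD, hu, star_smul]
  simp only [Matrix.mulVec_add, Matrix.mulVec_smul, hXw, smul_zero, zero_add, add_dotProduct,
    dotProduct_add, smul_dotProduct, dotProduct_smul, hw, hw', dotProduct_comm (star w) w]
  congr 1
  · congr 1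
    simp only [smul_eq_mul]
    push_cast
    simp only [Complex.star_def]
    field_simp
    ring
  · ext i j
    simp [vecMulVec_apply]
    field_simp

theorem dotProduct_star_eq_sum_normSq {ι : Type*} [Fintype ι] (w : ι → ℂ) :
    w ⬝ᵥ star w = ((∑ i, Complex.normSq (w i) : ℝ) : ℂ) := by
  simp [dotProduct, Complex.mul_conj]

theorem gramDet_straighten_ne_zero {X : Mat23} (hX : gramDet X ≠ 0) {a b : ℝ} (ha : 0 < a)
    (hb : 0 ≤ b) : gramDet (straighten a b X) ≠ 0 := by
  obtain ⟨c, w, hc, hu, hw⟩ := exists_unit_normal hX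
  rw [straighten_eq_projectRows hc hu hw, gramDet_projectRows, hu]
  have hw' : star w ⬝ᵥ star w = 1 := by
    rw [star_dotProduct_star, hw, star_one]
  simp only [add_dotProduct, dotProduct_add, smul_dotProduct, dotProduct_smul, hw, hw',
    dotProduct_comm (star w) w, dotProduct_star_eq_sum_normSq, smul_eq_mul, mul_one]
  have hN : 0 ≤ ∑ i, Complex.normSq (w i) := Finset.sum_nonneg fun i _ => Complex.normSq_nonneg _
  set N := ∑ i, Complex.normSq (w i)
  have hsq : 0 < a * (a + b * N) + b * (a * N + b) := by positivity
  have hlin : 0 < a + b * N := by positivity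
  refine mul_ne_zero (pow_ne_zero _ ?_) (pow_ne_zero _ (mul_ne_zero hc ?_))
  · exact_mod_cast hsq.ne'
  · exact_mod_cast hlin.ne'

theorem straighten_smul (a b : ℝ) {c : ℂ} (hc : c ≠ 0) {X : Mat23} (hX : gramDet X ≠ 0) :
    straighten a b (c • X) = c • straighten a b X := by
  have hN : ((‖c‖ : ℝ) : ℂ) ^ 2 = c * conj c := (Complex.mul_conj' c).symm
  have hN' : ((‖c ^ 4 * gramDet X‖ : ℝ) : ℂ) = (c * conj c) ^ 2 * (‖gramDet X‖ : ℂ) := by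
    rw [norm_mul, norm_pow, ← hN]
    push_cast
    ring
  have hc' : conj c ≠ 0 := by simpa using hc
  have hnorm : ((‖gramDet X‖ : ℝ) : ℂ) ≠ 0 := by simpa using hX
  have hconj : conj (gramDet X) ≠ 0 := by simpa using hX
  rw [straighten, straighten, gramDet_smul, normalVec_smul, hN']
  ext i j
  simp [vecMulVec_apply, Matrix.smul_mulVec, Matrix.mulVec_smul]
  field_simp

theorem continuous_straighten {T : Type*} [TopologicalSpace T] {a b : T → ℝ} {X : T → Mat23}
    (ha : Continuous a) (hb : Continuous b) (hX : Continuous X) (hX0 : ∀ t, gramDet (X t) ≠ 0) :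
    Continuous fun t => straighten (a t) (b t) (X t) := by
  have hn : Continuous fun t => normalVec (X t) := by
    unfold normalVec
    fun_prop
  have hD : Continuous fun t => gramDet (X t) := continuous_gramDet.comp hX
  have hnorm : ∀ t, ((‖gramDet (X t)‖ : ℝ) : ℂ) ≠ 0 := fun t => by simpa using hX0 t
  have hconj : ∀ t, conj (gramDet (X t)) ≠ 0 := fun t => by simpa using hX0 t
  unfold straighten
  fun_prop (disch := assumption)

theorem IsFrameOf.normalVec_eq {X : Mat23} {n : Fin 3 → ℝ} (h : IsFrameOf X n) :
    ∃ c : ℂ, normalVec X = c • cvec n := by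
  have hX0 := congrFun h.2.1 0
  have hX1 := congrFun h.2.1 1
  simp only [Matrix.mulVec, dotProduct, Fin.sum_univ_three, cvec, Pi.zero_apply] at hX0 hX1
  obtain ⟨j, hj⟩ := Function.ne_iff.1 h.1
  have hj' : (n j : ℂ) ≠ 0 := by exact_mod_cast hj
  refine ⟨normalVec X j / n j, ?_⟩
  ext i
  simp only [Pi.smul_apply, smul_eq_mul, cvec]
  field_simp
  fin_cases i <;> fin_cases j <;> simp [normalVec] <;> grind

theorem IsFrameOf.exists_straighten_eq_smul {X : Mat23} {n : Fin 3 → ℝ} (h : IsFrameOf X n)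
    (a b : ℝ) : ∃ c : ℂ, straighten a b X = c • X := by
  have hzero : X *ᵥ star (normalVec X) = 0 := by
    obtain ⟨c, hc⟩ := h.normalVec_eq
    have hstar : star (cvec n) = cvec n := by
      ext i
      simp [cvec]
    rw [hc, star_smul, hstar, Matrix.mulVec_smul, h.2.1, smul_zero]
  exact ⟨_, by rw [straighten, hzero, Matrix.zero_vecMulVec, sub_zero]⟩

theorem straighten_one_zero (X : Mat23) : straighten 1 0 X = X := by
  ext i j
  simp [straighten, vecMulVec_apply]

theorem exists_straighten_half_mulVec {X : Mat23} (hX : gramDet X ≠ 0) :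
    ∃ n : Fin 3 → ℝ, n ≠ 0 ∧ straighten (1 / 2) (1 / 2) X *ᵥ cvec n = 0 := by
  obtain ⟨c, w, hc, hu, hw⟩ := exists_unit_normal hX
  have hv : ((1 / 2 : ℝ) : ℂ) • w + ((1 / 2 : ℝ) : ℂ) • star w = cvec fun i => (w i).re := by
    ext i
    apply Complex.ext
    · simp [cvec]
      ring
    · simp [cvec]
  have hne := gramDet_straighten_ne_zero hX (a := 1 / 2) (b := 1 / 2) (by norm_num) (by norm_num)
  have hproj := straighten_eq_projectRows hc hu hw (1 / 2) (1 / 2)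
  rw [hv] at hproj
  refine ⟨_, fun h => hne ?_, by rw [hproj]; exact projectRows_mulVec _ _⟩
  rw [hproj, gramDet_projectRows, h]
  simp [cvec, dotProduct]

/-- The square root of the determinant of the Hermitian Gram matrix of the rows. -/
noncomputable def area (X : Mat23) : ℝ := √(∑ i, Complex.normSq (normalVec X i))

theorem area_sq (X : Mat23) : ((area X : ℝ) : ℂ) ^ 2 = (X * Xᴴ).det := by
  have h : area X ^ 2 = ∑ i, Complex.normSq (normalVec X i) :=
    Real.sq_sqrt (Finset.sum_nonneg fun i _ => Complex.normSq_nonneg _)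
  rw [← Complex.ofReal_pow, h]
  simp [Complex.normSq_eq_conj_mul_self, normalVec, Fin.sum_univ_three, Matrix.det_fin_two,
    Matrix.mul_apply]
  ring

theorem area_pos {X : Mat23} (hX : gramDet X ≠ 0) : 0 < area X := by
  refine Real.sqrt_pos.2 ?_
  have h : normalVec X ≠ 0 := fun h => hX (by rw [gramDet, h, zero_dotProduct])
  obtain ⟨i, hi⟩ := Function.ne_iff.1 h
  exact Finset.sum_pos' (fun i _ => Complex.normSq_nonneg _)
    ⟨i, Finset.mem_univ _, Complex.normSq_pos.2 hi⟩

theorem area_smul (c : ℂ) (X : Mat23) : area (c • X) = ‖c‖ ^ 2 * area X := by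
  rw [area, area, normalVec_smul, ← Real.sqrt_sq (sq_nonneg ‖c‖), ← Real.sqrt_mul (by positivity),
    Finset.mul_sum]
  congr 1
  refine Finset.sum_congr rfl fun i _ => ?_
  simp [Complex.normSq_eq_norm_sq]
  ring

/-- The matrix by which a second deformation multiplies a pair of rows to make them orthogonal and
of equal length. -/
noncomputable def orthonormalizer (s : ℝ) (X : Mat23) : Matrix (Fin 2) (Fin 2) ℂ :=
  (((1 - s : ℝ) : ℂ) * (X * Xᴴ).trace + (s : ℂ) * area X) • 1 + (s : ℂ) • (X * Xᴴ).adjugate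

theorem trace_mul_conjTranspose_eq_sum_normSq {m n : Type*} [Fintype m] [Fintype n]
    (X : Matrix m n ℂ) : (X * Xᴴ).trace = ((∑ i, ∑ j, Complex.normSq (X i j) : ℝ) : ℂ) := by
  simp [Matrix.trace, Matrix.mul_apply, Complex.mul_conj]

theorem sum_normSq_pos {X : Mat23} (hX : gramDet X ≠ 0) :
    0 < ∑ i, ∑ j, Complex.normSq (X i j) := by
  have h : X ≠ 0 := by
    rintro rfl
    exact hX (by simp [gramDet_eq])
  obtain ⟨i, hi⟩ := Function.ne_iff.1 h
  obtain ⟨j, hj⟩ := Function.ne_iff.1 hi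
  exact Finset.sum_pos' (fun i _ => Finset.sum_nonneg fun j _ => Complex.normSq_nonneg _)
    ⟨i, Finset.mem_univ _, Finset.sum_pos' (fun i _ => Complex.normSq_nonneg _)
      ⟨j, Finset.mem_univ _, Complex.normSq_pos.2 hj⟩⟩

theorem det_smul_one_add_smul_adjugate {R : Type*} [CommRing R] (a b : R)
    (H : Matrix (Fin 2) (Fin 2) R) : (a • (1 : Matrix (Fin 2) (Fin 2) R) + b • H.adjugate).det =
      a ^ 2 + a * b * H.trace + b ^ 2 * H.det := by
  simp [Matrix.det_fin_two, Matrix.adjugate_fin_two, Matrix.trace_fin_two]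
  ring

theorem det_orthonormalizer_ne_zero {X : Mat23} (hX : gramDet X ≠ 0) {s : ℝ} (h0 : 0 ≤ s)
    (h1 : s ≤ 1) : (orthonormalizer s X).det ≠ 0 := by
  have hT := sum_normSq_pos hX
  have hA := area_pos hX
  rw [orthonormalizer, det_smul_one_add_smul_adjugate, ← area_sq,
    trace_mul_conjTranspose_eq_sum_normSq]
  set T := ∑ i, ∑ j, Complex.normSq (X i j)
  set A := area X
  have hα : 0 < (1 - s) * T + s * A := by
    rcases h0.eq_or_lt with rfl | h0
    · simpa using hT
    · have := mul_nonneg (sub_nonneg.2 h1) hT.le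
      positivity
  set α := (1 - s) * T + s * A with hα_def
  have hdet : 0 < α ^ 2 + α * s * T + s ^ 2 * A ^ 2 := by positivity
  have hcast : ((1 - s : ℝ) : ℂ) * (T : ℂ) + (s : ℂ) * A = (α : ℂ) := by
    rw [hα_def]
    push_cast
    rfl
  rw [hcast]
  exact_mod_cast hdet.ne'

theorem orthonormalizer_smul (s : ℝ) (c : ℂ) (X : Mat23) :
    orthonormalizer s (c • X) = ((‖c‖ ^ 2 : ℝ) : ℂ) • orthonormalizer s X := by
  have h : (c • X) * (c • X)ᴴ = ((‖c‖ ^ 2 : ℝ) : ℂ) • (X * Xᴴ) := by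
    rw [Matrix.conjTranspose_smul, Matrix.smul_mul, Matrix.mul_smul, smul_smul]
    congr 1
    rw [← Complex.normSq_eq_norm_sq]
    exact Complex.mul_conj c
  rw [orthonormalizer, orthonormalizer, h, area_smul, Matrix.trace_smul, Matrix.adjugate_smul]
  ext i j
  simp
  ring

theorem orthonormalizer_zero (X : Mat23) : orthonormalizer 0 X = (X * Xᴴ).trace • 1 := by
  simp [orthonormalizer]

theorem smul_one_add_adjugate_mul_mul_self {R : Type*} [CommRing R] {a : R}
    {H : Matrix (Fin 2) (Fin 2) R} (ha : a ^ 2 = H.det) :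
    (a • 1 + H.adjugate) * (H * (a • 1 + H.adjugate)) = (a ^ 2 * (H.trace + 2 * a)) • 1 := by
  have htrace : H + H.adjugate = H.trace • 1 := by
    ext i j
    fin_cases i <;> fin_cases j <;>
      simp [Matrix.adjugate_fin_two, Matrix.trace_fin_two, add_comm]
  calc (a • 1 + H.adjugate) * (H * (a • 1 + H.adjugate))
      = a ^ 2 • (H + H.adjugate) + (2 * a * a ^ 2) • (1 : Matrix (Fin 2) (Fin 2) R) := by
        rw [mul_add H, Matrix.mul_adjugate, ← ha, add_mul, mul_add, mul_add, Matrix.mul_smul H,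
          Matrix.mul_one, Matrix.mul_smul H.adjugate a H, Matrix.adjugate_mul, ← ha]
        simp only [Matrix.smul_mul, Matrix.mul_smul, Matrix.one_mul, Matrix.mul_one]
        module
    _ = _ := by rw [htrace]; module

theorem exists_orthonormalizer_one_mul_conjTranspose (X : Mat23) : ∃ r : ℝ,
    (gramDet X ≠ 0 → 0 < r) ∧
      (orthonormalizer 1 X * X) * (orthonormalizer 1 X * X)ᴴ = (r : ℂ) • 1 := by
  refine ⟨area X ^ 2 * ((∑ i, ∑ j, Complex.normSq (X i j)) + 2 * area X), fun hX => ?_, ?_⟩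
  · have hT := sum_normSq_pos hX
    have hA := area_pos hX
    positivity
  · have hone : orthonormalizer 1 X = (area X : ℂ) • 1 + (X * Xᴴ).adjugate := by
      simp [orthonormalizer]
    have hself : (orthonormalizer 1 X)ᴴ = orthonormalizer 1 X := by
      rw [hone, Matrix.conjTranspose_add, Matrix.adjugate_conjTranspose]
      simp
    rw [Matrix.conjTranspose_mul, hself, Matrix.mul_assoc, ← Matrix.mul_assoc X, hone,
      smul_one_add_adjugate_mul_mul_self (area_sq X), trace_mul_conjTranspose_eq_sum_normSq]
    push_cast
    rfl

theorem IsFrameOf.exists_orthonormalizer_eq_smul_one {X : Mat23} {n : Fin 3 → ℝ}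
    (h : IsFrameOf X n) (s : ℝ) : ∃ c : ℂ, orthonormalizer s X = c • 1 := by
  obtain ⟨-, -, r, -, hr⟩ := h
  exact ⟨_, by
    rw [orthonormalizer, hr, Matrix.adjugate_smul, Matrix.adjugate_one, smul_smul, ← add_smul]⟩

theorem continuous_orthonormalizer :
    Continuous fun x : ℝ × Mat23 => orthonormalizer x.1 x.2 := by
  have hn : Continuous fun x : ℝ × Mat23 => area x.2 := by
    unfold area normalVec
    simp only [Complex.normSq_eq_norm_sq]
    fun_prop
  unfold orthonormalizer
  fun_prop

/-- The deformation of pairs of rows into frames which runs both deformations at once. -/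
noncomputable def deform (s : ℝ) (X : Mat23) : Mat23 :=
  orthonormalizer s (straighten (1 - s / 2) (s / 2) X) * straighten (1 - s / 2) (s / 2) X

theorem gramDet_deform_ne_zero {X : Mat23} (hX : gramDet X ≠ 0) {s : ℝ} (h0 : 0 ≤ s)
    (h1 : s ≤ 1) : gramDet (deform s X) ≠ 0 := by
  have h := gramDet_straighten_ne_zero hX (a := 1 - s / 2) (b := s / 2) (by linarith) (by linarith)
  rw [deform, gramDet_mul_left]
  exact mul_ne_zero (pow_ne_zero _ (det_orthonormalizer_ne_zero h h0 h1)) h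

theorem deform_smul (s : ℝ) {c : ℂ} (hc : c ≠ 0) {X : Mat23} (hX : gramDet X ≠ 0) :
    ∃ b : ℂ, deform s (c • X) = b • deform s X := by
  refine ⟨((‖c‖ ^ 2 : ℝ) : ℂ) * c, ?_⟩
  rw [deform, deform, straighten_smul _ _ hc hX, orthonormalizer_smul, Matrix.smul_mul,
    Matrix.mul_smul, smul_smul]

theorem exists_deform_zero_eq_smul (X : Mat23) : ∃ b : ℂ, deform 0 X = b • X :=
  ⟨_, by
    rw [deform, zero_div, sub_zero, straighten_one_zero X, orthonormalizer_zero, Matrix.smul_mul,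
      Matrix.one_mul]⟩

theorem exists_isFrameOf_deform_one {X : Mat23} (hX : gramDet X ≠ 0) :
    ∃ n, IsFrameOf (deform 1 X) n := by
  obtain ⟨n, hn, h⟩ := exists_straighten_half_mulVec hX
  have hhalf : (1 : ℝ) - 1 / 2 = 1 / 2 := by norm_num
  obtain ⟨r, hr, hmul⟩ := exists_orthonormalizer_one_mul_conjTranspose
    (straighten (1 / 2) (1 / 2) X)
  refine ⟨n, hn, ?_, r, hr (gramDet_straighten_ne_zero hX (by norm_num) (by norm_num)), ?_⟩
  · rw [deform, hhalf, ← Matrix.mulVec_mulVec, h, Matrix.mulVec_zero]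
  · rw [deform, hhalf, hmul]

theorem IsFrameOf.exists_deform_eq_smul {X : Mat23} {n : Fin 3 → ℝ} (h : IsFrameOf X n) {s : ℝ}
    (h0 : 0 ≤ s) (h1 : s ≤ 1) : ∃ b : ℂ, deform s X = b • X := by
  obtain ⟨c, hc⟩ := h.exists_straighten_eq_smul (1 - s / 2) (s / 2)
  have hne := gramDet_straighten_ne_zero h.gramDet_ne_zero (a := 1 - s / 2) (b := s / 2)
    (by linarith) (by linarith)
  have hc0 : c ≠ 0 := by
    rintro rfl
    exact hne (by rw [hc, gramDet_smul]; simp)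
  obtain ⟨d, hd⟩ := (h.smul hc0).exists_orthonormalizer_eq_smul_one s
  exact ⟨d * c, by rw [deform, hc, hd, Matrix.smul_mul, Matrix.one_mul, smul_smul]⟩

theorem ratMk_eq_of_eq_smul {X Y : NondegPair} {b : ℂ} (h : Y.1 = b • X.1) : ratMk X = ratMk Y := by
  refine (ratMk_eq_iff _ _).2 ⟨b, ?_, h⟩
  rintro rfl
  exact Y.2 (by rw [h, gramDet_smul]; simp)

/-- The deformation on nondegenerate pairs. -/
noncomputable def deformPair (s : unitInterval) (X : NondegPair) : NondegPair :=
  ⟨deform s X.1, gramDet_deform_ne_zero X.2 s.2.1 s.2.2⟩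

/-- The deformation of rational maps. -/
noncomputable def deformRat (s : unitInterval) (x : Rat2) : Rat2 :=
  ratMk (deformPair s (Function.surjInv isOpenQuotientMap_ratMk.surjective x))

theorem deformRat_ratMk (s : unitInterval) (X : NondegPair) :
    deformRat s (ratMk X) = ratMk (deformPair s X) := by
  obtain ⟨a, ha, e⟩ := (ratMk_eq_iff _ _).1
    (Function.surjInv_eq isOpenQuotientMap_ratMk.surjective (ratMk X))
  obtain ⟨b, hb⟩ := deform_smul s ha
    (Function.surjInv isOpenQuotientMap_ratMk.surjective (ratMk X)).2
  refine ratMk_eq_of_eq_smul (b := b) ?_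
  rw [← e] at hb
  exact hb

theorem continuous_deformRat : Continuous fun x : unitInterval × Rat2 => deformRat x.1 x.2 := by
  refine (IsOpenQuotientMap.id.prodMap isOpenQuotientMap_ratMk).isQuotientMap.continuous_iff.2 ?_
  have : (fun x : unitInterval × Rat2 => deformRat x.1 x.2) ∘ Prod.map id ratMk =
      fun x : unitInterval × NondegPair => ratMk (deformPair x.1 x.2) := by
    funext x
    exact deformRat_ratMk _ _
  rw [this]
  have hs : Continuous fun x : unitInterval × NondegPair =>
      straighten (1 - (x.1 : ℝ) / 2) ((x.1 : ℝ) / 2) x.2.1 :=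
    continuous_straighten (by fun_prop) (by fun_prop) (by fun_prop) fun x => x.2.2
  have hdeform : Continuous fun x : unitInterval × NondegPair => deform x.1 x.2.1 :=
    (continuous_orthonormalizer.comp (Continuous.prodMk (by fun_prop) hs)).matrix_mul hs
  exact isOpenQuotientMap_ratMk.continuous.comp
    (hdeform.subtype_mk fun x => (deformPair x.1 x.2).2)

theorem isDeformationRetract_frameSet : IsDeformationRetract frameSet := by
  have hr : Continuous (deformRat 1) :=
    continuous_deformRat.comp (f := fun x : Rat2 => ((1 : unitInterval), x)) (by fun_prop)
  refine ⟨⟨deformRat 1, hr⟩, fun x => ?_, ⟨?_⟩⟩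
  · obtain ⟨X, rfl⟩ := isOpenQuotientMap_ratMk.surjective x
    change deformRat 1 (ratMk X) ∈ frameSet
    rw [deformRat_ratMk, ratMk_mem_frameSet_iff]
    exact exists_isFrameOf_deform_one X.2
  · refine ⟨⟨⟨fun x => deformRat x.1 x.2, continuous_deformRat⟩, fun x => ?_, fun x => rfl⟩, ?_⟩
    · obtain ⟨X, rfl⟩ := isOpenQuotientMap_ratMk.surjective x
      change deformRat 0 (ratMk X) = ratMk X
      rw [deformRat_ratMk]
      obtain ⟨b, hb⟩ := exists_deform_zero_eq_smul X.1
      exact (ratMk_eq_of_eq_smul hb).symm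
    · rintro s x ⟨X, rfl, n, hn⟩
      change deformRat s (ratMk X) = ratMk X
      rw [deformRat_ratMk]
      obtain ⟨b, hb⟩ := hn.exists_deform_eq_smul s.2.1 s.2.2
      exact (ratMk_eq_of_eq_smul hb).symm

end Retraction

section Chart

open Quaternion Matrix

/-- Two orthogonal rows of equal length spanning the plane orthogonal to `(x, y, 1)`. -/
noncomputable def planeFrame (x y : ℝ) : Mat23 :=
  !![(√(1 + x ^ 2 + y ^ 2) : ℂ), 0, -(√(1 + x ^ 2 + y ^ 2) * x : ℂ);
    -(x * y : ℂ), (1 + x ^ 2 : ℂ), -(y : ℂ)]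

theorem planeFrame_mul_conjTranspose (x y : ℝ) : planeFrame x y * (planeFrame x y)ᴴ =
    (((1 + x ^ 2 + y ^ 2) * (1 + x ^ 2) : ℝ) : ℂ) • 1 := by
  have h : (√(1 + x ^ 2 + y ^ 2) : ℂ) ^ 2 = 1 + x ^ 2 + y ^ 2 := by
    have := Real.sq_sqrt (show 0 ≤ 1 + x ^ 2 + y ^ 2 by positivity)
    exact_mod_cast this
  ext i j
  fin_cases i <;> fin_cases j <;>
    simp [planeFrame, Matrix.mul_apply, Fin.sum_univ_three]
  · linear_combination (1 + (x : ℂ) ^ 2) * h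
  · ring
  · ring
  · ring

theorem isFrameOf_planeFrame (x y : ℝ) : IsFrameOf (planeFrame x y) ![x, y, 1] := by
  refine ⟨fun h => one_ne_zero (congrFun h 2), ?_, _, ?_, planeFrame_mul_conjTranspose x y⟩
  · ext i
    fin_cases i
    · simp [planeFrame, cvec, Matrix.mulVec, dotProduct, Fin.sum_univ_three]
    · simp [planeFrame, cvec, Matrix.mulVec, dotProduct, Fin.sum_univ_three]
      ring
  · positivity

/-- The parametrization of the frames near the base frame by five real parameters: the affine
coordinates of the normal of the plane, then the rotation of the rows. -/
noncomputable def chartFrame (y : EuclideanSpace ℝ (Fin 5)) : Mat23 :=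
  quatMat (quat 1 (y 2) (y 3) (y 4)) * planeFrame (y 0) (y 1)

/-- The affine coordinates of the normal of the plane of the rows, meaningful where the last
homogeneous coordinate does not vanish. -/
noncomputable def normalSlope (X : Mat23) (i : Fin 3) : ℝ := (normalVec X i / normalVec X 2).re

/-- The matrix expressing the rows of `X` in the standard frame of the same plane, up to a
positive factor. -/
noncomputable def coframe (X : Mat23) : Matrix (Fin 2) (Fin 2) ℂ :=
  X * (planeFrame (normalSlope X 0) (normalSlope X 1))ᵀ

/-- The coordinates inverse to `chartFrame`: the slopes of the normal, and the ratios of the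
imaginary parts to the real part of the quaternion that `coframe` is a multiple of. -/
noncomputable def chartCoord (X : Mat23) : EuclideanSpace ℝ (Fin 5) :=
  !₂[normalSlope X 0, normalSlope X 1, ((coframe X 0 0 - coframe X 1 1) / (coframe X).trace).im,
    (2 * coframe X 0 1 / (coframe X).trace).re, (2 * coframe X 0 1 / (coframe X).trace).im]

/-- The open set where no denominator in `chartCoord` vanishes. -/
def chartDomain : Set Mat23 := {X | normalVec X 2 ≠ 0 ∧ (coframe X).trace ≠ 0}

theorem normalSlope_smul {c : ℂ} (hc : c ≠ 0) (X : Mat23) (i : Fin 3) :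
    normalSlope (c • X) i = normalSlope X i := by
  simp only [normalSlope, normalVec_smul, Pi.smul_apply, smul_eq_mul,
    mul_div_mul_left _ _ (pow_ne_zero 2 hc)]

theorem coframe_smul {c : ℂ} (hc : c ≠ 0) (X : Mat23) : coframe (c • X) = c • coframe X := by
  rw [coframe, coframe, normalSlope_smul hc, normalSlope_smul hc, Matrix.smul_mul]

theorem chartCoord_smul {c : ℂ} (hc : c ≠ 0) (X : Mat23) : chartCoord (c • X) = chartCoord X := by
  simp only [chartCoord, normalSlope_smul hc, coframe_smul hc, Matrix.smul_apply, Matrix.trace_smul,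
    smul_eq_mul, ← mul_sub, mul_left_comm 2 c, mul_div_mul_left _ _ hc]

theorem smul_mem_chartDomain {c : ℂ} (hc : c ≠ 0) {X : Mat23} :
    c • X ∈ chartDomain ↔ X ∈ chartDomain := by
  simp [chartDomain, normalVec_smul, coframe_smul hc, hc]

theorem normalVec_mul_left (A : Matrix (Fin 2) (Fin 2) ℂ) (X : Mat23) :
    normalVec (A * X) = A.det • normalVec X := by
  ext i
  fin_cases i <;>
    simp [normalVec, Matrix.mul_apply, Fin.sum_univ_two, Matrix.det_fin_two] <;> ring

theorem normalVec_planeFrame (x y : ℝ) : normalVec (planeFrame x y) =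
    ((√(1 + x ^ 2 + y ^ 2) * (1 + x ^ 2) : ℝ) : ℂ) • cvec ![x, y, 1] := by
  ext i
  fin_cases i <;> simp [normalVec, planeFrame, cvec] <;> ring

theorem planeFrame_mul_transpose (x y : ℝ) : planeFrame x y * (planeFrame x y)ᵀ =
    (((1 + x ^ 2 + y ^ 2) * (1 + x ^ 2) : ℝ) : ℂ) • 1 := by
  rw [← planeFrame_mul_conjTranspose]
  congr 1
  ext i j
  fin_cases i <;> fin_cases j <;> simp [planeFrame]

theorem normalVec_quatMat_mul_planeFrame {q : ℍ[ℝ]} (hq : q ≠ 0) (x y : ℝ) :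
    ∃ r : ℂ, r ≠ 0 ∧ normalVec (quatMat q * planeFrame x y) = r • cvec ![x, y, 1] := by
  refine ⟨_, ?_, by rw [normalVec_mul_left, normalVec_planeFrame, smul_smul]⟩
  have hscale : 0 < √(1 + x ^ 2 + y ^ 2) * (1 + x ^ 2) := by positivity
  rw [det_quatMat]
  exact mul_ne_zero (Complex.ofReal_ne_zero.2 (normSq_ne_zero.2 hq))
    (Complex.ofReal_ne_zero.2 hscale.ne')

theorem normalSlope_quatMat_mul_planeFrame {q : ℍ[ℝ]} (hq : q ≠ 0) (x y : ℝ) (i : Fin 3) :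
    normalSlope (quatMat q * planeFrame x y) i = ![x, y, 1] i := by
  obtain ⟨r, hr, h⟩ := normalVec_quatMat_mul_planeFrame hq x y
  rw [normalSlope, h]
  simp only [cvec, Pi.smul_apply, smul_eq_mul, mul_div_mul_left _ _ hr, ← Complex.ofReal_div,
    Complex.ofReal_re]
  exact div_one _

theorem coframe_quatMat_mul_planeFrame {q : ℍ[ℝ]} (hq : q ≠ 0) (x y : ℝ) :
    coframe (quatMat q * planeFrame x y) =
      (((1 + x ^ 2 + y ^ 2) * (1 + x ^ 2) : ℝ) : ℂ) • quatMat q := by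
  rw [coframe, normalSlope_quatMat_mul_planeFrame hq, normalSlope_quatMat_mul_planeFrame hq,
    Matrix.mul_assoc]
  change _ * (planeFrame x y * (planeFrame x y)ᵀ) = _
  rw [planeFrame_mul_transpose, Matrix.mul_smul, Matrix.mul_one]

theorem trace_quatMat (q : ℍ[ℝ]) : (quatMat q).trace = ((2 * q.re : ℝ) : ℂ) := by
  apply Complex.ext
  · simp [quatMat, Matrix.trace_fin_two]
    ring
  · simp [quatMat, Matrix.trace_fin_two]

theorem quatMat_mul_planeFrame_mem_chartDomain {q : ℍ[ℝ]} (hq : q ≠ 0) (x y : ℝ) :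
    quatMat q * planeFrame x y ∈ chartDomain ↔ q.re ≠ 0 := by
  obtain ⟨r, hr, h⟩ := normalVec_quatMat_mul_planeFrame hq x y
  have hscale : 0 < (1 + x ^ 2 + y ^ 2) * (1 + x ^ 2) := by positivity
  have hnormal : normalVec (quatMat q * planeFrame x y) 2 ≠ 0 := by
    rw [h]
    simpa [cvec] using hr
  have htrace : (coframe (quatMat q * planeFrame x y)).trace =
      (((1 + x ^ 2 + y ^ 2) * (1 + x ^ 2) * (2 * q.re) : ℝ) : ℂ) := by
    rw [coframe_quatMat_mul_planeFrame hq, Matrix.trace_smul, trace_quatMat, smul_eq_mul,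
      ← Complex.ofReal_mul]
  rw [chartDomain, Set.mem_ofPred_eq, htrace, Complex.ofReal_ne_zero]
  simp [hnormal, hscale.ne']

theorem chartCoord_quatMat_mul_planeFrame {q : ℍ[ℝ]} (hq : q.re ≠ 0) (x y : ℝ) :
    chartCoord (quatMat q * planeFrame x y) =
      !₂[x, y, q.imI / q.re, q.imJ / q.re, q.imK / q.re] := by
  have hq0 : q ≠ 0 := by
    rintro rfl
    exact hq rfl
  have hscale : (((1 + x ^ 2 + y ^ 2) * (1 + x ^ 2) : ℝ) : ℂ) ≠ 0 :=
    Complex.ofReal_ne_zero.2 (by positivity)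
  simp only [chartCoord, normalSlope_quatMat_mul_planeFrame hq0, coframe_quatMat_mul_planeFrame hq0,
    Matrix.smul_apply, Matrix.trace_smul, trace_quatMat, smul_eq_mul, ← mul_sub,
    mul_left_comm (2 : ℂ) (((1 + x ^ 2 + y ^ 2) * (1 + x ^ 2) : ℝ) : ℂ),
    mul_div_mul_left _ _ hscale, Complex.div_ofReal_re, Complex.div_ofReal_im]
  ext i
  fin_cases i
  · rfl
  · rfl
  all_goals
    simp [quatMat]
    field_simp
  ring

theorem chartFrame_mem (y : EuclideanSpace ℝ (Fin 5)) : chartFrame y ∈ chartDomain := by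
  have h : quat 1 (y 2) (y 3) (y 4) ≠ 0 := fun h => one_ne_zero (congrArg QuaternionAlgebra.re h)
  exact (quatMat_mul_planeFrame_mem_chartDomain h _ _).2 one_ne_zero

theorem chartCoord_chartFrame (y : EuclideanSpace ℝ (Fin 5)) : chartCoord (chartFrame y) = y := by
  rw [chartFrame, chartCoord_quatMat_mul_planeFrame one_ne_zero]
  ext i
  fin_cases i <;> simp

theorem exists_isFrameOf_chartFrame (y : EuclideanSpace ℝ (Fin 5)) :
    ∃ n, IsFrameOf (chartFrame y) n := by
  obtain ⟨hn, hXn, r, hr, hXr⟩ := isFrameOf_planeFrame (y 0) (y 1)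
  refine ⟨_, hn, by rw [chartFrame, ← Matrix.mulVec_mulVec, hXn, Matrix.mulVec_zero],
    r * (1 + y 2 ^ 2 + y 3 ^ 2 + y 4 ^ 2), by positivity, ?_⟩
  rw [chartFrame, Matrix.conjTranspose_mul, Matrix.mul_assoc, ← Matrix.mul_assoc (planeFrame _ _),
    hXr, Matrix.smul_mul, Matrix.one_mul, Matrix.mul_smul, quatMat_mul_conjTranspose, smul_smul,
    normSq_def']
  simp

theorem quatMat_eq_smul {q : ℍ[ℝ]} (hq : q.re ≠ 0) : quatMat q =
    (q.re : ℂ) • quatMat (quat 1 (q.imI / q.re) (q.imJ / q.re) (q.imK / q.re)) := by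
  ext i j
  fin_cases i <;> fin_cases j <;> apply Complex.ext <;> simp [quatMat, mul_div_cancel₀, hq]

theorem exists_eq_smul_chartFrame {X : Mat23} {n : Fin 3 → ℝ} (hX : IsFrameOf X n)
    (hd : X ∈ chartDomain) : ∃ c : ℂ, c ≠ 0 ∧ X = c • chartFrame (chartCoord X) := by
  have hn : n 2 ≠ 0 := by
    obtain ⟨b, hb⟩ := hX.normalVec_eq
    intro h
    exact hd.1 (by simp [hb, cvec, h])
  have hnormal : (n 2)⁻¹ • n = ![n 0 / n 2, n 1 / n 2, 1] := by
    ext i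
    fin_cases i
    · exact inv_mul_eq_div _ _
    · exact inv_mul_eq_div _ _
    · exact inv_mul_cancel₀ hn
  obtain ⟨l, q, hl, rfl⟩ :=
    (isFrameOf_planeFrame _ _).exists_eq_smul (hnormal ▸ hX.smul_normal (inv_ne_zero hn))
  have hq : q.1 ≠ 0 := normSq_ne_zero.1 (by simp [q.normSq_eq_one])
  rw [smul_mem_chartDomain hl, quatMat_mul_planeFrame_mem_chartDomain hq] at hd
  rw [chartCoord_smul hl, chartCoord_quatMat_mul_planeFrame hd]
  refine ⟨l * q.1.re, mul_ne_zero hl (Complex.ofReal_ne_zero.2 hd), ?_⟩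
  rw [← smul_smul, chartFrame, quatMat_eq_smul hd, Matrix.smul_mul]
  rfl

end Chart

section SmoothStructure

open Quaternion Matrix

variable {T : Type*} [NormedAddCommGroup T] [NormedSpace ℝ T]

/-- Smoothness at a point of a family of matrices, entry by entry: the space of matrices carries
no global norm, so that `ContDiffAt` does not apply to it. -/
def SmoothEntriesAt {m n : Type*} (X : T → Matrix m n ℂ) (t : T) : Prop :=
  ∀ i j, ContDiffAt ℝ ∞ (fun s => X s i j) t

theorem SmoothEntriesAt.mul {l m n : Type*} [Fintype m] {X : T → Matrix l m ℂ}
    {Y : T → Matrix m n ℂ} {t : T} (hX : SmoothEntriesAt X t) (hY : SmoothEntriesAt Y t) :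
    SmoothEntriesAt (fun s => X s * Y s) t := fun i j => by
  simp only [Matrix.mul_apply]
  exact ContDiffAt.sum fun k _ => (hX i k).mul (hY k j)

theorem SmoothEntriesAt.transpose {m n : Type*} {X : T → Matrix m n ℂ} {t : T}
    (hX : SmoothEntriesAt X t) : SmoothEntriesAt (fun s => (X s)ᵀ) t := fun i j => hX j i

theorem smoothEntriesAt_const {m n : Type*} (X : Matrix m n ℂ) (t : T) :
    SmoothEntriesAt (fun _ => X) t := fun _ _ => contDiffAt_const

theorem contDiffAt_ofReal {n : WithTop ℕ∞} {f : T → ℝ} {t : T} (hf : ContDiffAt ℝ n f t) :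
    ContDiffAt ℝ n (fun s => (f s : ℂ)) t :=
  Complex.ofRealCLM.contDiff.contDiffAt.comp t hf

theorem contDiffAt_re {n : WithTop ℕ∞} {f : T → ℂ} {t : T} (hf : ContDiffAt ℝ n f t) :
    ContDiffAt ℝ n (fun s => (f s).re) t :=
  Complex.reCLM.contDiff.contDiffAt.comp t hf

theorem contDiffAt_im {n : WithTop ℕ∞} {f : T → ℂ} {t : T} (hf : ContDiffAt ℝ n f t) :
    ContDiffAt ℝ n (fun s => (f s).im) t :=
  Complex.imCLM.contDiff.contDiffAt.comp t hf

theorem contDiffAt_complex_mk {n : WithTop ℕ∞} {f g : T → ℝ} {t : T} (hf : ContDiffAt ℝ n f t)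
    (hg : ContDiffAt ℝ n g t) : ContDiffAt ℝ n (fun s => (⟨f s, g s⟩ : ℂ)) t := by
  simp only [Complex.mk_eq_add_mul_I]
  exact (contDiffAt_ofReal hf).add ((contDiffAt_ofReal hg).mul contDiffAt_const)

theorem smoothEntriesAt_quatMat {a b c d : T → ℝ} {t : T} (ha : ContDiffAt ℝ ∞ a t)
    (hb : ContDiffAt ℝ ∞ b t) (hc : ContDiffAt ℝ ∞ c t) (hd : ContDiffAt ℝ ∞ d t) :
    SmoothEntriesAt (fun s => quatMat (quat (a s) (b s) (c s) (d s))) t := fun i j => by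
  fin_cases i <;> fin_cases j
  · exact contDiffAt_complex_mk ha hb
  · exact contDiffAt_complex_mk hc hd
  · exact contDiffAt_complex_mk hc.neg hd
  · exact contDiffAt_complex_mk ha hb.neg

theorem smoothEntriesAt_planeFrame {a b : T → ℝ} {t : T} (ha : ContDiffAt ℝ ∞ a t)
    (hb : ContDiffAt ℝ ∞ b t) : SmoothEntriesAt (fun s => planeFrame (a s) (b s)) t := by
  have hr : ContDiffAt ℝ ∞ (fun s => √(1 + a s ^ 2 + b s ^ 2)) t :=
    ((contDiffAt_const.add (ha.pow 2)).add (hb.pow 2)).sqrt (by positivity)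
  have hr' := contDiffAt_ofReal hr
  have ha' := contDiffAt_ofReal ha
  have hb' := contDiffAt_ofReal hb
  intro i j
  fin_cases i <;> fin_cases j
  · exact hr'
  · exact contDiffAt_const
  · exact (hr'.mul ha').neg
  · exact (ha'.mul hb').neg
  · exact contDiffAt_const.add (ha'.pow 2)
  · exact hb'.neg

theorem smoothEntriesAt_chartFrame (y : EuclideanSpace ℝ (Fin 5)) :
    SmoothEntriesAt chartFrame y := by
  have h : ∀ i, ContDiffAt ℝ ∞ (fun y : EuclideanSpace ℝ (Fin 5) => y i) y := fun i => by fun_prop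
  exact (smoothEntriesAt_quatMat contDiffAt_const (h 2) (h 3) (h 4)).mul
    (smoothEntriesAt_planeFrame (h 0) (h 1))

theorem SmoothEntriesAt.frameAct {X : T → Mat23} {t : T} (hX : SmoothEntriesAt X t)
    (k : S3 × SO3) : SmoothEntriesAt (fun s => frameAct k (X s)) t :=
  ((smoothEntriesAt_const _ t).mul hX).mul (smoothEntriesAt_const _ t)

theorem SmoothEntriesAt.normalVec {X : T → Mat23} {t : T} (hX : SmoothEntriesAt X t) (i : Fin 3) :
    ContDiffAt ℝ ∞ (fun s => normalVec (X s) i) t := by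
  fin_cases i
  · exact ((hX 0 1).mul (hX 1 2)).sub ((hX 0 2).mul (hX 1 1))
  · exact ((hX 0 2).mul (hX 1 0)).sub ((hX 0 0).mul (hX 1 2))
  · exact ((hX 0 0).mul (hX 1 1)).sub ((hX 0 1).mul (hX 1 0))

theorem SmoothEntriesAt.normalSlope {X : T → Mat23} {t : T} (hX : SmoothEntriesAt X t)
    (h0 : _root_.normalVec (X t) 2 ≠ 0) (i : Fin 3) :
    ContDiffAt ℝ ∞ (fun s => normalSlope (X s) i) t :=
  contDiffAt_re (((hX.normalVec i).mul ((hX.normalVec 2).inv h0)).congr_of_eventuallyEq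
    (.of_forall fun _ => div_eq_mul_inv _ _))

theorem SmoothEntriesAt.coframe {X : T → Mat23} {t : T} (hX : SmoothEntriesAt X t)
    (h0 : _root_.normalVec (X t) 2 ≠ 0) : SmoothEntriesAt (fun s => coframe (X s)) t :=
  hX.mul (smoothEntriesAt_planeFrame (hX.normalSlope h0 0) (hX.normalSlope h0 1)).transpose

theorem SmoothEntriesAt.trace_coframe {X : T → Mat23} {t : T} (hX : SmoothEntriesAt X t)
    (h0 : _root_.normalVec (X t) 2 ≠ 0) :
    ContDiffAt ℝ ∞ (fun s => (_root_.coframe (X s)).trace) t := by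
  simp only [Matrix.trace_fin_two]
  exact (hX.coframe h0 0 0).add (hX.coframe h0 1 1)

theorem SmoothEntriesAt.chartCoord {X : T → Mat23} {t : T} (hX : SmoothEntriesAt X t)
    (h : X t ∈ chartDomain) : ContDiffAt ℝ ∞ (fun s => chartCoord (X s)) t := by
  have hB := hX.coframe h.1
  have hT := (hX.trace_coframe h.1).inv h.2
  simp only [_root_.chartCoord, div_eq_mul_inv]
  refine contDiffAt_euclidean.2 fun i => ?_
  fin_cases i
  · exact hX.normalSlope h.1 0
  · exact hX.normalSlope h.1 1
  · exact contDiffAt_im (((hB 0 0).sub (hB 1 1)).mul hT)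
  · exact contDiffAt_re ((contDiffAt_const.mul (hB 0 1)).mul hT)
  · exact contDiffAt_im ((contDiffAt_const.mul (hB 0 1)).mul hT)

theorem SmoothEntriesAt.eventually_mem_chartDomain {X : T → Mat23} {t : T}
    (hX : SmoothEntriesAt X t) (h : X t ∈ chartDomain) : ∀ᶠ s in 𝓝 t, X s ∈ chartDomain :=
  ((hX.normalVec 2).continuousAt.eventually_ne h.1).and
    ((hX.trace_coframe h.1).continuousAt.eventually_ne h.2)

theorem smoothEntriesAt_coeffs_symm (c : Fin 6 → ℂ) :
    SmoothEntriesAt (fun c => coeffs.symm c) c := by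
  have h : ∀ i, ContDiffAt ℝ ∞ (fun c : Fin 6 → ℂ => c i) c := fun i => by fun_prop
  intro i j
  fin_cases i <;> fin_cases j
  · exact h 1
  · exact (h 0).sub (h 2)
  · exact contDiffAt_const.mul ((h 0).add (h 2))
  · exact h 4
  · exact (h 3).sub (h 5)
  · exact contDiffAt_const.mul ((h 3).add (h 5))

theorem SmoothEntriesAt.coeffs {X : T → Mat23} {t : T} (hX : SmoothEntriesAt X t) :
    ContDiffAt ℝ ∞ (fun s => coeffs (X s)) t := by
  refine contDiffAt_pi.2 fun i => ?_
  simp only [coeffs_apply, div_eq_mul_inv]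
  fin_cases i
  · exact ((hX 0 1).sub (contDiffAt_const.mul (hX 0 2))).mul contDiffAt_const
  · exact hX 0 0
  · exact ((hX 0 1).neg.sub (contDiffAt_const.mul (hX 0 2))).mul contDiffAt_const
  · exact ((hX 1 1).sub (contDiffAt_const.mul (hX 1 2))).mul contDiffAt_const
  · exact hX 1 0
  · exact ((hX 1 1).neg.sub (contDiffAt_const.mul (hX 1 2))).mul contDiffAt_const

theorem isOpen_chartDomain : IsOpen chartDomain := by
  have : chartDomain = coeffs ⁻¹' {c | coeffs.symm c ∈ chartDomain} := by
    ext X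
    simp
  rw [this]
  refine IsOpen.preimage continuous_coeffs (isOpen_iff_mem_nhds.2 fun c hc => ?_)
  exact (smoothEntriesAt_coeffs_symm c).eventually_mem_chartDomain hc

theorem continuousOn_chartCoord : ContinuousOn chartCoord chartDomain := by
  intro X hX
  have h : ContinuousAt (fun c => chartCoord (coeffs.symm c)) (coeffs X) :=
    ((smoothEntriesAt_coeffs_symm _).chartCoord (by simpa using hX)).continuousAt
  have h' := h.comp continuous_coeffs.continuousAt
  simp only [Function.comp_def, LinearEquiv.symm_apply_apply] at h'
  exact h'.continuousWithinAt

theorem continuous_chartFrame : Continuous chartFrame :=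
  continuous_matrix fun i j => continuous_iff_continuousAt.2 fun y =>
    (smoothEntriesAt_chartFrame y i j).continuousAt

end SmoothStructure

section FrameAtlas

open Quaternion Matrix

/-- The frame with the given coordinates. -/
noncomputable def Frame.param (y : EuclideanSpace ℝ (Fin 5)) : Frame :=
  ⟨chartFrame y, exists_isFrameOf_chartFrame y⟩

/-- The coordinates of a point of `frameSet`, those of any frame representing it. -/
noncomputable def frameCoord (m : frameSet) : EuclideanSpace ℝ (Fin 5) :=
  chartCoord (Function.surjInv frameMk_surjective m).1

theorem frameCoord_frameMk (X : Frame) : frameCoord (frameMk X) = chartCoord X.1 := by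
  obtain ⟨a, ha, e⟩ := (frameMk_eq_iff _ _).1
    (Function.surjInv_eq frameMk_surjective (frameMk X))
  rw [frameCoord, e, chartCoord_smul ha]

/-- The domain of the coordinates `frameCoord`. -/
def frameDomain : Set frameSet := {m | (Function.surjInv frameMk_surjective m).1 ∈ chartDomain}

theorem frameMk_mem_frameDomain (X : Frame) : frameMk X ∈ frameDomain ↔ X.1 ∈ chartDomain := by
  obtain ⟨a, ha, e⟩ := (frameMk_eq_iff _ _).1
    (Function.surjInv_eq frameMk_surjective (frameMk X))
  rw [frameDomain, Set.mem_ofPred_eq, e, smul_mem_chartDomain ha]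

theorem frameMk_preimage_frameDomain :
    frameMk ⁻¹' frameDomain = Subtype.val ⁻¹' chartDomain :=
  Set.ext frameMk_mem_frameDomain

theorem isOpen_frameDomain : IsOpen frameDomain := by
  rw [← isOpenQuotientMap_frameMk.isQuotientMap.isOpen_preimage, frameMk_preimage_frameDomain]
  exact isOpen_chartDomain.preimage continuous_subtype_val

/-- The chart of `frameSet` at the base point, whose image is the whole of `ℝ⁵`. -/
noncomputable def baseChart : OpenPartialHomeomorph frameSet (EuclideanSpace ℝ (Fin 5)) where
  toFun := frameCoord
  invFun y := frameMk (.param y)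
  source := frameDomain
  target := Set.univ
  map_source' _ _ := Set.mem_univ _
  map_target' y _ := (frameMk_mem_frameDomain _).2 (chartFrame_mem y)
  left_inv' m hm := by
    obtain ⟨X, rfl⟩ := frameMk_surjective m
    rw [frameCoord_frameMk]
    obtain ⟨c, hc, e⟩ :=
      exists_eq_smul_chartFrame X.2.choose_spec ((frameMk_mem_frameDomain X).1 hm)
    exact (frameMk_eq_iff _ _).2 ⟨c, hc, e⟩
  right_inv' y _ := by
    rw [frameCoord_frameMk]
    exact chartCoord_chartFrame y
  open_source := isOpen_frameDomain
  open_target := isOpen_univ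
  continuousOn_toFun := by
    refine (isOpenQuotientMap_frameMk.isQuotientMap.continuousOn_isOpen_iff
      isOpen_frameDomain).2 ?_
    rw [frameMk_preimage_frameDomain, show frameCoord ∘ frameMk = fun X => chartCoord X.1 from
      funext frameCoord_frameMk]
    exact continuousOn_chartCoord.comp continuous_subtype_val.continuousOn fun _ h => h
  continuousOn_invFun :=
    (isOpenQuotientMap_frameMk.continuous.comp
      (continuous_chartFrame.subtype_mk _)).continuousOn

/-- The homeomorphism of the space of frames given by a pair of rotations. -/
noncomputable def pairHomeomorph (k : S3 × SO3) : frameSet ≃ₜ frameSet where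
  toFun := pairAct k
  invFun := pairAct k⁻¹
  left_inv m := by rw [← pairAct_mul, inv_mul_cancel, pairAct_one]
  right_inv m := by rw [← pairAct_mul, mul_inv_cancel, pairAct_one]
  continuous_toFun := continuous_pairAct.comp (f := fun m => (k, m)) (by fun_prop)
  continuous_invFun := continuous_pairAct.comp (f := fun m => (k⁻¹, m)) (by fun_prop)

/-- The translate of the chart at the base point by a pair of rotations. -/
noncomputable def frameChart (k : S3 × SO3) :
    OpenPartialHomeomorph frameSet (EuclideanSpace ℝ (Fin 5)) :=
  (pairHomeomorph k).symm.transOpenPartialHomeomorph baseChart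

theorem frameChart_apply (k : S3 × SO3) (m : frameSet) :
    frameChart k m = frameCoord (pairAct k⁻¹ m) := rfl

theorem frameChart_symm_apply (k : S3 × SO3) (y : EuclideanSpace ℝ (Fin 5)) :
    (frameChart k).symm y = pairAct k (frameMk (.param y)) := rfl

theorem mem_frameChart_source (k : S3 × SO3) (m : frameSet) :
    m ∈ (frameChart k).source ↔ pairAct k⁻¹ m ∈ frameDomain := Iff.rfl

theorem frameChart_target (k : S3 × SO3) : (frameChart k).target = Set.univ := rfl

theorem pairAct_symm_apply (k l : S3 × SO3) (y : EuclideanSpace ℝ (Fin 5)) :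
    pairAct l⁻¹ ((frameChart k).symm y) = frameMk ((Frame.param y).act (l⁻¹ * k)) := by
  rw [frameChart_symm_apply, ← pairAct_mul, pairAct_frameMk]

theorem frameChart_transition (k l : S3 × SO3) (y : EuclideanSpace ℝ (Fin 5)) :
    frameChart l ((frameChart k).symm y) = chartCoord (frameAct (l⁻¹ * k) (chartFrame y)) := by
  rw [frameChart_apply, pairAct_symm_apply, frameCoord_frameMk]
  rfl

theorem symm_mem_frameChart_source (k l : S3 × SO3) (y : EuclideanSpace ℝ (Fin 5)) :
    (frameChart k).symm y ∈ (frameChart l).source ↔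
      frameAct (l⁻¹ * k) (chartFrame y) ∈ chartDomain := by
  rw [mem_frameChart_source, pairAct_symm_apply, frameMk_mem_frameDomain]
  rfl

/-- A pair of rotations taking the base point to a given point. -/
noncomputable def chartIndex (m : frameSet) : S3 × SO3 := (exists_pairAct_base m).choose

theorem baseFrame_eq_chartFrame_zero : baseFrame = chartFrame 0 := by
  ext i j
  fin_cases i <;> fin_cases j <;>
    simp [baseFrame, chartFrame, quatMat, planeFrame, Matrix.mul_apply, Complex.ext_iff]

theorem mem_frameChart_chartIndex (m : frameSet) : m ∈ (frameChart (chartIndex m)).source := by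
  have h : pairAct (chartIndex m) (frameMk .base) = m := (exists_pairAct_base m).choose_spec
  rw [mem_frameChart_source]
  generalize chartIndex m = k at h ⊢
  rw [← h, ← pairAct_mul, inv_mul_cancel, pairAct_one, frameMk_mem_frameDomain]
  change baseFrame ∈ _
  rw [baseFrame_eq_chartFrame_zero]
  exact chartFrame_mem 0

noncomputable instance frameChartedSpace : ChartedSpace (EuclideanSpace ℝ (Fin 5)) frameSet where
  atlas := Set.range frameChart
  chartAt m := frameChart (chartIndex m)
  mem_chart_source := mem_frameChart_chartIndex
  chart_mem_atlas _ := ⟨_, rfl⟩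

theorem contDiffAt_transition (k : S3 × SO3) {y : EuclideanSpace ℝ (Fin 5)}
    (h : frameAct k (chartFrame y) ∈ chartDomain) :
    ContDiffAt ℝ ∞ (fun y => chartCoord (frameAct k (chartFrame y))) y :=
  ((smoothEntriesAt_chartFrame y).frameAct k).chartCoord h

theorem mem_symm_trans_source {M H : Type*} [TopologicalSpace M] [TopologicalSpace H]
    (e e' : OpenPartialHomeomorph M H) (y : H) :
    y ∈ (e.symm ≫ₕ e').source ↔ y ∈ e.target ∧ e.symm y ∈ e'.source := by
  rw [OpenPartialHomeomorph.trans_source, Set.mem_inter_iff, Set.mem_preimage]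
  rfl

theorem coe_transition (k l : S3 × SO3) : ⇑((frameChart k).symm ≫ₕ frameChart l) =
    fun y => chartCoord (frameAct (l⁻¹ * k) (chartFrame y)) := by
  funext y
  rw [OpenPartialHomeomorph.coe_trans, Function.comp_apply, frameChart_transition]

theorem contDiffOn_transition (k l : S3 × SO3) :
    ContDiffOn ℝ ∞ ((frameChart k).symm ≫ₕ frameChart l)
      ((frameChart k).symm ≫ₕ frameChart l).source := by
  intro y hy
  rw [coe_transition]
  have h := (symm_mem_frameChart_source k l y).1 ((mem_symm_trans_source _ _ _).1 hy).2
  exact (contDiffAt_transition (l⁻¹ * k) h).contDiffWithinAt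

instance frameIsManifold : IsManifold (𝓡 5) ∞ frameSet := by
  refine isManifold_of_contDiffOn _ _ _ ?_
  rintro _ _ ⟨k, rfl⟩ ⟨l, rfl⟩
  have h := contDiffOn_transition k l
  simpa using h

/-- The inverse of the chart `frameChart k`, lifted to homogeneous coordinates. -/
noncomputable def paramVec (k : S3 × SO3) (y : EuclideanSpace ℝ (Fin 5)) : Fin 6 → ℂ :=
  coeffs (frameAct k (chartFrame y))

theorem contDiff_paramVec (k : S3 × SO3) : ContDiff ℝ ∞ (paramVec k) :=
  contDiff_iff_contDiffAt.2 fun y => ((smoothEntriesAt_chartFrame y).frameAct k).coeffs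

/-- The chart `frameChart k` as a function of homogeneous coordinates. -/
noncomputable def coordVec (k : S3 × SO3) (c : Fin 6 → ℂ) : EuclideanSpace ℝ (Fin 5) :=
  chartCoord (frameAct k⁻¹ (coeffs.symm c))

theorem frameAct_inv_coeffs_symm (k : S3 × SO3) (y : EuclideanSpace ℝ (Fin 5)) :
    frameAct k⁻¹ (coeffs.symm (paramVec k y)) = chartFrame y := by
  rw [paramVec, LinearEquiv.symm_apply_apply, ← frameAct_mul, inv_mul_cancel, frameAct_one]

theorem coordVec_paramVec (k : S3 × SO3) (y : EuclideanSpace ℝ (Fin 5)) :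
    coordVec k (paramVec k y) = y := by
  rw [coordVec, frameAct_inv_coeffs_symm, chartCoord_chartFrame]

theorem contDiffAt_coordVec (k : S3 × SO3) (y : EuclideanSpace ℝ (Fin 5)) :
    ContDiffAt ℝ ∞ (coordVec k) (paramVec k y) :=
  ((smoothEntriesAt_coeffs_symm _).frameAct k⁻¹).chartCoord (by
    rw [frameAct_inv_coeffs_symm]
    exact chartFrame_mem y)

theorem coordVec_smul (k : S3 × SO3) {a : ℂ} (ha : a ≠ 0) (c : Fin 6 → ℂ) :
    coordVec k (a • c) = coordVec k c := by
  rw [coordVec, map_smul, frameAct_smul, chartCoord_smul ha, coordVec]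

theorem fderiv_smul_self_eq_zero {V F : Type*} [NormedAddCommGroup V] [NormedSpace ℂ V]
    [NormedAddCommGroup F] [NormedSpace ℝ F] {G : V → F} {v : V}
    (hG : DifferentiableAt ℝ G v) (hinv : ∀ a : ℂ, a ≠ 0 → G (a • v) = G v) (c : ℂ) :
    fderiv ℝ G v (c • v) = 0 := by
  have hline : HasDerivAt (fun t : ℝ => v + t • (c • v)) (c • v) 0 := by
    simpa using ((hasDerivAt_id (0 : ℝ)).smul_const (c • v)).const_add v
  have hGline := HasFDerivAt.comp_hasDerivAt (0 : ℝ) (l := G) (l' := fderiv ℝ G v)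
    (by simpa using hG.hasFDerivAt) hline
  have hconst : (fun t : ℝ => G (v + t • (c • v))) =ᶠ[𝓝 0] fun _ => G v := by
    have hcont : ContinuousAt (fun t : ℝ => (1 + t * c : ℂ)) 0 := by fun_prop
    filter_upwards [hcont.eventually_ne (y := 0) (by simp)] with t ht
    rw [← hinv _ ht, add_smul, one_smul, mul_smul, Complex.coe_smul]
  exact hGline.unique ((hasDerivAt_const (0 : ℝ) _).congr_of_eventuallyEq hconst)

theorem eq_zero_of_fderiv_mem_span {V F : Type*} [NormedAddCommGroup V] [NormedSpace ℂ V]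
    [NormedAddCommGroup F] [NormedSpace ℝ F] {P : F → V} {G : V → F} {y : F}
    (hP : DifferentiableAt ℝ P y) (hG : DifferentiableAt ℝ G (P y)) (hGP : ∀ x, G (P x) = x)
    (hinv : ∀ a : ℂ, a ≠ 0 → G (a • P y) = G (P y)) {ξ : F}
    (h : fderiv ℝ P y ξ ∈ Submodule.span ℂ {P y}) : ξ = 0 := by
  obtain ⟨c, hc⟩ := Submodule.mem_span_singleton.1 h
  have hcomp := hG.hasFDerivAt.comp y hP.hasFDerivAt
  rw [show G ∘ P = id from funext hGP] at hcomp
  have hξ := DFunLike.congr_fun (hcomp.unique (hasFDerivAt_id y)) ξ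
  rw [ContinuousLinearMap.comp_apply, ← hc, fderiv_smul_self_eq_zero hG hinv] at hξ
  exact hξ.symm

theorem eq_zero_of_fderiv_paramVec_mem_span (k : S3 × SO3) (y ξ : EuclideanSpace ℝ (Fin 5))
    (h : fderiv ℝ (paramVec k) y ξ ∈ Submodule.span ℂ {paramVec k y}) : ξ = 0 :=
  eq_zero_of_fderiv_mem_span ((contDiff_paramVec k).differentiable (by simp) y)
    ((contDiffAt_coordVec k y).differentiableAt (by simp)) (coordVec_paramVec k)
    (fun _ ha => coordVec_smul k ha _) h

theorem coe_symm_frameChart (k : S3 × SO3) (y : EuclideanSpace ℝ (Fin 5)) :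
    ∃ h : paramVec k y ≠ 0, (((frameChart k).symm y : frameSet) : Rat2).1 =
      Projectivization.mk ℂ (paramVec k y) h := by
  rw [frameChart_symm_apply, pairAct_frameMk]
  exact ⟨_, rfl⟩

theorem isSmoothImmersionToProj_frameSet :
    IsSmoothImmersionToProj 5 (fun m : frameSet => (m : Rat2).1) := by
  intro m
  let k := chartIndex m
  let e := frameChart k
  have hm : m ∈ e.source := mem_frameChart_chartIndex m
  have hsmooth : ContMDiffOn (𝓡 5) 𝓘(ℝ, Fin 6 → ℂ) ∞ (paramVec k ∘ e) e.source :=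
    (contDiff_paramVec k).contMDiff.comp_contMDiffOn
      (contMDiffOn_of_mem_maximalAtlas (IsManifold.subset_maximalAtlas ⟨k, rfl⟩))
  refine ⟨e.source, paramVec k ∘ e, e.open_source, hm, hsmooth, fun m' hm' => ?_, fun ξ hξ => ?_⟩
  · have h := coe_symm_frameChart k (e m')
    rwa [e.left_inv hm'] at h
  · have hdiff : MDifferentiableAt (𝓡 5) 𝓘(ℝ, Fin 6 → ℂ) (paramVec k ∘ e) m :=
      (hsmooth.contMDiffAt (e.open_source.mem_nhds hm)).mdifferentiableAt (by simp)
    have hwritten : writtenInExtChartAt (𝓡 5) 𝓘(ℝ, Fin 6 → ℂ) m (paramVec k ∘ e) = paramVec k :=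
      funext fun y => congrArg (paramVec k) (e.right_inv (Set.mem_univ y))
    rw [hdiff.mfderiv, hwritten, ModelWithCorners.Boundaryless.range_eq_univ,
      fderivWithin_univ] at hξ
    exact eq_zero_of_fderiv_paramVec_mem_span k _ ξ hξ

end FrameAtlas

section Orientation

open IsManifold

variable {n : ℕ} {M : Type*} [TopologicalSpace M]

/-- The Jacobian determinant of the coordinate change from `e` to `e'`. -/
noncomputable def chartJacobian (e e' : OpenPartialHomeomorph M (EuclideanSpace ℝ (Fin n)))
    (x : EuclideanSpace ℝ (Fin n)) : ℝ :=
  (fderiv ℝ (e.symm ≫ₕ e') x).det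

/-- A chart `e` is positive at the coordinate vector `x` if some chart of the family `A` around the
corresponding point differs from it by a coordinate change with positive Jacobian at `x`. -/
def IsPositiveAt (A : Set (OpenPartialHomeomorph M (EuclideanSpace ℝ (Fin n))))
    (e : OpenPartialHomeomorph M (EuclideanSpace ℝ (Fin n))) (x : EuclideanSpace ℝ (Fin n)) :
    Prop :=
  ∃ a ∈ A, x ∈ (e.symm ≫ₕ a).source ∧ 0 < chartJacobian e a x

variable {A : Set (OpenPartialHomeomorph M (EuclideanSpace ℝ (Fin n)))}
  {e e' f : OpenPartialHomeomorph M (EuclideanSpace ℝ (Fin n))} {x y : EuclideanSpace ℝ (Fin n)}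

theorem apply_mem_symm_trans_source (hx : x ∈ (e.symm ≫ₕ e').source)
    (hxf : x ∈ (e.symm ≫ₕ f).source) : e' (e.symm x) ∈ (e'.symm ≫ₕ f).source := by
  have hx' := ((mem_symm_trans_source _ _ _).1 hx).2
  rw [mem_symm_trans_source, e'.left_inv hx']
  exact ⟨e'.map_source hx', ((mem_symm_trans_source _ _ _).1 hxf).2⟩

theorem chartJacobian_self (hx : x ∈ e.target) : chartJacobian e e x = 1 := by
  have h : (e.symm ≫ₕ e) =ᶠ[𝓝 x] id := by
    filter_upwards [e.open_target.mem_nhds hx] with z hz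
    simp [e.right_inv hz]
  rw [chartJacobian, h.fderiv_eq, fderiv_id]
  exact LinearMap.det_id

variable [ChartedSpace (EuclideanSpace ℝ (Fin n)) M]

/-- The families of charts witnessing `IsOrientable`. -/
structure IsOrientingAtlas (A : Set (OpenPartialHomeomorph M (EuclideanSpace ℝ (Fin n)))) :
    Prop where
  subset_maximalAtlas : A ⊆ maximalAtlas (𝓡 n) ∞ M
  exists_mem_source : ∀ m : M, ∃ a ∈ A, m ∈ a.source
  chartJacobian_pos : ∀ a ∈ A, ∀ b ∈ A, ∀ x ∈ (a.symm ≫ₕ b).source, 0 < chartJacobian a b x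

theorem contDiffAt_of_mem_maximalAtlas (he : e ∈ maximalAtlas (𝓡 n) ∞ M)
    (he' : e' ∈ maximalAtlas (𝓡 n) ∞ M) (hx : x ∈ (e.symm ≫ₕ e').source) :
    ContDiffAt ℝ ∞ (e.symm ≫ₕ e') x :=
  (contMDiffOn_of_mem_contDiffGroupoid
    (compatible_of_mem_maximalAtlas he he')).contDiffOn.contDiffAt
    ((e.symm ≫ₕ e').open_source.mem_nhds hx)

theorem chartJacobian_mul (he : e ∈ maximalAtlas (𝓡 n) ∞ M) (he' : e' ∈ maximalAtlas (𝓡 n) ∞ M)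
    (hf : f ∈ maximalAtlas (𝓡 n) ∞ M) (hx : x ∈ (e.symm ≫ₕ e').source)
    (hxf : x ∈ (e.symm ≫ₕ f).source) :
    chartJacobian e f x = chartJacobian e' f (e' (e.symm x)) * chartJacobian e e' x := by
  have hee' := (contDiffAt_of_mem_maximalAtlas he he' hx).differentiableAt (by simp)
  have he'f := (contDiffAt_of_mem_maximalAtlas he' hf
    (apply_mem_symm_trans_source hx hxf)).differentiableAt (by simp)
  have hcomp : (e.symm ≫ₕ f) =ᶠ[𝓝 x] (e'.symm ≫ₕ f) ∘ (e.symm ≫ₕ e') := by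
    filter_upwards [(e.symm ≫ₕ e').open_source.mem_nhds hx] with z hz
    simp [e'.left_inv ((mem_symm_trans_source _ _ _).1 hz).2]
  rw [chartJacobian, hcomp.fderiv_eq, fderiv_comp x he'f hee']
  exact LinearMap.det_comp _ _

theorem chartJacobian_ne_zero (he : e ∈ maximalAtlas (𝓡 n) ∞ M)
    (he' : e' ∈ maximalAtlas (𝓡 n) ∞ M) (hx : x ∈ (e.symm ≫ₕ e').source) :
    chartJacobian e e' x ≠ 0 := by
  have hx' := ((mem_symm_trans_source _ _ _).1 hx).1
  have h := chartJacobian_mul he he' he hx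
    ((mem_symm_trans_source _ _ _).2 ⟨hx', e.map_target hx'⟩)
  rw [chartJacobian_self hx'] at h
  exact right_ne_zero_of_mul (h ▸ one_ne_zero)

theorem continuousAt_chartJacobian (he : e ∈ maximalAtlas (𝓡 n) ∞ M)
    (he' : e' ∈ maximalAtlas (𝓡 n) ∞ M) (hx : x ∈ (e.symm ≫ₕ e').source) :
    ContinuousAt (chartJacobian e e') x :=
  ContinuousLinearMap.continuous_det.continuousAt.comp
    ((contDiffAt_of_mem_maximalAtlas he he' hx).fderiv_right (m := 0) (by simp)).continuousAt

theorem IsOrientingAtlas.isPositiveAt_iff_chartJacobian_pos (hA : IsOrientingAtlas A)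
    (he : e ∈ maximalAtlas (𝓡 n) ∞ M) (hf : f ∈ A) (hx : x ∈ (e.symm ≫ₕ f).source) :
    IsPositiveAt A e x ↔ 0 < chartJacobian e f x := by
  refine ⟨fun ⟨a, ha, hxa, hpos⟩ => ?_, fun h => ⟨f, hf, hx, h⟩⟩
  rw [chartJacobian_mul he (hA.subset_maximalAtlas ha) (hA.subset_maximalAtlas hf) hxa hx]
  exact mul_pos (hA.chartJacobian_pos a ha f hf _ (apply_mem_symm_trans_source hxa hx)) hpos

theorem IsOrientingAtlas.exists_mem_symm_trans_source (hA : IsOrientingAtlas A)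
    (hx : x ∈ e.target) : ∃ a ∈ A, x ∈ (e.symm ≫ₕ a).source :=
  let ⟨a, ha, hxa⟩ := hA.exists_mem_source (e.symm x)
  ⟨a, ha, (mem_symm_trans_source e a x).2 ⟨hx, hxa⟩⟩

theorem IsOrientingAtlas.eventually_isPositiveAt_iff (hA : IsOrientingAtlas A)
    (he : e ∈ maximalAtlas (𝓡 n) ∞ M) (hx : x ∈ e.target) :
    ∀ᶠ z in 𝓝 x, IsPositiveAt A e x ↔ IsPositiveAt A e z := by
  obtain ⟨a, ha, hxa⟩ := hA.exists_mem_symm_trans_source hx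
  have ha' := hA.subset_maximalAtlas ha
  have hsign : ∀ᶠ z in 𝓝 x, 0 < chartJacobian e a x ↔ 0 < chartJacobian e a z := by
    have hcont := continuousAt_chartJacobian he ha' hxa
    rcases (chartJacobian_ne_zero he ha' hxa).lt_or_gt with h | h
    · filter_upwards [hcont.eventually_lt_const h] with z hz
      exact iff_of_false h.not_gt hz.not_gt
    · filter_upwards [hcont.eventually_const_lt h] with z hz
      exact iff_of_true h hz
  filter_upwards [hsign, (e.symm ≫ₕ a).open_source.mem_nhds hxa] with z hz hza
  rwa [hA.isPositiveAt_iff_chartJacobian_pos he ha hxa,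
    hA.isPositiveAt_iff_chartJacobian_pos he ha hza]

theorem IsOrientingAtlas.isPositiveAt_iff_of_isPreconnected (hA : IsOrientingAtlas A)
    (he : e ∈ maximalAtlas (𝓡 n) ∞ M) (hconn : IsPreconnected e.target) (hx : x ∈ e.target)
    (hy : y ∈ e.target) : IsPositiveAt A e x ↔ IsPositiveAt A e y :=
  hconn.induction₂ (fun x y => IsPositiveAt A e x ↔ IsPositiveAt A e y)
    (fun _ hz => (hA.eventually_isPositiveAt_iff he hz).filter_mono nhdsWithin_le_nhds)
    (fun _ _ _ _ _ _ => Iff.trans) (fun _ _ _ _ => Iff.symm) hx hy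

theorem IsOrientingAtlas.chartJacobian_pos_iff (hA : IsOrientingAtlas A)
    (he : e ∈ maximalAtlas (𝓡 n) ∞ M) (he' : e' ∈ maximalAtlas (𝓡 n) ∞ M)
    (hx : x ∈ (e.symm ≫ₕ e').source) :
    0 < chartJacobian e e' x ↔ (IsPositiveAt A e x ↔ IsPositiveAt A e' (e' (e.symm x))) := by
  obtain ⟨a, ha, hxa⟩ :=
    hA.exists_mem_symm_trans_source ((mem_symm_trans_source _ _ _).1 hx).1
  have ha' := hA.subset_maximalAtlas ha
  have hya := apply_mem_symm_trans_source hx hxa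
  rw [hA.isPositiveAt_iff_chartJacobian_pos he ha hxa,
    hA.isPositiveAt_iff_chartJacobian_pos he' ha hya, chartJacobian_mul he he' ha' hx hxa]
  rcases (chartJacobian_ne_zero he' ha' hya).lt_or_gt with h | h
  · rw [← smul_eq_mul, smul_pos_iff_of_neg_left h, iff_false_right h.not_gt, not_lt]
    exact (chartJacobian_ne_zero he he' hx).symm.le_iff_lt.symm
  · rw [mul_pos_iff_of_pos_left h, iff_true_right h]

end Orientation

section NonOrientable

open Quaternion Matrix IsManifold

/-- The one-parameter group of unit quaternions covering the rotations about the first axis. -/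
noncomputable def rollQuat (s : ℝ) : S3 := ⟨quat (Real.cos s) (Real.sin s) 0 0, by
  rw [mem_S3_iff]
  simp⟩

/-- The one-parameter group of simultaneous rotations of the source and the target sphere about the
first axis. -/
noncomputable def roll (s : ℝ) : S3 × SO3 := (rollQuat s, rot (rollQuat s))

theorem rollQuat_add (s t : ℝ) : rollQuat (s + t) = rollQuat s * rollQuat t := by
  refine Subtype.ext ?_
  change quat _ _ _ _ = quat _ _ _ _ * quat _ _ _ _
  rw [Real.cos_add, Real.sin_add]
  refine Quaternion.ext _ _ ?_ ?_ ?_ ?_ <;> simp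
  ring

theorem roll_add (s t : ℝ) : roll (s + t) = roll s * roll t := by
  simp [roll, rollQuat_add]

theorem roll_zero : roll 0 = 1 := by
  have h := roll_add 0 0
  rw [add_zero] at h
  exact mul_eq_left.1 h.symm

theorem inv_roll_mul_roll (s t : ℝ) : (roll s)⁻¹ * roll t = roll (t - s) := by
  rw [inv_mul_eq_iff_eq_mul, ← roll_add, add_sub_cancel]

theorem smoothEntriesAt_roll (p : ℝ × EuclideanSpace ℝ (Fin 5)) :
    SmoothEntriesAt (fun p : ℝ × EuclideanSpace ℝ (Fin 5) => frameAct (roll p.1) (chartFrame p.2))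
      p := by
  have hc : ContDiffAt ℝ ∞ (fun p : ℝ × EuclideanSpace ℝ (Fin 5) => Real.cos p.1) p := by fun_prop
  have hs : ContDiffAt ℝ ∞ (fun p : ℝ × EuclideanSpace ℝ (Fin 5) => Real.sin p.1) p := by fun_prop
  have h1 : SmoothEntriesAt (fun p : ℝ × EuclideanSpace ℝ (Fin 5) =>
      quatMat (quat (Real.cos p.1) (Real.sin p.1) 0 0)) p :=
    smoothEntriesAt_quatMat hc hs contDiffAt_const contDiffAt_const
  have h2 : SmoothEntriesAt (fun p : ℝ × EuclideanSpace ℝ (Fin 5) => chartFrame p.2) p :=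
    fun i j => (smoothEntriesAt_chartFrame p.2 i j).comp p contDiffAt_snd
  have h3 : SmoothEntriesAt (fun p : ℝ × EuclideanSpace ℝ (Fin 5) => cmat (rot (rollQuat p.1))) p :=
    fun i j => by
      refine contDiffAt_ofReal (f := fun p : ℝ × EuclideanSpace ℝ (Fin 5) =>
        rotMat (quat (Real.cos p.1) (Real.sin p.1) 0 0) i j) ?_
      fin_cases i <;> fin_cases j <;>
        simp only [rotMat, quat, Fin.zero_eta, Fin.mk_one, Fin.reduceFinMk, Matrix.of_apply,
          Matrix.cons_val] <;> fun_prop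
  exact (h1.mul h2).mul h3.transpose

theorem eventually_det_fderiv_pos {T E : Type*} [NormedAddCommGroup T] [NormedSpace ℝ T]
    [NormedAddCommGroup E] [NormedSpace ℝ E] {F : T × E → E} {t : T} {x : E}
    (hF : ContDiffAt ℝ 1 F (t, x)) (hid : ∀ y, F (t, y) = y) :
    ∀ᶠ s in 𝓝 t, 0 < (fderiv ℝ (fun y => F (s, y)) x).det := by
  have hline : ContinuousAt (fun s : T => (s, x)) t := by fun_prop
  have hpartial : ∀ᶠ s in 𝓝 t, fderiv ℝ (fun y => F (s, y)) x =
      (fderiv ℝ F (s, x)).comp (ContinuousLinearMap.inr ℝ T E) := by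
    filter_upwards [hline.eventually (hF.eventually (by simp))] with s hs
    exact ((hs.differentiableAt (by simp)).hasFDerivAt.comp x (hasFDerivAt_prodMk_right s x)).fderiv
  have hcont : ContinuousAt (fun s => fderiv ℝ (fun y => F (s, y)) x) t := by
    have h : ContinuousAt (fun s => fderiv ℝ F (s, x)) t :=
      (hF.fderiv_right (m := 0) (by simp)).continuousAt.comp (f := fun s => (s, x)) hline
    exact (h.clm_comp continuousAt_const).congr (hpartial.mono fun _ hs => hs.symm)
  refine (ContinuousLinearMap.continuous_det.continuousAt.comp hcont).eventually_const_lt ?_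
  have hdet : (ContinuousLinearMap.id ℝ E).det = 1 := LinearMap.det_id
  simp [hid, hdet]

theorem eventually_frameAct_roll_mem_chartDomain :
    ∀ᶠ θ : ℝ in 𝓝 0, frameAct (roll θ) (chartFrame 0) ∈ chartDomain := by
  have hline : ContinuousAt (fun θ : ℝ => (θ, (0 : EuclideanSpace ℝ (Fin 5)))) 0 := by fun_prop
  refine hline.eventually ((smoothEntriesAt_roll (0, 0)).eventually_mem_chartDomain ?_)
  rw [roll_zero, frameAct_one]
  exact chartFrame_mem 0

theorem eventually_det_fderiv_roll_pos : ∀ᶠ θ : ℝ in 𝓝 0,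
    0 < (fderiv ℝ (fun y => chartCoord (frameAct (roll θ) (chartFrame y))) 0).det := by
  have hid : ∀ y, frameAct (roll 0) (chartFrame y) = chartFrame y := fun y => by
    rw [roll_zero, frameAct_one]
  refine eventually_det_fderiv_pos
    (F := fun p : ℝ × EuclideanSpace ℝ (Fin 5) => chartCoord (frameAct (roll p.1) (chartFrame p.2)))
    (((smoothEntriesAt_roll (0, 0)).chartCoord ?_).of_le (by simp)) fun y => ?_
  · rw [hid]
    exact chartFrame_mem 0
  · rw [hid, chartCoord_chartFrame]

theorem frameAct_roll_half_pi (y : EuclideanSpace ℝ (Fin 5)) :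
    frameAct (roll (Real.pi / 2)) (chartFrame y) = -Complex.I •
      (quatMat (quat (-1) (-y 2) (y 3) (y 4)) * planeFrame (-y 0) (y 1)) := by
  have hq : (rollQuat (Real.pi / 2)).1 = quat 0 1 0 0 := by simp [rollQuat]
  rw [frameAct, roll, cmat, coe_rot, hq, chartFrame]
  ext i j
  fin_cases i <;> fin_cases j <;> apply Complex.ext <;>
    simp [quatMat, planeFrame, rotMat, Matrix.mul_apply, Fin.sum_univ_three] <;> ring

theorem chartCoord_roll_half_pi (y : EuclideanSpace ℝ (Fin 5)) :
    chartCoord (frameAct (roll (Real.pi / 2)) (chartFrame y)) =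
      !₂[-y 0, y 1, y 2, -y 3, -y 4] := by
  rw [frameAct_roll_half_pi, chartCoord_smul (by simp),
    chartCoord_quatMat_mul_planeFrame (by simp)]
  simp [div_neg]

theorem frameAct_roll_half_pi_mem (y : EuclideanSpace ℝ (Fin 5)) :
    frameAct (roll (Real.pi / 2)) (chartFrame y) ∈ chartDomain := by
  rw [frameAct_roll_half_pi, smul_mem_chartDomain (by simp),
    quatMat_mul_planeFrame_mem_chartDomain]
  · simp
  · intro h
    simpa using congrArg QuaternionAlgebra.re h

theorem det_fderiv_roll_half_pi (y : EuclideanSpace ℝ (Fin 5)) :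
    (fderiv ℝ (fun y => chartCoord (frameAct (roll (Real.pi / 2)) (chartFrame y))) y).det = -1 := by
  let σ := (Matrix.toLpLin 2 2 (Matrix.diagonal ![-1, 1, 1, -1, (-1 : ℝ)])).toContinuousLinearMap
  have e : (fun y => chartCoord (frameAct (roll (Real.pi / 2)) (chartFrame y))) = σ := by
    funext y
    rw [chartCoord_roll_half_pi]
    ext i
    fin_cases i <;> simp [σ, Matrix.toLpLin_apply, Matrix.mulVec_diagonal]
  rw [e, σ.fderiv]
  change LinearMap.det (Matrix.toLpLin 2 2 (Matrix.diagonal ![-1, 1, 1, -1, (-1 : ℝ)])) = -1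
  rw [LinearMap.det_toLpLin, Matrix.det_diagonal]
  simp [Fin.prod_univ_five]

theorem chartJacobian_frameChart (k l : S3 × SO3) (y : EuclideanSpace ℝ (Fin 5)) :
    chartJacobian (frameChart k) (frameChart l) y =
      (fderiv ℝ (fun y => chartCoord (frameAct (l⁻¹ * k) (chartFrame y))) y).det := by
  rw [chartJacobian, coe_transition]

theorem frameChart_mem_maximalAtlas (k : S3 × SO3) :
    frameChart k ∈ maximalAtlas (𝓡 5) ∞ frameSet :=
  subset_maximalAtlas ⟨k, rfl⟩

theorem isPositiveAt_frameChart_iff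
    {A : Set (OpenPartialHomeomorph frameSet (EuclideanSpace ℝ (Fin 5)))} (hA : IsOrientingAtlas A)
    (k : S3 × SO3) (x y : EuclideanSpace ℝ (Fin 5)) :
    IsPositiveAt A (frameChart k) x ↔ IsPositiveAt A (frameChart k) y :=
  hA.isPositiveAt_iff_of_isPreconnected (frameChart_mem_maximalAtlas k) isPreconnected_univ
    (Set.mem_univ _) (Set.mem_univ _)

theorem det_fderiv_transition_pos_iff
    {A : Set (OpenPartialHomeomorph frameSet (EuclideanSpace ℝ (Fin 5)))} (hA : IsOrientingAtlas A)
    {k l : S3 × SO3} (h : frameAct (l⁻¹ * k) (chartFrame 0) ∈ chartDomain) :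
    0 < (fderiv ℝ (fun y => chartCoord (frameAct (l⁻¹ * k) (chartFrame y))) 0).det ↔
      (IsPositiveAt A (frameChart k) 0 ↔ IsPositiveAt A (frameChart l) 0) := by
  have hsource : 0 ∈ ((frameChart k).symm ≫ₕ frameChart l).source := by
    rw [mem_symm_trans_source, frameChart_target, symm_mem_frameChart_source]
    exact ⟨Set.mem_univ _, h⟩
  rw [← chartJacobian_frameChart, hA.chartJacobian_pos_iff (frameChart_mem_maximalAtlas k)
    (frameChart_mem_maximalAtlas l) hsource, isPositiveAt_frameChart_iff hA l]

theorem not_isOrientable_frameSet : ¬ IsOrientable 5 frameSet := by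
  rintro ⟨A, hmax, hcover, hpos⟩
  have hA : IsOrientingAtlas A := ⟨hmax, hcover, hpos⟩
  have hlocal : ∀ θ, ∀ᶠ φ in 𝓝 θ,
      IsPositiveAt A (frameChart (roll θ)) 0 ↔ IsPositiveAt A (frameChart (roll φ)) 0 := fun θ => by
    have hsub : Filter.Tendsto (fun φ => φ - θ) (𝓝 θ) (𝓝 0) := by
      simpa using (continuous_sub_right θ).tendsto θ
    filter_upwards [hsub.eventually eventually_frameAct_roll_mem_chartDomain,
      hsub.eventually eventually_det_fderiv_roll_pos] with φ hmem hdet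
    rw [← inv_roll_mul_roll] at hmem hdet
    exact ((det_fderiv_transition_pos_iff hA hmem).1 hdet).symm
  have hconst : IsPositiveAt A (frameChart (roll (Real.pi / 2))) 0 ↔
      IsPositiveAt A (frameChart (roll 0)) 0 :=
    PreconnectedSpace.induction₂'
      (fun θ φ => IsPositiveAt A (frameChart (roll θ)) 0 ↔ IsPositiveAt A (frameChart (roll φ)) 0)
      (fun θ => (hlocal θ).mono fun _ h => ⟨h, h.symm⟩) ⟨fun _ _ _ => Iff.trans⟩ _ _
  have hroll : (roll 0)⁻¹ * roll (Real.pi / 2) = roll (Real.pi / 2) := by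
    rw [inv_roll_mul_roll, sub_zero]
  have hdet := (det_fderiv_transition_pos_iff hA (by
    rw [hroll]
    exact frameAct_roll_half_pi_mem 0)).2 hconst
  rw [hroll, det_fderiv_roll_half_pi] at hdet
  linarith

end NonOrientable

theorem theorem2p1 :
    ∃ (M : Set Rat2) (_ : ChartedSpace (EuclideanSpace ℝ (Fin 5)) M) (_ : IsManifold (𝓡 5) ∞ M)
      (_ : MulAction SO3 M) (proj : M → RP2),
      -- `M` is a compact non-orientable smooth 5-manifold, smoothly embedded in `Rat₂`
      IsCompact M ∧ T2Space M ∧ SecondCountableTopology M ∧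
      IsSmoothImmersionToProj 5 (fun m : M => (m : Rat2).1) ∧
      ¬ IsOrientable 5 M ∧
      -- `M` is a deformation retract of `Rat₂`
      IsDeformationRetract M ∧
      -- `M` is a non-trivial principal `SO(3)`-bundle over the projective plane
      IsPrincipalBundle SO3 proj ∧
      ¬ IsTrivialPrincipalBundle SO3 proj ∧
      -- every non-trivial principal `SO(3)`-bundle over the projective plane is isomorphic to it
      ∀ (P : Type u) [TopologicalSpace P] [MulAction SO3 P] (proj' : P → RP2),
        IsPrincipalBundle SO3 proj' → ¬ IsTrivialPrincipalBundle SO3 proj' →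
          PrincipalBundleIso SO3 proj proj' := by
  have hP := isPrincipalBundle_frameProj
  refine ⟨frameSet, frameChartedSpace, frameIsManifold, frameAction, frameProj,
    isCompact_iff_compactSpace.2 inferInstance, inferInstance, inferInstance,
    isSmoothImmersionToProj_frameSet, not_isOrientable_frameSet, isDeformationRetract_frameSet,
    hP, hasClutching_frameProj.not_isTrivial, fun P _ _ proj' hP' hnt => ?_⟩
  rcases exists_hasClutching hP' with h | h
  · exact absurd (h.isTrivial hP') hnt
  · exact hasClutching_frameProj.iso hP hP' h
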